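/- **Setting.** Let $l>0$, $I=(-\frac l2,\frac l2)$, $S=I\times(-\frac12,\frac12)$, $\Gamma=\partial I\times(-\frac12,\frac12)$. Let $Q_W^2,Q_R^2$ be quadratic forms on $\mathbb R^{2\times2}$ that depend only on the symmetric part of a matrix and are positive definite on symmetric matrices. For $T\in\{W,R\}$ put $$Q_T^1(a,b)=\min_{\alpha\in\mathbb R}Q_T^2\begin{pmatrix}a&b\\ b&\alpha\end{pmatrix},\qquad Q_T^0(a)=\min_{z\in\mathbb R}Q_T^1(a,z)=C_T^0a^2 .$$ Let $\hat u_1\in W^{1,2}(I)$, $\hat u_2,\hat v\in W^{2,2}(I)$, $f,g_1,g_2\in L^2(I)$. Write $W^{k,2}_{\hat h}(I)=\hat h+W^{k,2}_0(I)$ and $$\mathcal K=W^{1,2}_{\hat u_1}(I)\times W^{2,2}_{\hat u_2}(I)\times W^{2,2}_{\hat v}(I)\times W^{1,2}_0(I).$$ Let $BN$ be the set of $y\in W^{1,2}(S;\mathbb R^2)$ with $e(y)_{12}=e(y)_{22}=0$, where $e(y)=\frac12(\nabla y+\nabla y^T)$, and $y_1=\hat u_1-x_2\hat u_2'$, $y_2=\hat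 u_2$ on $\Gamma$ in the sense of traces. On $\mathscr S=BN\times W^{2,2}_{\hat v}(I)\times W^{1,2}_0(I)$ define $\mathcal D_0\ge 0$ and $\phi_0$ by $$\mathcal D_0((y,w,\theta),(\tilde y,\tilde w,\tilde\theta))^2=\int_SQ_R^0\Big(\partial_1y_1-\partial_1\tilde y_1+\tfrac{|w'|^2}2-\tfrac{|\tilde w'|^2}2\Big)+\tfrac1{12}\int_IQ_R^1(w''-\tilde w'',\theta'-\tilde\theta'),$$ $$\phi_0(y,w,\theta)=\tfrac12\int_SQ_W^0\Big(\partial_1y_1+\tfrac{|w'|^2}2\Big)+\tfrac1{24}\int_IQ_W^1(w'',\theta')-\int_S\big(fw+g_1y_1+g_2y_2\big),$$ where functions on $I$ are regarded as functions on $S$ independent of $x_2$. We say that $(\xi_1,\xi_2,w,\theta)$ is *identified* with $(y,w,\theta)\in\mathscr S$ if $y_1(x)=\xi_1(x_1)-x_2\xi_2'(x_1)$ and $y_2(x)=\xi_2(x_1)$. A curve $z$ in $\mathscr S$ is absolutely continuous on an interval $J$ if $\mathcal D_0(z(s),z(t))\le\int_s^tm$ for $s\le t$ in $J$ with some $m\in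 L^1(J)$; a curve on $[0,\infty)$ is absolutely continuous if it is so on each $[0,T]$. Its metric derivative is $|z'|(t)=\lim_{s\to t}\mathcal D_0(z(s),z(t))/|s-t|$ (a.e. $t$). The local slope is $|\partial\phi_0|(u)=\limsup_{v\to u}(\phi_0(u)-\phi_0(v))^+/\mathcal D_0(u,v)$. A function $g:\mathscr S\to[0,\infty]$ is a strong upper gradient for $\phi_0$ if, along every absolutely continuous curve $z:(a,b)\to\mathscr S$, $g\circ z$ is Borel and $|\phi_0(z(t))-\phi_0(z(s))|\le\int_s^tg(z(r))|z'|(r)\,dr$ for $a<s\le t<b$. A *curve of maximal slope* (for $\phi_0$ with respect to $|\partial\phi_0|$) is an absolutely continuous curve $z:[0,\infty)\to\mathscr S$ with $\frac{d}{dt}\phi_0(z(t))\le-\frac12|z'|^2(t)-\frac12|\partial\phi_0|^2(z(t))$ for a.e. $t>0$. A *discrete solution* with step $\tau>0$ from $z^0$ is a map $\bar U_\tau$ with $\bar U_\tau(0)=U^0=z^0$ and $\bar U_\tau(t)=U^n$ for $t\in((n-1)\tau,n\tau]$, where $U^n$ minimizes $v\mapsto\frac1{2\tau}\mathcal D_0(v,U^{n-1})^2+\phi_0(v)$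 over $\mathscr S$, $n\ge1$. A curve $(\xi_1,\xi_2,w,\theta):[0,\infty)\to\mathcal K$ is said to be of class $W^{1,2}([0,\infty);\mathcal K)$ if it is bounded and is the time integral of a derivative $(\partial_t\xi_1,\partial_t\xi_2,\partial_tw,\partial_t\theta)\in L^2\big((0,\infty);W^{1,2}(I)\times W^{2,2}(I)\times W^{2,2}(I)\times W^{1,2}(I)\big)$. It is a *weak solution* with given initial datum if it attains this datum at $t=0$, is of this class, and for a.e. $t>0$ $$\begin{aligned}0&=\int_I\Big(C_W^0\big(\xi_1'+\tfrac{|w'|^2}2\big)+C_R^0(\partial_t\xi_1'+w'\partial_tw')\Big)\varphi_1'-\int_Ig_1\varphi_1,\\ 0&=\int_I\tfrac1{12}\big(C_W^0\xi_2''+C_R^0\partial_t\xi_2''\big)\varphi_2''-\int_Ig_2\varphi_2,\\ 0&=\int_I\Big(C_W^0\big(\xi_1'+\tfrac{|w'|^2}2\big)+C_R^0(\partial_t\xi_1'+w'\partial_tw')\Big)w'\varphi_w'+\tfrac1{24}\int_I\big(\partial_1Q_W^1(w'',\theta')+\partial_1Q_R^1(\partial_tw'',\partial_t\theta')\big)\varphi_w''-\int_If\varphi_w,\\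 0&=\int_I\big(\partial_2Q_W^1(w'',\theta')+\partial_2Q_R^1(\partial_tw'',\partial_t\theta')\big)\varphi_\theta'\end{aligned}$$ for all $\varphi_1,\varphi_\theta\in W^{1,2}_0(I)$ and $\varphi_2,\varphi_w\in W^{2,2}_0(I)$. **Theorem.** The local slope $|\partial\phi_0|$ is a strong upper gradient for $\phi_0$, and the following holds. (i) (Approximation and existence) Let $(\xi_1^0,\xi_2^0,w^0,\theta^0)\in\mathcal K$. It is identified with exactly one $z^0=(y^0,w^0,\theta^0)\in\mathscr S$, where $y^0=(\xi_1^0-x_2(\xi_2^0)',\xi_2^0)$. For every $\tau>0$ a discrete solution from $z^0$ exists. For every sequence $\tau_j>0$ with $\tau_j\to0$ and all discrete solutions $\bar U_{\tau_j}$ from $z^0$ there is a curve of maximal slope $z=(y,w,\theta):[0,\infty)\to\mathscr S$ with $z(0)=z^0$ such that, along a subsequence that does not depend on $t$, $\mathcal D_0(\bar U_{\tau_j}(t),z(t))\to0$ for all $t\ge0$. (ii) (Identification) For every curve of maximal slope $(y,w,\theta)$ there is a curve $(\xi_1,\xi_2,w,\theta)\in W^{1,2}([0,\infty);\mathcal K)$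 that is identified with $(y(t),w(t),\theta(t))$ for every $t\ge0$ and is a weak solution; its initial datum is the one identified with $(y(0),w(0),\theta(0))$. -/

import Mathlib

open MeasureTheory Set Filter Topology
open scoped ContDiff

namespace Ribbon

noncomputable section

/-! ## Curves, slopes and minimizing movements for a distance `d` on a set `X` -/

section Metric

variable {X : Type*}

/-- Absolute continuity of `z` on the interval `J` with respect to `d`:
`d (z s) (z t) ≤ ∫ₛᵗ m` for some `m ∈ L¹(J)`. -/
def ACOn (d : X → X → ℝ) (z : ℝ → X) (J : Set ℝ) : Prop :=
  ∃ m : ℝ → ℝ, IntegrableOn m J ∧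
    ∀ s ∈ J, ∀ t ∈ J, s ≤ t → d (z s) (z t) ≤ ∫ r in s..t, m r

/-- The metric derivative `lim_{s → t} d (z s) (z t) / |s - t|`, written as an upper limit
(for an absolutely continuous curve in a metric space the limit exists at a.e. `t`). -/
def metricDeriv (d : X → X → ℝ) (z : ℝ → X) (t : ℝ) : ENNReal :=
  limsup (fun s => ENNReal.ofReal (d (z s) (z t) / |s - t|)) (𝓝[≠] t)

/-- The local slope `limsup_{v → u} (φ u - φ v)⁺ / d u v`. The filter is `d u v → 0` with
`0 < d u v`, and `ENNReal.ofReal` takes the positive part. -/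
def localSlope (d : X → X → ℝ) (φ : X → ℝ) (u : X) : ENNReal :=
  limsup (fun v => ENNReal.ofReal ((φ u - φ v) / d u v)) (comap (fun v => d u v) (𝓝[>] 0))

/-- `g` is a strong upper gradient for `φ`: along every absolutely continuous curve on an
interval `(a, b)` the function `g ∘ z` is Borel and
`|φ (z t) - φ (z s)| ≤ ∫ₛᵗ g (z r) |z'|(r) dr` (the right-hand side may be infinite). -/
def IsStrongUpperGradient (d : X → X → ℝ) (φ : X → ℝ) (g : X → ENNReal) : Prop :=
  ∀ (a b : ℝ) (z : ℝ → X), ACOn d z (Ioo a b) →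
    Measurable (fun t : Ioo a b => g (z t)) ∧
    ∀ s t : ℝ, a < s → s ≤ t → t < b →
      ENNReal.ofReal |φ (z t) - φ (z s)| ≤ ∫⁻ r in Ioo s t, g (z r) * metricDeriv d z r

/-- Absolute continuity of a curve defined on `[0, ∞)`: on every bounded interval. (Curves on
`[0, ∞)` are maps on `ℝ` whose values at negative times play no role.) -/
def IsACCurve (d : X → X → ℝ) (z : ℝ → X) : Prop :=
  ∀ T : ℝ, 0 < T → ACOn d z (Icc 0 T)

/-- `z : [0, ∞) → X` is a curve of maximal slope for `φ` with respect to `g`: it is absolutely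
continuous and `d/dt φ(z(t)) ≤ - |z'|²(t) / 2 - g(z(t))² / 2` for a.e. `t > 0`; the derivative
exists and both terms on the right-hand side are finite for a.e. `t`. -/
def IsCurveOfMaximalSlope (d : X → X → ℝ) (φ : X → ℝ) (g : X → ENNReal) (z : ℝ → X) : Prop :=
  IsACCurve d z ∧
  ∀ᵐ t ∂(volume.restrict (Ioi (0 : ℝ))),
    metricDeriv d z t ≠ ⊤ ∧ g (z t) ≠ ⊤ ∧
    ∃ δ : ℝ, HasDerivAt (fun s => φ (z s)) δ t ∧
      δ ≤ - (1 / 2) * (metricDeriv d z t).toReal ^ 2 - (1 / 2) * (g (z t)).toReal ^ 2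

/-- Time-incremental minimization with time step `τ` and initial datum `z₀`: `U (n + 1)`
minimizes `v ↦ d(v, U n)² / (2 τ) + φ v` over `X`. -/
def IsDiscreteSolution (d : X → X → ℝ) (φ : X → ℝ) (τ : ℝ) (z₀ : X) (U : ℕ → X) : Prop :=
  U 0 = z₀ ∧ ∀ n : ℕ, ∀ v : X,
    1 / (2 * τ) * d (U (n + 1)) (U n) ^ 2 + φ (U (n + 1)) ≤ 1 / (2 * τ) * d v (U n) ^ 2 + φ v

/-- Piecewise constant interpolation: the value at `0` is `U 0` and the value on
`((n - 1) τ, n τ]` is `U n`. -/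
def interpolation (τ : ℝ) (U : ℕ → X) (t : ℝ) : X := U ⌈t / τ⌉₊

end Metric

/-! ## Sobolev functions on `I = (-l/2, l/2)` and on `S = I × (-1/2, 1/2)` -/

/-- The interval `I`. -/
def I (l : ℝ) : Set ℝ := Ioo (-(l / 2)) (l / 2)

/-- The rectangle `S`. -/
def S (l : ℝ) : Set (ℝ × ℝ) := I l ×ˢ Ioo (-(1 / 2)) (1 / 2)

/-- `L²(I)`. -/
abbrev L2I (l : ℝ) : Type := Lp ℝ 2 (volume.restrict (I l))

/-- `L²(S)`. -/
abbrev L2S (l : ℝ) : Type := Lp ℝ 2 (volume.restrict (S l))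

/-- Integration by parts without boundary terms: `∫ u (D φ) = - ∫ g φ` for all `φ ∈ T`. -/
def IBP {α : Type*} [MeasurableSpace α] (μ : Measure α) (T : Set (α → ℝ))
    (D : (α → ℝ) → (α → ℝ)) (u g : α → ℝ) : Prop :=
  ∀ φ ∈ T, ∫ x, u x * D φ x ∂μ = - ∫ x, g x * φ x ∂μ

section IBPSpace

variable {α : Type*} [MeasurableSpace α] {μ : Measure α}

theorem integrable_mul_Lp (u : Lp ℝ 2 μ) {ψ : α → ℝ} (hψ : MemLp ψ 2 μ) :
    Integrable (fun x => u x * ψ x) μ :=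
  (Lp.memLp u).integrable_mul hψ

theorem integral_add_Lp (u v : Lp ℝ 2 μ) {ψ : α → ℝ} (hψ : MemLp ψ 2 μ) :
    ∫ x, (u + v : Lp ℝ 2 μ) x * ψ x ∂μ = ∫ x, u x * ψ x ∂μ + ∫ x, v x * ψ x ∂μ := by
  rw [← integral_add (integrable_mul_Lp u hψ) (integrable_mul_Lp v hψ)]
  refine integral_congr_ae ?_
  filter_upwards [Lp.coeFn_add u v] with x hx
  rw [hx, Pi.add_apply, add_mul]

theorem integral_smul_Lp (c : ℝ) (u : Lp ℝ 2 μ) (ψ : α → ℝ) :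
    ∫ x, (c • u : Lp ℝ 2 μ) x * ψ x ∂μ = c * ∫ x, u x * ψ x ∂μ := by
  rw [← integral_const_mul]
  refine integral_congr_ae ?_
  filter_upwards [Lp.coeFn_smul c u] with x hx
  rw [hx, Pi.smul_apply, smul_eq_mul, mul_assoc]

theorem continuous_integral_Lp {ψ : α → ℝ} (hψ : MemLp ψ 2 μ) :
    Continuous (fun u : Lp ℝ 2 μ => ∫ x, u x * ψ x ∂μ) := by
  have h : (fun u : Lp ℝ 2 μ => ∫ x, u x * ψ x ∂μ) = fun u => inner ℝ (hψ.toLp ψ) u := by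
    funext u
    rw [L2.inner_def]
    refine integral_congr_ae ?_
    filter_upwards [hψ.coeFn_toLp] with x hx
    simp [hx]
  rw [h]
  fun_prop

/-- The space of all pairs `(u, g)` of square integrable functions that satisfy
`∫ u (D φ) = - ∫ g φ` for all `φ ∈ T`. -/
def ibpSpace (μ : Measure α) (T : Set (α → ℝ)) (D : (α → ℝ) → (α → ℝ))
    (hT : ∀ φ ∈ T, MemLp φ 2 μ ∧ MemLp (D φ) 2 μ) : Submodule ℝ (Lp ℝ 2 μ × Lp ℝ 2 μ) where
  carrier := {p | IBP μ T D p.1 p.2}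
  zero_mem' := by
    intro φ hφ
    have h := integral_smul_Lp (0 : ℝ) (0 : Lp ℝ 2 μ)
    simp only [zero_smul, zero_mul] at h
    simp only [Prod.fst_zero, Prod.snd_zero, h, neg_zero]
  add_mem' := by
    intro p q hp hq φ hφ
    obtain ⟨h0, h1⟩ := hT φ hφ
    simp only [Prod.fst_add, Prod.snd_add]
    rw [integral_add_Lp _ _ h1, integral_add_Lp _ _ h0, hp φ hφ, hq φ hφ]
    ring
  smul_mem' := by
    intro c p hp φ hφ
    simp only [Prod.smul_fst, Prod.smul_snd]
    rw [integral_smul_Lp, integral_smul_Lp, hp φ hφ]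
    ring

theorem isClosed_ibpSpace (T : Set (α → ℝ)) (D : (α → ℝ) → (α → ℝ))
    (hT : ∀ φ ∈ T, MemLp φ 2 μ ∧ MemLp (D φ) 2 μ) :
    IsClosed (ibpSpace μ T D hT : Set (Lp ℝ 2 μ × Lp ℝ 2 μ)) := by
  have h : (ibpSpace μ T D hT : Set (Lp ℝ 2 μ × Lp ℝ 2 μ)) =
      ⋂ φ ∈ T, {p | ∫ x, p.1 x * D φ x ∂μ = - ∫ x, p.2 x * φ x ∂μ} := by
    ext p
    simp [ibpSpace, IBP]
  rw [h]
  refine isClosed_biInter fun φ hφ => ?_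
  exact isClosed_eq ((continuous_integral_Lp (hT φ hφ).2).comp continuous_fst)
    ((continuous_integral_Lp (hT φ hφ).1).comp continuous_snd).neg

end IBPSpace

theorem memLp_of_isCompact {E : Type*} [NormedAddCommGroup E] [MeasureSpace E] [BorelSpace E]
    [SecondCountableTopology E] [IsFiniteMeasureOnCompacts (volume : Measure E)] {s : Set E}
    (hs : IsCompact s) {ψ : E → ℝ} (hψ : Continuous ψ) : MemLp ψ 2 (volume.restrict s) := by
  obtain ⟨C, hC⟩ := hs.exists_bound_of_continuousOn hψ.continuousOn
  have : IsFiniteMeasure (volume.restrict s) := ⟨by simpa using hs.measure_lt_top⟩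
  exact MemLp.of_bound hψ.aestronglyMeasurable C
    ((ae_restrict_iff' hs.measurableSet).2 (Eventually.of_forall hC))

theorem memLp_I (l : ℝ) {ψ : ℝ → ℝ} (hψ : Continuous ψ) :
    MemLp ψ 2 (volume.restrict (I l)) := by
  have h : MemLp ψ 2 (volume.restrict (Icc (-(l / 2)) (l / 2))) :=
    memLp_of_isCompact isCompact_Icc hψ
  exact h.mono_measure (Measure.restrict_mono Ioo_subset_Icc_self le_rfl)

theorem memLp_S (l : ℝ) {ψ : ℝ × ℝ → ℝ} (hψ : Continuous ψ) :
    MemLp ψ 2 (volume.restrict (S l)) := by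
  have h : MemLp ψ 2 (volume.restrict
      (Icc (-(l / 2)) (l / 2) ×ˢ Icc (-(1 / 2) : ℝ) (1 / 2))) :=
    memLp_of_isCompact (isCompact_Icc.prod isCompact_Icc) hψ
  exact h.mono_measure
    (Measure.restrict_mono (Set.prod_mono Ioo_subset_Icc_self Ioo_subset_Icc_self) le_rfl)

/-- `C_c^∞(Ω)`. -/
def testFunctions {E : Type*} [NormedAddCommGroup E] [NormedSpace ℝ E] (Ω : Set E) :
    Set (E → ℝ) :=
  {φ | ContDiff ℝ ∞ φ ∧ HasCompactSupport φ ∧ tsupport φ ⊆ Ω}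

/-- Smooth functions on the line, with no condition on the support. -/
def smoothFunctions : Set (ℝ → ℝ) := {φ | ContDiff ℝ ∞ φ}

/-- The partial derivative with respect to the first variable. -/
def pd1 (φ : ℝ × ℝ → ℝ) : ℝ × ℝ → ℝ := fun p => fderiv ℝ φ p (1, 0)

/-- The partial derivative with respect to the second variable. -/
def pd2 (φ : ℝ × ℝ → ℝ) : ℝ × ℝ → ℝ := fun p => fderiv ℝ φ p (0, 1)

theorem memLp_smooth (l : ℝ) : ∀ φ ∈ smoothFunctions,
    MemLp φ 2 (volume.restrict (I l)) ∧ MemLp (deriv φ) 2 (volume.restrict (I l)) := by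
  intro φ hφ
  have hφ' : ContDiff ℝ ∞ φ := hφ
  exact ⟨memLp_I l hφ'.continuous, memLp_I l (hφ'.continuous_deriv (by simp))⟩

theorem memLp_test (l : ℝ) : ∀ φ ∈ testFunctions (I l),
    MemLp φ 2 (volume.restrict (I l)) ∧ MemLp (deriv φ) 2 (volume.restrict (I l)) :=
  fun φ hφ => memLp_smooth l φ hφ.1

theorem memLp_test1 (l : ℝ) : ∀ φ ∈ testFunctions (S l),
    MemLp φ 2 (volume.restrict (S l)) ∧ MemLp (pd1 φ) 2 (volume.restrict (S l)) := by
  intro φ hφ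
  have h := hφ.1.continuous_fderiv (by simp)
  exact ⟨memLp_S l hφ.1.continuous, memLp_S l (h.clm_apply continuous_const)⟩

theorem memLp_test2 (l : ℝ) : ∀ φ ∈ testFunctions (S l),
    MemLp φ 2 (volume.restrict (S l)) ∧ MemLp (pd2 φ) 2 (volume.restrict (S l)) := by
  intro φ hφ
  have h := hφ.1.continuous_fderiv (by simp)
  exact ⟨memLp_S l hφ.1.continuous, memLp_S l (h.clm_apply continuous_const)⟩

/-- `W^{1,2}(I)` as the space of pairs `(u, u')`, where `u'` is the weak derivative of `u`. -/
def W12sub (l : ℝ) : Submodule ℝ (L2I l × L2I l) :=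
  ibpSpace (volume.restrict (I l)) (testFunctions (I l)) deriv (memLp_test l)

/-- `W_0^{1,2}(I)`: pairs `(u, u')` such that `∫_I u φ' = - ∫_I u' φ` for *all* smooth `φ`. For
`φ ∈ C_c^∞(I)` this says that `u'` is the weak derivative; for general `φ` it says that the
boundary term `u(l/2) φ(l/2) - u(-l/2) φ(-l/2)` vanishes, i.e. that `u = 0` on `∂I`. -/
def W12zero (l : ℝ) : Submodule ℝ (L2I l × L2I l) :=
  ibpSpace (volume.restrict (I l)) smoothFunctions deriv (memLp_smooth l)

/-- `W^{2,2}(I)` as the space of triples `(u, u', u'')` of weak derivatives. -/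
def W22sub (l : ℝ) : Submodule ℝ (L2I l × L2I l × L2I l) :=
  (W12sub l).comap ((LinearMap.fst ℝ (L2I l) (L2I l × L2I l)).prod
    (LinearMap.fst ℝ (L2I l) (L2I l) ∘ₗ LinearMap.snd ℝ (L2I l) (L2I l × L2I l))) ⊓
  (W12sub l).comap (LinearMap.snd ℝ (L2I l) (L2I l × L2I l))

/-- `W_0^{2,2}(I)`: triples `(u, u', u'')` such that `u = u' = 0` on `∂I`. -/
def W22zero (l : ℝ) : Submodule ℝ (L2I l × L2I l × L2I l) :=
  (W12zero l).comap ((LinearMap.fst ℝ (L2I l) (L2I l × L2I l)).prod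
    (LinearMap.fst ℝ (L2I l) (L2I l) ∘ₗ LinearMap.snd ℝ (L2I l) (L2I l × L2I l))) ⊓
  (W12zero l).comap (LinearMap.snd ℝ (L2I l) (L2I l × L2I l))

/-- `W^{1,2}(S)` as the space of triples `(u, ∂₁u, ∂₂u)` of weak partial derivatives. -/
def W12Ssub (l : ℝ) : Submodule ℝ (L2S l × L2S l × L2S l) :=
  (ibpSpace (volume.restrict (S l)) (testFunctions (S l)) pd1 (memLp_test1 l)).comap
    ((LinearMap.fst ℝ (L2S l) (L2S l × L2S l)).prod
      (LinearMap.fst ℝ (L2S l) (L2S l) ∘ₗ LinearMap.snd ℝ (L2S l) (L2S l × L2S l))) ⊓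
  (ibpSpace (volume.restrict (S l)) (testFunctions (S l)) pd2 (memLp_test2 l)).comap
    ((LinearMap.fst ℝ (L2S l) (L2S l × L2S l)).prod
      (LinearMap.snd ℝ (L2S l) (L2S l) ∘ₗ LinearMap.snd ℝ (L2S l) (L2S l × L2S l)))

/-- The norms of `W12sub` and `W22sub` (the largest of the `L²` norms of the function and its
derivatives) are equivalent to the usual ones, and the spaces are complete. -/
instance (l : ℝ) : CompleteSpace (W12sub l) :=
  (isClosed_ibpSpace _ _ (memLp_test l)).completeSpace_coe

instance (l : ℝ) : CompleteSpace (W22sub l) := by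
  have h1 : IsClosed (W12sub l : Set (L2I l × L2I l)) := isClosed_ibpSpace _ _ (memLp_test l)
  have h2 : IsClosed (W22sub l : Set (L2I l × L2I l × L2I l)) :=
    (h1.preimage (f := fun p : L2I l × L2I l × L2I l => (p.1, p.2.1)) (by fun_prop)).inter
      (h1.preimage (f := fun p : L2I l × L2I l × L2I l => p.2) (by fun_prop))
  exact h2.completeSpace_coe

/-- A function `u ∈ W^{1,2}(S)` with weak derivative `∂₁u = g` vanishes on
`Γ = ∂I × (-1/2, 1/2)` in the sense of traces: in Green's formula
`∫_S u ∂₁φ + ∫_S g φ = ∫_{x₁ = l/2} u φ dx₂ - ∫_{x₁ = -l/2} u φ dx₂`, where `φ` is supported in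
`ℝ × (-1/2, 1/2)` and need not vanish near `Γ`, the right-hand side is always zero. -/
def VanishesOnGamma (l : ℝ) (u g : ℝ × ℝ → ℝ) : Prop :=
  IBP (volume.restrict (S l)) (testFunctions (univ ×ˢ Ioo (-(1 / 2)) (1 / 2))) pd1 u g

/-! ## Effective quadratic forms -/

/-- A quadratic form on `ℝ^{2×2}` that depends only on the symmetric part and is positive
definite on symmetric matrices. -/
def IsAdmissibleForm (Q : QuadraticForm ℝ (Matrix (Fin 2) (Fin 2) ℝ)) : Prop :=
  (∀ A, Q A = Q ((1 / 2 : ℝ) • (A + A.transpose))) ∧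
  ∀ A : Matrix (Fin 2) (Fin 2) ℝ, A.IsSymm → A ≠ 0 → 0 < Q A

/-- `Q¹(a, b) = min_α Q²(a, b, α)`, with `(a, b, α)` identified with a symmetric matrix. -/
def form1 (Q : QuadraticForm ℝ (Matrix (Fin 2) (Fin 2) ℝ)) (a b : ℝ) : ℝ :=
  ⨅ α : ℝ, Q !![a, b; b, α]

/-- `Q⁰(a) = min_z Q¹(a, z)`. -/
def form0 (Q : QuadraticForm ℝ (Matrix (Fin 2) (Fin 2) ℝ)) (a : ℝ) : ℝ :=
  ⨅ z : ℝ, form1 Q a z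

/-- The constant `C⁰` in `Q⁰(a) = C⁰ a²`. -/
def const0 (Q : QuadraticForm ℝ (Matrix (Fin 2) (Fin 2) ℝ)) : ℝ := form0 Q 1

/-- `∂₁Q¹(a, b)`. -/
def form1_d1 (Q : QuadraticForm ℝ (Matrix (Fin 2) (Fin 2) ℝ)) (a b : ℝ) : ℝ :=
  deriv (fun s => form1 Q s b) a

/-- `∂₂Q¹(a, b)`. -/
def form1_d2 (Q : QuadraticForm ℝ (Matrix (Fin 2) (Fin 2) ℝ)) (a b : ℝ) : ℝ :=
  deriv (fun s => form1 Q a s) b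

/-! ## The state spaces -/

/-- `W^{1,2}(I)`, `W^{2,2}(I)` and `W^{1,2}(S)` as types. -/
abbrev W12 (l : ℝ) : Type := W12sub l
abbrev W22 (l : ℝ) : Type := W22sub l
abbrev W12S (l : ℝ) : Type := W12Ssub l

/-- `u` and its weak derivative. -/
abbrev W12.fn {l : ℝ} (u : W12 l) : ℝ → ℝ := u.1.1
abbrev W12.d {l : ℝ} (u : W12 l) : ℝ → ℝ := u.1.2

/-- `u` and its first and second weak derivatives. -/
abbrev W22.fn {l : ℝ} (u : W22 l) : ℝ → ℝ := u.1.1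
abbrev W22.d {l : ℝ} (u : W22 l) : ℝ → ℝ := u.1.2.1
abbrev W22.dd {l : ℝ} (u : W22 l) : ℝ → ℝ := u.1.2.2

/-- `u` and its weak partial derivatives. -/
abbrev W12S.fn {l : ℝ} (u : W12S l) : ℝ × ℝ → ℝ := u.1.1
abbrev W12S.d1 {l : ℝ} (u : W12S l) : ℝ × ℝ → ℝ := u.1.2.1
abbrev W12S.d2 {l : ℝ} (u : W12S l) : ℝ × ℝ → ℝ := u.1.2.2

/-- The space `𝒮^{1D} = BN_{(û₁, û₂)}(S; ℝ²) × W_{v̂}^{2,2}(I) × W_0^{1,2}(I)`. The in-plane part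
`y = (y₁, y₂) ∈ W^{1,2}(S; ℝ²)` satisfies `e(y)₁₂ = e(y)₂₂ = 0`, and `y₁ = û₁ - x₂ û₂'`,
`y₂ = û₂` on `Γ` in the sense of traces. -/
@[ext]
structure S1D (l : ℝ) (u₁hat : W12 l) (u₂hat vhat : W22 l) where
  y₁ : W12S l
  y₂ : W12S l
  w : W22 l
  θ : W12 l
  e₁₂ : ∀ᵐ p ∂(volume.restrict (S l)), (1 / 2) * (y₁.d2 p + y₂.d1 p) = 0
  e₂₂ : ∀ᵐ p ∂(volume.restrict (S l)), y₂.d2 p = 0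
  y₁_on_Γ : VanishesOnGamma l
    (fun p => y₁.fn p - (u₁hat.fn p.1 - p.2 * u₂hat.d p.1))
    (fun p => y₁.d1 p - (u₁hat.d p.1 - p.2 * u₂hat.dd p.1))
  y₂_on_Γ : VanishesOnGamma l
    (fun p => y₂.fn p - u₂hat.fn p.1) (fun p => y₂.d1 p - u₂hat.d p.1)
  w_bdry : (w - vhat : W22 l).1 ∈ W22zero l
  θ_bdry : θ.1 ∈ W12zero l

/-- The space `W^{1,2}(I) × W^{2,2}(I) × W^{2,2}(I) × W^{1,2}(I)`, without boundary conditions. -/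
abbrev V (l : ℝ) : Type := W12 l × W22 l × W22 l × W12 l

abbrev V.ξ₁ {l : ℝ} (k : V l) : W12 l := k.1
abbrev V.ξ₂ {l : ℝ} (k : V l) : W22 l := k.2.1
abbrev V.w {l : ℝ} (k : V l) : W22 l := k.2.2.1
abbrev V.θ {l : ℝ} (k : V l) : W12 l := k.2.2.2

/-- `𝒦 = W_{û₁}^{1,2}(I) × W_{û₂}^{2,2}(I) × W_{v̂}^{2,2}(I) × W_0^{1,2}(I)`. -/
def K (l : ℝ) (u₁hat : W12 l) (u₂hat vhat : W22 l) : Set (V l) :=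
  {k | (V.ξ₁ k - u₁hat : W12 l).1 ∈ W12zero l ∧ (V.ξ₂ k - u₂hat : W22 l).1 ∈ W22zero l ∧
    (V.w k - vhat : W22 l).1 ∈ W22zero l ∧ (V.θ k).1 ∈ W12zero l}

section

variable {l : ℝ} {u₁hat : W12 l} {u₂hat vhat : W22 l}

/-- The identification of `(ξ₁, ξ₂, w, θ)` with `(y, w, θ)`: `y₁(x) = ξ₁(x₁) - x₂ ξ₂'(x₁)` and
`y₂(x) = ξ₂(x₁)`. -/
def Identified (k : V l) (z : S1D l u₁hat u₂hat vhat) : Prop :=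
  (∀ᵐ p ∂(volume.restrict (S l)), z.y₁.fn p = (V.ξ₁ k).fn p.1 - p.2 * (V.ξ₂ k).d p.1) ∧
  (∀ᵐ p ∂(volume.restrict (S l)), z.y₂.fn p = (V.ξ₂ k).fn p.1) ∧
  z.w = V.w k ∧ z.θ = V.θ k

/-- The metric `𝒟₀`. -/
def D0 (QR : QuadraticForm ℝ (Matrix (Fin 2) (Fin 2) ℝ))
    (z z' : S1D l u₁hat u₂hat vhat) : ℝ :=
  Real.sqrt
    ((∫ p in S l, form0 QR
        (z.y₁.d1 p - z'.y₁.d1 p + (z.w.d p.1) ^ 2 / 2 - (z'.w.d p.1) ^ 2 / 2))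
      + 1 / 12 * ∫ x in I l, form1 QR (z.w.dd x - z'.w.dd x) (z.θ.d x - z'.θ.d x))

/-- The energy `φ₀` with vertical force `f` and horizontal force `(g₁, g₂)`. -/
def phi0 (QW : QuadraticForm ℝ (Matrix (Fin 2) (Fin 2) ℝ)) (f g₁ g₂ : L2I l)
    (z : S1D l u₁hat u₂hat vhat) : ℝ :=
  1 / 2 * (∫ p in S l, form0 QW (z.y₁.d1 p + (z.w.d p.1) ^ 2 / 2))
    + 1 / 24 * (∫ x in I l, form1 QW (z.w.dd x) (z.θ.d x))
    - ∫ p in S l, (f p.1 * z.w.fn p.1 + (g₁ p.1 * z.y₁.fn p + g₂ p.1 * z.y₂.fn p))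

/-- The local slope `|∂φ₀|` with respect to `𝒟₀`. -/
def slope0 (QW QR : QuadraticForm ℝ (Matrix (Fin 2) (Fin 2) ℝ)) (f g₁ g₂ : L2I l) :
    S1D l u₁hat u₂hat vhat → ENNReal :=
  localSlope (D0 QR) (phi0 QW f g₁ g₂)

end

/-! ## Weak solutions of the one-dimensional system -/

/-- The weak form of the system at a fixed time, for the state `k = (ξ₁, ξ₂, w, θ)` with time
derivative `k' = (∂ₜξ₁, ∂ₜξ₂, ∂ₜw, ∂ₜθ)`. A test function `φ` in `W_0^{1,2}(I)` or `W_0^{2,2}(I)` is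
given together with its weak derivatives, as `(φ, φ')` or `(φ, φ', φ'')`. -/
def WeakEquations {l : ℝ} (QW QR : QuadraticForm ℝ (Matrix (Fin 2) (Fin 2) ℝ))
    (f g₁ g₂ : L2I l) (k k' : V l) : Prop :=
  (∀ φ ∈ W12zero l,
    0 = (∫ x in I l,
          (const0 QW * ((V.ξ₁ k).d x + ((V.w k).d x) ^ 2 / 2)
            + const0 QR * ((V.ξ₁ k').d x + (V.w k).d x * (V.w k').d x)) * φ.2 x)
        - ∫ x in I l, g₁ x * φ.1 x) ∧
  (∀ φ ∈ W22zero l,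
    0 = (∫ x in I l,
          1 / 12 * (const0 QW * (V.ξ₂ k).dd x + const0 QR * (V.ξ₂ k').dd x) * φ.2.2 x)
        - ∫ x in I l, g₂ x * φ.1 x) ∧
  (∀ φ ∈ W22zero l,
    0 = (∫ x in I l,
          (const0 QW * ((V.ξ₁ k).d x + ((V.w k).d x) ^ 2 / 2)
            + const0 QR * ((V.ξ₁ k').d x + (V.w k).d x * (V.w k').d x))
              * (V.w k).d x * φ.2.1 x)
        + 1 / 24 * (∫ x in I l,
          (form1_d1 QW ((V.w k).dd x) ((V.θ k).d x)
            + form1_d1 QR ((V.w k').dd x) ((V.θ k').d x)) * φ.2.2 x)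
        - ∫ x in I l, f x * φ.1 x) ∧
  (∀ φ ∈ W12zero l,
    0 = ∫ x in I l,
          (form1_d2 QW ((V.w k).dd x) ((V.θ k).d x)
            + form1_d2 QR ((V.w k').dd x) ((V.θ k').d x)) * φ.2 x)

/-- The curve `k : [0, ∞) → 𝒦` is of class `W^{1,2}` in time with time derivative `k'`: it takes
values in `𝒦`, is bounded, and is the integral of `k' ∈ L²((0, ∞); V)`. -/
def IsW12Curve {l : ℝ} (u₁hat : W12 l) (u₂hat vhat : W22 l) (k k' : ℝ → V l) : Prop :=
  (∀ t, 0 ≤ t → k t ∈ K l u₁hat u₂hat vhat) ∧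
  (∃ C : ℝ, ∀ t, 0 ≤ t → ‖k t‖ ≤ C) ∧
  MemLp k' 2 (volume.restrict (Ioi (0 : ℝ))) ∧
  ∀ t, 0 ≤ t → k t = k 0 + ∫ r in (0 : ℝ)..t, k' r

/-- `k` is a weak solution of the one-dimensional system with initial datum `k₀`. -/
def IsWeakSolution {l : ℝ} (QW QR : QuadraticForm ℝ (Matrix (Fin 2) (Fin 2) ℝ))
    (u₁hat : W12 l) (u₂hat vhat : W22 l) (f g₁ g₂ : L2I l) (k₀ : V l) (k : ℝ → V l) : Prop :=
  k 0 = k₀ ∧ ∃ k' : ℝ → V l, IsW12Curve u₁hat u₂hat vhat k k' ∧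
    ∀ᵐ t ∂(volume.restrict (Ioi (0 : ℝ))), WeakEquations QW QR f g₁ g₂ (k t) (k' t)

end

end Ribbon

/-!
The theorem is about a gradient flow on an affine Banach space whose distance is the chordal
distance of an embedding into a Hilbert space.

A Bernoulli–Navier displacement has the form `y₁ = ξ₁ - x₂ ξ₂'`, `y₂ = ξ₂` (`exists_profile`), and
its boundary conditions on `Γ` are those of `ξ₁`, `ξ₂` and `ξ₂'` on `∂I`. Hence `𝒮` is in bijection
with the space `V0` of admissible directions `h`, where `h` stands for the state `k₀ + h` and `k₀`
carries the boundary values (`dirEquiv`). Completing squares in the effective forms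
(`exists_form1_eq`) and integrating over `x₂` gives
`𝒟₀ = ‖R (P x) - R (P y)‖` and `φ₀ = ‖W (P x)‖² / 2 - ℓ x + const` (`D0_eq`, `phi0_eq`), where
`P = (ξ₁' + |w'|² / 2, ξ₂'', w'', θ')` is a quadratic map into `L²(I)⁴` and `R`, `W` are invertible
linear operators.

The Poincaré inequality shows that `P` is coercive and that `‖x - y‖ ≤ C ‖P x - P y‖` on bounded
sets (`exists_strain_bounded`, `exists_strain_lower`). Although `ξ₁'` is only a strain minus
`|w'|² / 2`, the loads grow at most linearly in `P`, since the mean of `|w'|² / 2` is controlled by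
that of the first strain (`exists_xi1_bound`). So `𝒟₀` and the Riemannian metric `‖R (P'(x) h)‖`
agree to first order, and there is a locally Lipschitz gradient `F` of `φ₀`, given by
`⟪A F, A h⟫ = dφ₀ h` with `A = R P'`. These are the properties collected in `GradSystem`, and they
yield everything else:

* the local slope is `‖A F‖` (`localSlope_eq`), and it is a strong upper gradient by the chain rule
  along absolutely continuous curves (`isStrongUpperGradient`);
* the curves of maximal slope are exactly the solutions of `x' = -F x`
  (`eq_integral_of_maximal_slope`, `isCurveOfMaximalSlope_of_flow`), which exist for all times
  because the energy does not increase (`exists_flow`);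
* the incremental functional is convex up to a compact perturbation, so that minimizers exist
  (`exists_isDiscreteSolution`), and they satisfy the implicit Euler equation up to a small error,
  so that the discrete solutions converge, without passing to a subsequence (`tendsto_discrete`).

Finally, `⟪A F, A h⟫ = dφ₀ h` with `x' = -F x`, tested with directions that have a single
nonzero component, is the weak form of the one-dimensional system (`weakEquations_of_inner`).
-/

namespace Ribbon

noncomputable section

/-! ### Gradient systems -/

/-- A Riesz representation on the range of an injective operator with closed range. -/
theorem exists_riesz_of_lower_bound {X Y : Type*} [NormedAddCommGroup X] [NormedSpace ℝ X]
    [CompleteSpace X] [NormedAddCommGroup Y] [InnerProductSpace ℝ Y] (A : X →L[ℝ] Y) {c : ℝ}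
    (hc : ∀ h, ‖h‖ ≤ c * ‖A h‖) (ℓ : X →L[ℝ] ℝ) :
    ∃ g : X, ∀ h, inner ℝ (A g) (A h) = ℓ h := by
  have hinj : Function.Injective A.toLinearMap := by
    intro x y hxy
    have h0 : A (x - y) = 0 := by
      have : A x = A y := hxy
      rw [map_sub, this, sub_self]
    have h1 := hc (x - y)
    rw [h0, norm_zero, mul_zero] at h1
    exact sub_eq_zero.1 (norm_le_zero_iff.1 h1)
  let e : X ≃L[ℝ] LinearMap.range A.toLinearMap :=
    (LinearEquiv.ofInjective A.toLinearMap hinj).toContinuousLinearEquivOfBounds ‖A‖ c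
      (fun x => A.le_opNorm x) (fun y => by
        obtain ⟨x, rfl⟩ := (LinearEquiv.ofInjective A.toLinearMap hinj).surjective y
        rw [LinearEquiv.symm_apply_apply]
        exact hc x)
  have : CompleteSpace (LinearMap.range A.toLinearMap) :=
    (completeSpace_congr (e := e.toEquiv) e.isUniformEmbedding).1 inferInstance
  let v := (InnerProductSpace.toDual ℝ (LinearMap.range A.toLinearMap)).symm
    (ℓ.comp (e.symm : LinearMap.range A.toLinearMap →L[ℝ] X))
  refine ⟨e.symm v, fun h => ?_⟩
  have h1 : inner ℝ v (e h) = ℓ h := by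
    rw [InnerProductSpace.toDual_symm_apply]
    simp
  have h2 : A (e.symm v) = (v : Y) := by
    have : ((e (e.symm v) : LinearMap.range A.toLinearMap) : Y) = v := by
      rw [ContinuousLinearEquiv.apply_symm_apply]
    exact this
  rw [h2, ← h1]
  rfl

/-- A gradient system in a global chart: the state space is the Banach space `X`, embedded into
the inner product space `Y` by the nonlinear map `Ψ` with derivative `A`, and the energy `φ` has
derivative `dφ`. Distances are those of `Y`, measured along straight lines of `Y` and not inside
the range of `Ψ`. All estimates hold uniformly on bounded sets. -/
structure GradSystem (X Y : Type*) [NormedAddCommGroup X] [NormedSpace ℝ X]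
    [NormedAddCommGroup Y] [InnerProductSpace ℝ Y] where
  Ψ : X → Y
  A : X → X →L[ℝ] Y
  φ : X → ℝ
  dφ : X → X →L[ℝ] ℝ
  Ψ_taylor : ∀ R : ℝ, ∃ C : ℝ, ∀ x y, ‖x‖ ≤ R → ‖y‖ ≤ R →
    ‖Ψ y - Ψ x - A x (y - x)‖ ≤ C * ‖y - x‖ ^ 2
  A_lip : ∀ R : ℝ, ∃ C : ℝ, ∀ x y, ‖x‖ ≤ R → ‖y‖ ≤ R → ‖A x - A y‖ ≤ C * ‖x - y‖
  lower : ∀ R : ℝ, ∃ C : ℝ, ∀ x y, ‖x‖ ≤ R → ‖y‖ ≤ R → ‖x - y‖ ≤ C * ‖Ψ x - Ψ y‖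
  φ_taylor : ∀ R : ℝ, ∃ C : ℝ, ∀ x y, ‖x‖ ≤ R → ‖y‖ ≤ R →
    |φ y - φ x - dφ x (y - x)| ≤ C * ‖y - x‖ ^ 2
  dφ_lip : ∀ R : ℝ, ∃ C : ℝ, ∀ x y, ‖x‖ ≤ R → ‖y‖ ≤ R → ‖dφ x - dφ y‖ ≤ C * ‖x - y‖
  bounded_of_Ψ : ∀ r : ℝ, ∃ R : ℝ, ∀ x, ‖Ψ x‖ ≤ r → ‖x‖ ≤ R
  bounded_of_φ : ∀ r : ℝ, ∃ R : ℝ, ∀ x, φ x ≤ r → ‖x‖ ≤ R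
  bddBelow : ∃ m : ℝ, ∀ x, m ≤ φ x

namespace GradSystem

variable {X Y : Type*} [NormedAddCommGroup X] [NormedSpace ℝ X]
  [NormedAddCommGroup Y] [InnerProductSpace ℝ Y] (G : GradSystem X Y)

/-- The distance of the ambient space `Y`. -/
def D (x y : X) : ℝ := ‖G.Ψ x - G.Ψ y‖

theorem D_comm (x y : X) : G.D x y = G.D y x := norm_sub_rev _ _

theorem D_nonneg (x y : X) : 0 ≤ G.D x y := norm_nonneg _

theorem exists_bounds (R : ℝ) : ∃ C : ℝ, 1 ≤ C ∧ ∀ x y, ‖x‖ ≤ R → ‖y‖ ≤ R →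
    ‖G.Ψ y - G.Ψ x - G.A x (y - x)‖ ≤ C * ‖y - x‖ ^ 2 ∧
    ‖G.A x - G.A y‖ ≤ C * ‖x - y‖ ∧ ‖x - y‖ ≤ C * ‖G.Ψ x - G.Ψ y‖ ∧
    |G.φ y - G.φ x - G.dφ x (y - x)| ≤ C * ‖y - x‖ ^ 2 ∧
    ‖G.dφ x - G.dφ y‖ ≤ C * ‖x - y‖ := by
  obtain ⟨C₁, h₁⟩ := G.Ψ_taylor R
  obtain ⟨C₂, h₂⟩ := G.A_lip R
  obtain ⟨C₃, h₃⟩ := G.lower R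
  obtain ⟨C₄, h₄⟩ := G.φ_taylor R
  obtain ⟨C₅, h₅⟩ := G.dφ_lip R
  refine ⟨1 + |C₁| + |C₂| + |C₃| + |C₄| + |C₅|, ?_, fun x y hx hy =>
    ⟨(h₁ x y hx hy).trans ?_, (h₂ x y hx hy).trans ?_, (h₃ x y hx hy).trans ?_,
      (h₄ x y hx hy).trans ?_, (h₅ x y hx hy).trans ?_⟩⟩
  · have := abs_nonneg C₁; have := abs_nonneg C₂; have := abs_nonneg C₃
    have := abs_nonneg C₄; have := abs_nonneg C₅
    linarith
  all_goals
    refine mul_le_mul_of_nonneg_right ?_ (by positivity)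
    have := abs_nonneg C₁; have := abs_nonneg C₂; have := abs_nonneg C₃
    have := abs_nonneg C₄; have := abs_nonneg C₅
    have := le_abs_self C₁; have := le_abs_self C₂; have := le_abs_self C₃
    have := le_abs_self C₄; have := le_abs_self C₅
    linarith

theorem exists_A_lower (R : ℝ) : ∃ C : ℝ, 1 ≤ C ∧ ∀ x, ‖x‖ ≤ R → ∀ h, ‖h‖ ≤ C * ‖G.A x h‖ := by
  obtain ⟨C, hC, H⟩ := G.exists_bounds (R + 1)
  refine ⟨C, hC, fun x hx h => ?_⟩
  rcases eq_or_ne h 0 with rfl | hh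
  · simp
  have hh' : 0 < ‖h‖ := norm_pos_iff.2 hh
  refine le_of_forall_pos_le_add fun ε hε => ?_
  -- compare `x` with `x + t h` for small `t`
  obtain ⟨t, ht, ht1, ht2⟩ : ∃ t : ℝ, 0 < t ∧ t * ‖h‖ ≤ 1 ∧ t * (C * (C * ‖h‖ ^ 2)) ≤ ε := by
    have hp : 0 < C * (C * ‖h‖ ^ 2) := by positivity
    refine ⟨min (1 / ‖h‖) (ε / (C * (C * ‖h‖ ^ 2))), by positivity, ?_, ?_⟩
    · rw [← le_div_iff₀ hh']; exact min_le_left _ _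
    · rw [← le_div_iff₀ hp]; exact min_le_right _ _
  have hth : ‖t • h‖ = t * ‖h‖ := by rw [norm_smul, Real.norm_of_nonneg ht.le]
  have hx' : ‖x + t • h‖ ≤ R + 1 := (norm_add_le _ _).trans (add_le_add hx (hth ▸ ht1))
  obtain ⟨b1, -, b3, -, -⟩ := H x (x + t • h) (by linarith) hx'
  rw [norm_sub_rev, norm_sub_rev (G.Ψ x)] at b3
  rw [add_sub_cancel_left] at b1 b3
  rw [hth] at b1 b3
  have h3 : ‖G.Ψ (x + t • h) - G.Ψ x‖ ≤ t * ‖G.A x h‖ + C * (t * ‖h‖) ^ 2 := by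
    calc _ = ‖(G.Ψ (x + t • h) - G.Ψ x - G.A x (t • h)) + G.A x (t • h)‖ := by
            rw [sub_add_cancel]
      _ ≤ _ := (norm_add_le _ _).trans (by
            rw [map_smul, norm_smul, Real.norm_of_nonneg ht.le] at *
            linarith)
  have h4 : t * ‖h‖ ≤ t * (C * ‖G.A x h‖ + t * (C * (C * ‖h‖ ^ 2))) := by
    calc _ ≤ C * (t * ‖G.A x h‖ + C * (t * ‖h‖) ^ 2) :=
          b3.trans (mul_le_mul_of_nonneg_left h3 (by linarith))
      _ = _ := by ring
  have h5 := le_of_mul_le_mul_left h4 ht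
  linarith

variable [CompleteSpace X]

theorem exists_grad (x : X) : ∃ g : X, ∀ h, inner ℝ (G.A x g) (G.A x h) = G.dφ x h := by
  obtain ⟨C, -, hC⟩ := G.exists_A_lower ‖x‖
  exact exists_riesz_of_lower_bound (G.A x) (hC x le_rfl) (G.dφ x)

/-- The gradient of `φ` with respect to the Riemannian metric `⟪A x ·, A x ·⟫`. -/
def F (x : X) : X := (G.exists_grad x).choose

theorem inner_F (x h : X) : inner ℝ (G.A x (G.F x)) (G.A x h) = G.dφ x h :=
  (G.exists_grad x).choose_spec h

/-- The length of the gradient, which turns out to be the local slope. -/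
def slope (x : X) : ℝ := ‖G.A x (G.F x)‖

theorem slope_nonneg (x : X) : 0 ≤ G.slope x := norm_nonneg _

/-- All estimates that are used on a ball, with one constant. -/
theorem exists_const (R : ℝ) (hR : 0 ≤ R) : ∃ C : ℝ, 1 ≤ C ∧ (∀ x, ‖x‖ ≤ R →
      (∀ h, ‖h‖ ≤ C * ‖G.A x h‖) ∧ (∀ h, ‖G.A x h‖ ≤ C * ‖h‖) ∧ (∀ h, |G.dφ x h| ≤ C * ‖h‖) ∧
      ‖G.F x‖ ≤ C ∧ G.slope x ≤ C) ∧
    ∀ x y, ‖x‖ ≤ R → ‖y‖ ≤ R →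
      ‖x - y‖ ≤ C * G.D x y ∧ G.D x y ≤ C * ‖x - y‖ ∧
      ‖G.Ψ y - G.Ψ x - G.A x (y - x)‖ ≤ C * ‖y - x‖ ^ 2 ∧
      ‖G.F x - G.F y‖ ≤ C * ‖x - y‖ ∧
      |G.φ y - G.φ x - G.dφ x (y - x)| ≤ C * ‖y - x‖ ^ 2 ∧
      |G.φ y - G.φ x - inner ℝ (G.A x (G.F x)) (G.Ψ y - G.Ψ x)| ≤ C * G.D y x ^ 2 ∧
      |G.φ y - G.φ x| ≤ C * G.D y x ∧ ‖G.A x - G.A y‖ ≤ C * ‖x - y‖ := by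
  obtain ⟨C, hC, H⟩ := G.exists_bounds R
  obtain ⟨c, hc, Hc⟩ := G.exists_A_lower R
  have hC0 : 0 ≤ C := by linarith
  have hc0 : 0 ≤ c := by linarith
  have hz : ‖(0 : X)‖ ≤ R := by simpa using hR
  obtain ⟨a, ha⟩ : ∃ a, a = ‖G.A 0‖ + C * R := ⟨_, rfl⟩
  obtain ⟨b, hb⟩ : ∃ b, b = ‖G.dφ 0‖ + C * R := ⟨_, rfl⟩
  have ha0 : 0 ≤ a := by rw [ha]; positivity
  have hb0 : 0 ≤ b := by rw [hb]; positivity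
  have hA : ∀ x, ‖x‖ ≤ R → ‖G.A x‖ ≤ a := fun x hx => by
    have h := (H x 0 hx hz).2.1
    rw [sub_zero] at h
    have h2 : C * ‖x‖ ≤ C * R := mul_le_mul_of_nonneg_left hx hC0
    have h3 : ‖G.A x‖ ≤ ‖G.A 0‖ + ‖G.A x - G.A 0‖ := norm_le_norm_add_norm_sub' _ _
    linarith
  have hdφ : ∀ x, ‖x‖ ≤ R → ‖G.dφ x‖ ≤ b := fun x hx => by
    have h := (H x 0 hx hz).2.2.2.2
    rw [sub_zero] at h
    have h2 : C * ‖x‖ ≤ C * R := mul_le_mul_of_nonneg_left hx hC0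
    have h3 : ‖G.dφ x‖ ≤ ‖G.dφ 0‖ + ‖G.dφ x - G.dφ 0‖ := norm_le_norm_add_norm_sub' _ _
    linarith
  have hAh : ∀ x, ‖x‖ ≤ R → ∀ h, ‖G.A x h‖ ≤ a * ‖h‖ := fun x hx h =>
    (G.A x).le_of_opNorm_le (hA x hx) h
  have hdφh : ∀ x, ‖x‖ ≤ R → ∀ h, |G.dφ x h| ≤ b * ‖h‖ := fun x hx h =>
    (G.dφ x).le_of_opNorm_le (hdφ x hx) h
  have hs : ∀ x, ‖x‖ ≤ R → G.slope x ≤ b * c := fun x hx => by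
    rcases (G.slope_nonneg x).eq_or_lt with h0 | h0
    · rw [← h0]; positivity
    have h1 : G.slope x * G.slope x ≤ b * c * G.slope x := by
      have h2 := G.inner_F x (G.F x)
      rw [real_inner_self_eq_norm_mul_norm] at h2
      calc G.slope x * G.slope x = G.dφ x (G.F x) := h2
        _ ≤ b * ‖G.F x‖ := (le_abs_self _).trans (hdφh x hx _)
        _ ≤ b * (c * G.slope x) := mul_le_mul_of_nonneg_left (Hc x hx _) hb0
        _ = _ := by ring
    exact le_of_mul_le_mul_right h1 h0
  have hF : ∀ x, ‖x‖ ≤ R → ‖G.F x‖ ≤ c * (b * c) := fun x hx =>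
    (Hc x hx _).trans (mul_le_mul_of_nonneg_left (hs x hx) hc0)
  obtain ⟨f, hf⟩ : ∃ f, f = c * (b * c) := ⟨_, rfl⟩
  have hf0 : 0 ≤ f := by rw [hf]; positivity
  -- `F` is Lipschitz: subtract the two defining equations and test with the difference
  have hFl : ∀ x y, ‖x‖ ≤ R → ‖y‖ ≤ R →
      ‖G.F x - G.F y‖ ≤ c ^ 2 * (C + 2 * a * f * C) * ‖x - y‖ := fun x y hx hy => by
    obtain ⟨d, hd⟩ : ∃ d, d = G.F x - G.F y := ⟨_, rfl⟩
    rcases eq_or_ne d 0 with h0 | h0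
    · rw [← hd, h0, norm_zero]; positivity
    have hd0 : 0 < ‖d‖ := norm_pos_iff.2 h0
    have e1 : inner ℝ (G.A x d) (G.A x d) = (G.dφ x - G.dφ y) d
        - inner ℝ ((G.A x - G.A y) (G.F y)) (G.A x d)
        - inner ℝ (G.A y (G.F y)) ((G.A x - G.A y) d) := by
      simp only [sub_apply, inner_sub_left, inner_sub_right]
      rw [← G.inner_F x d, ← G.inner_F y d]
      nth_rewrite 1 [hd]
      rw [map_sub, inner_sub_left]
      ring
    have b1 : |(G.dφ x - G.dφ y) d| ≤ C * ‖x - y‖ * ‖d‖ :=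
      (G.dφ x - G.dφ y).le_of_opNorm_le (H x y hx hy).2.2.2.2 d
    have b0 : ∀ v, ‖(G.A x - G.A y) v‖ ≤ C * ‖x - y‖ * ‖v‖ := fun v =>
      (G.A x - G.A y).le_of_opNorm_le (H x y hx hy).2.1 v
    have hFy : ‖G.F y‖ ≤ f := hf ▸ hF y hy
    have b2 : |inner ℝ ((G.A x - G.A y) (G.F y)) (G.A x d)| ≤
        C * ‖x - y‖ * f * (a * ‖d‖) := by
      refine (abs_real_inner_le_norm _ _).trans ?_
      refine mul_le_mul ((b0 _).trans ?_) (hAh x hx d) (norm_nonneg _) (by positivity)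
      exact mul_le_mul_of_nonneg_left hFy (by positivity)
    have b3 : |inner ℝ (G.A y (G.F y)) ((G.A x - G.A y) d)| ≤
        a * f * (C * ‖x - y‖ * ‖d‖) := by
      refine (abs_real_inner_le_norm _ _).trans ?_
      refine mul_le_mul ((hAh y hy _).trans ?_) (b0 d) (norm_nonneg _) (by positivity)
      exact mul_le_mul_of_nonneg_left hFy ha0
    rw [real_inner_self_eq_norm_sq] at e1
    have b4 : ‖G.A x d‖ ^ 2 ≤ (C + 2 * a * f * C) * ‖x - y‖ * ‖d‖ := by
      rw [e1]
      have := (abs_le.1 b1).2; have := (abs_le.1 b2).1; have := (abs_le.1 b3).1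
      linarith
    have b5 : ‖d‖ ^ 2 ≤ c ^ 2 * ‖G.A x d‖ ^ 2 := by
      rw [← mul_pow]; exact pow_le_pow_left₀ (norm_nonneg _) (Hc x hx d) 2
    have b6 : ‖d‖ * ‖d‖ ≤ c ^ 2 * (C + 2 * a * f * C) * ‖x - y‖ * ‖d‖ := by
      have := mul_le_mul_of_nonneg_left b4 (sq_nonneg c)
      calc ‖d‖ * ‖d‖ = ‖d‖ ^ 2 := by ring
        _ ≤ _ := b5.trans (this.trans (by linarith))
    rw [← hd]
    exact le_of_mul_le_mul_right b6 hd0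
  have hDub : ∀ x y, ‖x‖ ≤ R → ‖y‖ ≤ R → G.D y x ≤ (a + C * (2 * R)) * ‖y - x‖ :=
    fun x y hx hy => by
      have h1 := (H x y hx hy).1
      have h2 : ‖y - x‖ ≤ 2 * R := (norm_sub_le _ _).trans (by linarith)
      have h3 : G.D y x ≤ ‖G.Ψ y - G.Ψ x - G.A x (y - x)‖ + ‖G.A x (y - x)‖ := by
        unfold D
        calc _ = ‖(G.Ψ y - G.Ψ x - G.A x (y - x)) + G.A x (y - x)‖ := by rw [sub_add_cancel]
          _ ≤ _ := norm_add_le _ _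
      have h4 : C * ‖y - x‖ ^ 2 ≤ C * (2 * R) * ‖y - x‖ := by
        rw [sq, ← mul_assoc]
        exact mul_le_mul_of_nonneg_right (mul_le_mul_of_nonneg_left h2 hC0) (norm_nonneg _)
      have := hAh x hx (y - x)
      linarith
  have hφΨ : ∀ x y, ‖x‖ ≤ R → ‖y‖ ≤ R →
      |G.φ y - G.φ x - inner ℝ (G.A x (G.F x)) (G.Ψ y - G.Ψ x)| ≤
        (C + b * c * C) * C ^ 2 * G.D y x ^ 2 := fun x y hx hy => by
    obtain ⟨h1, -, h3, h4, -⟩ := H x y hx hy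
    have e1 : G.φ y - G.φ x - inner ℝ (G.A x (G.F x)) (G.Ψ y - G.Ψ x) =
        (G.φ y - G.φ x - G.dφ x (y - x))
          - inner ℝ (G.A x (G.F x)) (G.Ψ y - G.Ψ x - G.A x (y - x)) := by
      rw [inner_sub_right _ (G.Ψ y - G.Ψ x), G.inner_F]
      ring
    have b1 : |inner ℝ (G.A x (G.F x)) (G.Ψ y - G.Ψ x - G.A x (y - x))| ≤
        b * c * (C * ‖y - x‖ ^ 2) :=
      (abs_real_inner_le_norm _ _).trans (mul_le_mul (hs x hx) h1 (norm_nonneg _)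
        (by positivity))
    have b2 : ‖y - x‖ ^ 2 ≤ C ^ 2 * G.D y x ^ 2 := by
      rw [← mul_pow, norm_sub_rev, G.D_comm]
      exact pow_le_pow_left₀ (norm_nonneg _) h3 2
    rw [e1]
    calc _ ≤ C * ‖y - x‖ ^ 2 + b * c * (C * ‖y - x‖ ^ 2) :=
          (abs_sub _ _).trans (add_le_add h4 b1)
      _ = (C + b * c * C) * ‖y - x‖ ^ 2 := by ring
      _ ≤ (C + b * c * C) * (C ^ 2 * G.D y x ^ 2) :=
          mul_le_mul_of_nonneg_left b2 (by positivity)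
      _ = _ := by ring
  have hφD : ∀ x y, ‖x‖ ≤ R → ‖y‖ ≤ R → |G.φ y - G.φ x| ≤ (b + C * (2 * R)) * C * G.D y x :=
    fun x y hx hy => by
      obtain ⟨h1, -, h3, h4, -⟩ := H x y hx hy
      rw [norm_sub_rev, ← D, G.D_comm] at h3
      have h2 : ‖y - x‖ ≤ 2 * R := (norm_sub_le _ _).trans (by linarith)
      have h5 : C * ‖y - x‖ ^ 2 ≤ C * (2 * R) * ‖y - x‖ := by
        rw [sq, ← mul_assoc]
        exact mul_le_mul_of_nonneg_right (mul_le_mul_of_nonneg_left h2 hC0) (norm_nonneg _)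
      have h6 := hdφh x hx (y - x)
      have h7 : |G.φ y - G.φ x| ≤ |G.φ y - G.φ x - G.dφ x (y - x)| + |G.dφ x (y - x)| := by
        have := abs_add_le (G.φ y - G.φ x - G.dφ x (y - x)) (G.dφ x (y - x))
        rwa [sub_add_cancel] at this
      calc |G.φ y - G.φ x| ≤ (b + C * (2 * R)) * ‖y - x‖ := by linarith
        _ ≤ (b + C * (2 * R)) * (C * G.D y x) := mul_le_mul_of_nonneg_left h3 (by positivity)
        _ = _ := by ring
  have hsum : ∀ u v w p q r s t : ℝ, 0 ≤ u → 0 ≤ v → 0 ≤ w → 0 ≤ p → 0 ≤ q → 0 ≤ r → 0 ≤ s →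
      0 ≤ t → u ≤ 1 + (u + v + w + p + q + r + s + t) ∧ v ≤ 1 + (u + v + w + p + q + r + s + t) ∧
      w ≤ 1 + (u + v + w + p + q + r + s + t) ∧ p ≤ 1 + (u + v + w + p + q + r + s + t) ∧
      q ≤ 1 + (u + v + w + p + q + r + s + t) ∧ r ≤ 1 + (u + v + w + p + q + r + s + t) ∧
      s ≤ 1 + (u + v + w + p + q + r + s + t) ∧ t ≤ 1 + (u + v + w + p + q + r + s + t) ∧
      1 ≤ 1 + (u + v + w + p + q + r + s + t) := by
    intro u v w p q r s t _ _ _ _ _ _ _ _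
    refine ⟨?_, ?_, ?_, ?_, ?_, ?_, ?_, ?_, ?_⟩ <;> linarith
  obtain ⟨l1, l2, l3, l4, l5, l6, l7, l8, l9⟩ := hsum (c + C) (a + b) (b * c) f
    (c ^ 2 * (C + 2 * a * f * C)) (a + C * (2 * R)) ((C + b * c * C) * C ^ 2)
    ((b + C * (2 * R)) * C) (by positivity) (by positivity) (by positivity) (by positivity)
    (by positivity) (by positivity) (by positivity) (by positivity)
  refine ⟨_, l9, fun x hx => ⟨fun h => (Hc x hx h).trans ?_, fun h => (hAh x hx h).trans ?_,
      fun h => (hdφh x hx h).trans ?_, (hF x hx).trans (hf ▸ l4), (hs x hx).trans l3⟩,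
      fun x y hx hy => ⟨(H x y hx hy).2.2.1.trans ?_, (hDub y x hy hx).trans ?_,
      (H x y hx hy).1.trans ?_, (hFl x y hx hy).trans ?_, (H x y hx hy).2.2.2.1.trans ?_,
      (hφΨ x y hx hy).trans ?_, (hφD x y hx hy).trans ?_, (H x y hx hy).2.1.trans ?_⟩⟩
  · exact mul_le_mul_of_nonneg_right (by linarith) (norm_nonneg _)
  · exact mul_le_mul_of_nonneg_right (by linarith) (norm_nonneg _)
  · exact mul_le_mul_of_nonneg_right (by linarith) (norm_nonneg _)
  · exact mul_le_mul_of_nonneg_right (by linarith) (norm_nonneg _)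
  · exact mul_le_mul_of_nonneg_right (by linarith) (norm_nonneg _)
  · exact mul_le_mul_of_nonneg_right (by linarith) (by positivity)
  · exact mul_le_mul_of_nonneg_right (by linarith) (norm_nonneg _)
  · exact mul_le_mul_of_nonneg_right (by linarith) (by positivity)
  · exact mul_le_mul_of_nonneg_right (by linarith) (by positivity)
  · exact mul_le_mul_of_nonneg_right (by linarith) (norm_nonneg _)
  · exact mul_le_mul_of_nonneg_right (by linarith) (norm_nonneg _)

end GradSystem

/-! ### The local slope -/

theorem continuous_of_lipschitz_on_balls {E E' : Type*} [NormedAddCommGroup E]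
    [NormedAddCommGroup E'] {f : E → E'}
    (hf : ∀ R : ℝ, 0 ≤ R → ∃ C : ℝ, ∀ x y, ‖x‖ ≤ R → ‖y‖ ≤ R → ‖f x - f y‖ ≤ C * ‖x - y‖) :
    Continuous f := by
  refine continuous_iff_continuousAt.2 fun x => ?_
  obtain ⟨C, hC⟩ := hf (‖x‖ + 1) (by positivity)
  rw [ContinuousAt, tendsto_iff_norm_sub_tendsto_zero]
  have hlim : Tendsto (fun y => C * ‖y - x‖) (𝓝 x) (𝓝 0) := by
    have : Continuous fun y => C * ‖y - x‖ := by fun_prop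
    simpa using this.tendsto x
  refine squeeze_zero' (Eventually.of_forall fun _ => norm_nonneg _) ?_ hlim
  filter_upwards [Metric.ball_mem_nhds x one_pos] with y hy
  refine hC y x ?_ (by linarith)
  have : ‖y‖ ≤ ‖x‖ + ‖y - x‖ := norm_le_norm_add_norm_sub' _ _
  rw [Metric.mem_ball, dist_eq_norm] at hy
  linarith

theorem hasFDerivAt_of_quadratic_bound {E E' : Type*} [NormedAddCommGroup E] [NormedSpace ℝ E]
    [NormedAddCommGroup E'] [NormedSpace ℝ E'] {f : E → E'} {f' : E →L[ℝ] E'} {x : E} {C : ℝ}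
    (h : ∀ᶠ y in 𝓝 x, ‖f y - f x - f' (y - x)‖ ≤ C * ‖y - x‖ ^ 2) : HasFDerivAt f f' x := by
  have h1 : HasFDerivAt (fun y => f y - f x - f' (y - x)) (0 : E →L[ℝ] E') x := by
    refine Asymptotics.IsBigO.hasFDerivAt (n := 2) (Asymptotics.IsBigO.of_bound C ?_) one_lt_two
    filter_upwards [h] with y hy
    rwa [norm_pow, norm_norm]
  have h2 : HasFDerivAt (fun y => f x + f' (y - x)) f' x := by
    have h0 : HasFDerivAt (fun y => f' (y - x)) f' x := by
      simpa only [map_sub] using (f'.hasFDerivAt (x := x)).sub_const (f' x)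
    exact h0.const_add (f x)
  have h3 := h1.add h2
  rw [zero_add] at h3
  refine h3.congr_of_eventuallyEq (Eventually.of_forall fun y => ?_)
  simp

/-- A map whose increments are dominated by those of an integral is absolutely continuous. -/
theorem absolutelyContinuousOnInterval_of_dist_le {E : Type*} [PseudoMetricSpace E] {f : ℝ → E}
    {m : ℝ → ℝ} {a b C : ℝ} (hab : a ≤ b) (hm : IntegrableOn m (Icc a b))
    (h : ∀ s ∈ Icc a b, ∀ t ∈ Icc a b, s ≤ t → dist (f s) (f t) ≤ C * ∫ r in s..t, m r) :
    AbsolutelyContinuousOnInterval f a b := by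
  have hm' : IntervalIntegrable m volume a b := by
    rw [intervalIntegrable_iff_integrableOn_Icc_of_le hab]; exact hm
  have hg := (hm'.absolutelyContinuousOnInterval_intervalIntegral (c := a)
    (by simp [hab])).const_mul C
  have hd : ∀ s ∈ Icc a b, ∀ t ∈ Icc a b, dist (f s) (f t) ≤
      dist (C * ∫ v in a..s, m v) (C * ∫ v in a..t, m v) := by
    have key : ∀ s ∈ Icc a b, ∀ t ∈ Icc a b, s ≤ t → dist (f s) (f t) ≤
      dist (C * ∫ v in a..s, m v) (C * ∫ v in a..t, m v) := by
      intro s hs t ht hst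
      have hi : ∀ u ∈ Icc a b, IntervalIntegrable m volume a u := fun u hu => hm'.mono_set (by
        rw [uIcc_of_le hu.1, uIcc_of_le hab]; exact Icc_subset_Icc_right hu.2)
      have e := intervalIntegral.integral_interval_sub_left (hi t ht) (hi s hs)
      rw [dist_comm _ (C * _), Real.dist_eq, ← mul_sub, e]
      exact (h s hs t ht hst).trans (le_abs_self _)
    intro s hs t ht
    rcases le_total s t with hst | hst
    · exact key s hs t ht hst
    · rw [dist_comm, dist_comm (C * _)]; exact key t ht s hs hst
  refine squeeze_zero' (Eventually.of_forall fun E => Finset.sum_nonneg fun i _ => dist_nonneg)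
    ?_ hg
  refine mem_inf_of_right fun E hE => ?_
  change ∑ i ∈ Finset.range E.1, (_ : ℝ) ≤ ∑ i ∈ Finset.range E.1, (_ : ℝ)
  refine Finset.sum_le_sum fun i hi => ?_
  have := hE.1 i hi
  rw [uIcc_of_le hab] at this
  exact hd _ this.1 _ this.2

namespace GradSystem

variable {X Y : Type*} [NormedAddCommGroup X] [NormedSpace ℝ X]
  [NormedAddCommGroup Y] [InnerProductSpace ℝ Y] (G : GradSystem X Y)

theorem exists_ball_of_D (u : X) (r : ℝ) :
    ∃ R, ‖u‖ ≤ R ∧ 0 ≤ R ∧ ∀ v, G.D u v ≤ r → ‖v‖ ≤ R := by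
  obtain ⟨R, hR⟩ := G.bounded_of_Ψ (‖G.Ψ u‖ + r)
  refine ⟨max R ‖u‖, le_max_right _ _, (norm_nonneg u).trans (le_max_right _ _),
    fun v hv => le_max_of_le_left (hR v ?_)⟩
  have : ‖G.Ψ v‖ ≤ ‖G.Ψ u‖ + ‖G.Ψ u - G.Ψ v‖ := norm_le_norm_add_norm_sub _ _
  unfold D at hv
  linarith

theorem continuous_A : Continuous G.A :=
  continuous_of_lipschitz_on_balls fun R _ => G.A_lip R

theorem hasFDerivAt_φ (x : X) : HasFDerivAt G.φ (G.dφ x) x := by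
  obtain ⟨C, hC⟩ := G.φ_taylor (‖x‖ + 1)
  refine hasFDerivAt_of_quadratic_bound (C := C) ?_
  filter_upwards [Metric.ball_mem_nhds x one_pos] with y hy
  refine hC x y (by linarith) ?_
  have : ‖y‖ ≤ ‖x‖ + ‖y - x‖ := norm_le_norm_add_norm_sub' _ _
  rw [Metric.mem_ball, dist_eq_norm] at hy
  linarith

theorem hasFDerivAt_Ψ (x : X) : HasFDerivAt G.Ψ (G.A x) x := by
  obtain ⟨C, hC⟩ := G.Ψ_taylor (‖x‖ + 1)
  refine hasFDerivAt_of_quadratic_bound (C := C) ?_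
  filter_upwards [Metric.ball_mem_nhds x one_pos] with y hy
  refine hC x y (by linarith) ?_
  have : ‖y‖ ≤ ‖x‖ + ‖y - x‖ := norm_le_norm_add_norm_sub' _ _
  rw [Metric.mem_ball, dist_eq_norm] at hy
  linarith

theorem tendsto_D_div {c : ℝ → X} {v : X} {t : ℝ} (hc : HasDerivAt c v t) :
    Tendsto (fun s => G.D (c s) (c t) / |s - t|) (𝓝[≠] t) (𝓝 ‖G.A (c t) v‖) := by
  have h := (hasDerivAt_iff_tendsto_slope.1
    ((G.hasFDerivAt_Ψ (c t)).comp_hasDerivAt t hc)).norm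
  refine h.congr fun s => ?_
  rw [slope_def_module, norm_smul, norm_inv, Real.norm_eq_abs, div_eq_inv_mul]
  rfl

theorem metricDeriv_eq {c : ℝ → X} {v : X} {t : ℝ} (hc : HasDerivAt c v t) :
    metricDeriv G.D c t = ENNReal.ofReal ‖G.A (c t) v‖ :=
  ((ENNReal.continuous_ofReal.tendsto _).comp (G.tendsto_D_div hc)).limsup_eq

theorem eventually_D_le {z : ℝ → X} {t : ℝ} (hmd : metricDeriv G.D z t ≠ ⊤) {ε : ℝ}
    (hε : 0 < ε) : ∀ᶠ s in 𝓝[≠] t,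
      G.D (z s) (z t) ≤ ((metricDeriv G.D z t).toReal + ε) * |s - t| := by
  have h1 : metricDeriv G.D z t < ENNReal.ofReal ((metricDeriv G.D z t).toReal + ε) := by
    rw [ENNReal.ofReal_add ENNReal.toReal_nonneg hε.le, ENNReal.ofReal_toReal hmd]
    exact ENNReal.lt_add_right hmd (by simpa using hε)
  have h2 := eventually_lt_of_limsup_lt h1
  filter_upwards [h2, self_mem_nhdsWithin] with s hs hst
  have hst' : 0 < |s - t| := abs_pos.2 (sub_ne_zero.2 hst)
  rw [← div_le_iff₀ hst']
  refine (ENNReal.ofReal_le_ofReal_iff ?_).1 hs.le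
  have := ENNReal.toReal_nonneg (a := metricDeriv G.D z t)
  linarith

theorem tendsto_D_zero {z : ℝ → X} {t : ℝ} (hmd : metricDeriv G.D z t ≠ ⊤) :
    Tendsto (fun s => G.D (z s) (z t)) (𝓝[≠] t) (𝓝 0) := by
  have hlim : Tendsto (fun s => ((metricDeriv G.D z t).toReal + 1) * |s - t|) (𝓝[≠] t) (𝓝 0) := by
    have : Continuous fun s => ((metricDeriv G.D z t).toReal + 1) * |s - t| := by fun_prop
    have := this.tendsto t
    simp only [sub_self, abs_zero, mul_zero] at this
    exact this.mono_left nhdsWithin_le_nhds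
  exact squeeze_zero' (Eventually.of_forall fun s => G.D_nonneg _ _)
    (G.eventually_D_le hmd one_pos) hlim

/-- By Lebesgue's differentiation theorem the metric derivative of an absolutely continuous curve
is finite almost everywhere. -/
theorem ACOn.ae_metricDeriv_ne_top {z : ℝ → X} {a b : ℝ} (hab : a ≤ b)
    (hz : ACOn G.D z (Icc a b)) : ∀ᵐ t, t ∈ Ioo a b → metricDeriv G.D z t ≠ ⊤ := by
  obtain ⟨m, hm, h⟩ := hz
  have hm' : IntervalIntegrable m volume a b := by
    rw [intervalIntegrable_iff_integrableOn_Icc_of_le hab]; exact hm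
  filter_upwards [hm'.ae_hasDerivAt_integral] with t ht htab
  rw [uIcc_of_le hab] at ht
  have htab' := Ioo_subset_Icc_self htab
  have h1 := (hasDerivAt_iff_tendsto_slope.1 (ht htab' a (left_mem_Icc.2 hab))).abs
  have h2 := ((ENNReal.continuous_ofReal.tendsto _).comp h1).limsup_eq
  refine ne_top_of_le_ne_top (b := ENNReal.ofReal |m t|) ENNReal.ofReal_ne_top ?_
  rw [← h2]
  refine limsup_le_limsup ?_
  have hi : ∀ u ∈ Icc a b, IntervalIntegrable m volume a u := fun u hu => hm'.mono_set (by
        rw [uIcc_of_le hu.1, uIcc_of_le hab]; exact Icc_subset_Icc_right hu.2)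
  filter_upwards [self_mem_nhdsWithin,
    nhdsWithin_le_nhds (isOpen_Ioo.mem_nhds htab)] with s hst hsab
  have hst' : 0 < |s - t| := abs_pos.2 (sub_ne_zero.2 hst)
  have hsab' := Ioo_subset_Icc_self hsab
  refine ENNReal.ofReal_le_ofReal ?_
  change _ ≤ |_root_.slope _ _ _|
  rw [slope_def_field, abs_div, div_le_div_iff_of_pos_right hst',
    intervalIntegral.integral_interval_sub_left (hi s hsab') (hi t htab')]
  rcases le_total s t with hle | hle
  · rw [intervalIntegral.integral_symm, abs_neg]
    exact (h s hsab' t htab' hle).trans (le_abs_self _)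
  · rw [G.D_comm]
    exact (h t htab' s hsab' hle).trans (le_abs_self _)

variable [CompleteSpace X]

theorem continuous_F : Continuous G.F :=
  continuous_of_lipschitz_on_balls fun R hR => by
    obtain ⟨C, -, -, H⟩ := G.exists_const R hR
    exact ⟨C, fun x y hx hy => (H x y hx hy).2.2.2.1⟩

theorem continuous_slope : Continuous G.slope :=
  (G.continuous_A.clm_apply G.continuous_F).norm

theorem inner_self_F (x : X) : G.dφ x (G.F x) = G.slope x ^ 2 := by
  rw [← G.inner_F, real_inner_self_eq_norm_sq]; rfl

/-- The local slope is the length of the gradient. The straight line in the direction `-F u`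
shows that it cannot be smaller. -/
theorem localSlope_eq (u : X) : localSlope G.D G.φ u = ENNReal.ofReal (G.slope u) := by
  apply le_antisymm
  · rcases (comap (fun v => G.D u v) (𝓝[>] 0)).eq_or_neBot with hb | hb
    · rw [localSlope, hb]; simp
    obtain ⟨R, hu, hR, hv⟩ := G.exists_ball_of_D u 1
    obtain ⟨C, hC, -, H⟩ := G.exists_const R hR
    have hD : Tendsto (fun v => G.D u v) (comap (fun v => G.D u v) (𝓝[>] 0)) (𝓝[>] 0) :=
      tendsto_comap
    have h1 : Tendsto (fun v => ENNReal.ofReal (G.slope u + C * G.D u v))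
        (comap (fun v => G.D u v) (𝓝[>] 0)) (𝓝 (ENNReal.ofReal (G.slope u))) := by
      refine (ENNReal.continuous_ofReal.tendsto _).comp ?_
      have := ((hD.mono_right nhdsWithin_le_nhds).const_mul C).const_add (G.slope u)
      simpa using this
    rw [← h1.limsup_eq]
    refine limsup_le_limsup ?_
    filter_upwards [hD (Ioo_mem_nhdsGT one_pos)] with v hv'
    have hv0 : 0 < G.D u v := hv'.1
    refine ENNReal.ofReal_le_ofReal ?_
    rw [div_le_iff₀ hv0]
    have h2 := (H u v hu (hv v hv'.2.le)).2.2.2.2.2.1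
    have h3 : |inner ℝ (G.A u (G.F u)) (G.Ψ v - G.Ψ u)| ≤ G.slope u * G.D u v := by
      rw [G.D_comm]; exact abs_real_inner_le_norm _ _
    rw [G.D_comm v u] at h2
    have := (abs_le.1 h2).1; have := (abs_le.1 h3).1
    nlinarith
  · rcases (G.slope_nonneg u).eq_or_lt with h0 | h0
    · rw [← h0]; simp
    let c : ℝ → X := fun t => u - t • G.F u
    have hc0 : c 0 = u := by simp [c]
    have hc : HasDerivAt c (-G.F u) 0 := by
      have := ((hasDerivAt_id (0 : ℝ)).smul_const (G.F u)).const_sub u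
      simpa using this
    have hD := (G.tendsto_D_div hc).mono_left (nhdsGT_le_nhdsNE 0)
    have hφ := (hasDerivAt_iff_tendsto_slope.1
      ((G.hasFDerivAt_φ (c 0)).comp_hasDerivAt 0 hc)).mono_left (nhdsGT_le_nhdsNE 0)
    rw [hc0] at hD hφ
    rw [map_neg, norm_neg] at hD
    rw [map_neg, G.inner_self_F] at hφ
    have hq := hφ.neg.div hD h0.ne'
    have e1 : - -G.slope u ^ 2 / ‖G.A u (G.F u)‖ = G.slope u := by
      rw [neg_neg, sq]
      exact mul_div_cancel_right₀ _ h0.ne'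
    rw [e1] at hq
    have hpos : ∀ᶠ t in 𝓝[>] (0 : ℝ), 0 < G.D u (c t) := by
      filter_upwards [hD.eventually (lt_mem_nhds h0), self_mem_nhdsWithin] with t ht ht0
      have ht0' : (0 : ℝ) < t := ht0
      rw [G.D_comm, sub_zero, abs_of_pos ht0'] at ht
      by_contra hcon
      exact absurd ht (not_lt.2 (div_nonpos_of_nonpos_of_nonneg (not_lt.1 hcon) ht0'.le))
    have hlim : Tendsto c (𝓝[>] 0) (comap (fun v => G.D u v) (𝓝[>] 0)) := by
      rw [tendsto_comap_iff]
      refine tendsto_nhdsWithin_iff.2 ⟨?_, hpos⟩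
      have hcont : Tendsto c (𝓝[>] 0) (𝓝 u) := by
        have := hc.continuousAt.tendsto.mono_left (nhdsWithin_le_nhds (s := Ioi 0))
        rwa [hc0] at this
      have h2 : Tendsto (fun x => ‖G.Ψ u - G.Ψ x‖) (𝓝 u) (𝓝 0) := by
        have := ((G.hasFDerivAt_Ψ u).continuousAt.tendsto.const_sub (G.Ψ u)).norm
        simpa using this
      exact h2.comp hcont
    have h3 : Tendsto (fun t => ENNReal.ofReal ((G.φ u - G.φ (c t)) / G.D u (c t))) (𝓝[>] 0)
        (𝓝 (ENNReal.ofReal (G.slope u))) := by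
      refine ((ENNReal.continuous_ofReal.tendsto _).comp hq).congr' ?_
      filter_upwards [self_mem_nhdsWithin] with t ht0
      have ht0' : (0 : ℝ) < t := ht0
      simp only [Function.comp_apply, slope_def_field, sub_zero, hc0, abs_of_pos ht0',
        Pi.div_apply]
      rw [G.D_comm (c t), ← neg_div, div_div_div_cancel_right₀ ht0'.ne', neg_sub]
    rw [← h3.limsup_eq]
    exact limsup_le_limsup_of_le (f := map c (𝓝[>] 0))
      (u := fun v => ENNReal.ofReal ((G.φ u - G.φ v) / G.D u v)) hlim

/-! ### Absolutely continuous curves -/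

/-- Where the metric derivative is finite, the difference quotient of the energy along a curve is
that of the linearization. -/
theorem tendsto_inner_quotient {z : ℝ → X} {t δ : ℝ} (hmd : metricDeriv G.D z t ≠ ⊤)
    (hδ : HasDerivAt (fun s => G.φ (z s)) δ t) :
    Tendsto (fun s => inner ℝ (G.A (z t) (G.F (z t))) ((s - t)⁻¹ • (G.Ψ (z s) - G.Ψ (z t))))
      (𝓝[≠] t) (𝓝 δ) := by
  obtain ⟨R, hu, hR, hv⟩ := G.exists_ball_of_D (z t) 1
  obtain ⟨C, hC, -, H⟩ := G.exists_const R hR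
  have h1 := hasDerivAt_iff_tendsto_slope.1 hδ
  have hD := G.tendsto_D_zero hmd
  have h2 : Tendsto (fun s => _root_.slope (fun s => G.φ (z s)) t s -
      inner ℝ (G.A (z t) (G.F (z t))) ((s - t)⁻¹ • (G.Ψ (z s) - G.Ψ (z t)))) (𝓝[≠] t)
      (𝓝 0) := by
    have hlim : Tendsto (fun s => C * ((metricDeriv G.D z t).toReal + 1) * G.D (z s) (z t))
        (𝓝[≠] t) (𝓝 0) := by
      have := hD.const_mul (C * ((metricDeriv G.D z t).toReal + 1))
      simpa using this
    refine squeeze_zero_norm' ?_ hlim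
    filter_upwards [G.eventually_D_le hmd one_pos, self_mem_nhdsWithin,
      hD.eventually (gt_mem_nhds one_pos)] with s hs hst hs1
    have hst' : 0 < |s - t| := abs_pos.2 (sub_ne_zero.2 hst)
    rw [G.D_comm] at hs1
    have h3 := (H (z t) (z s) hu (hv _ hs1.le)).2.2.2.2.2.1
    have e : _root_.slope (fun s => G.φ (z s)) t s -
      inner ℝ (G.A (z t) (G.F (z t))) ((s - t)⁻¹ • (G.Ψ (z s) - G.Ψ (z t))) =
        (s - t)⁻¹ * (G.φ (z s) - G.φ (z t) -
          inner ℝ (G.A (z t) (G.F (z t))) (G.Ψ (z s) - G.Ψ (z t))) := by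
      rw [slope_def_module, inner_smul_right, smul_eq_mul]; ring
    rw [e, norm_mul, norm_inv, Real.norm_eq_abs, Real.norm_eq_abs, inv_mul_le_iff₀ hst']
    refine h3.trans ?_
    have h4 := mul_le_mul_of_nonneg_right hs (G.D_nonneg (z s) (z t))
    have h5 := mul_le_mul_of_nonneg_left h4 (by linarith : (0 : ℝ) ≤ C)
    nlinarith
  have := h1.sub h2
  simpa using this

theorem abs_deriv_le {z : ℝ → X} {t δ : ℝ} (hmd : metricDeriv G.D z t ≠ ⊤)
    (hδ : HasDerivAt (fun s => G.φ (z s)) δ t) :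
    |δ| ≤ G.slope (z t) * (metricDeriv G.D z t).toReal := by
  have h1 := (G.tendsto_inner_quotient hmd hδ).abs
  have h2 : ∀ ε : ℝ, 0 < ε → |δ| ≤ G.slope (z t) * ((metricDeriv G.D z t).toReal + ε) := by
    intro ε hε
    refine le_of_tendsto h1 ?_
    filter_upwards [G.eventually_D_le hmd hε, self_mem_nhdsWithin] with s hs hst
    have hst' : 0 < |s - t| := abs_pos.2 (sub_ne_zero.2 hst)
    refine (abs_real_inner_le_norm _ _).trans (mul_le_mul_of_nonneg_left ?_ (norm_nonneg _))
    rw [norm_smul, norm_inv, Real.norm_eq_abs, inv_mul_le_iff₀ hst', mul_comm]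
    exact hs
  have h3 : Tendsto (fun ε : ℝ => G.slope (z t) * ((metricDeriv G.D z t).toReal + ε)) (𝓝[>] 0)
      (𝓝 (G.slope (z t) * (metricDeriv G.D z t).toReal)) := by
    have : Continuous fun ε : ℝ => G.slope (z t) * ((metricDeriv G.D z t).toReal + ε) := by
      fun_prop
    have := this.tendsto 0
    rw [add_zero] at this
    exact this.mono_left nhdsWithin_le_nhds
  refine ge_of_tendsto h3 ?_
  filter_upwards [self_mem_nhdsWithin] with ε hε using h2 ε hε

/-- The differential inequality of maximal slope forces the difference quotients of a curve to
converge strongly to the negative gradient: their limit superior in norm and their component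
along the gradient are as extreme as the Cauchy-Schwarz inequality permits. -/
theorem hasDerivAt_of_maximal_slope {z : ℝ → X} {t δ : ℝ} (hmd : metricDeriv G.D z t ≠ ⊤)
    (hδ : HasDerivAt (fun s => G.φ (z s)) δ t)
    (h : δ ≤ - (1 / 2) * (metricDeriv G.D z t).toReal ^ 2 - (1 / 2) * G.slope (z t) ^ 2) :
    HasDerivAt z (-G.F (z t)) t := by
  obtain ⟨R, hu, hR, hv⟩ := G.exists_ball_of_D (z t) 1
  obtain ⟨C, hC, H', H⟩ := G.exists_const R hR
  obtain ⟨M, hM⟩ : ∃ M, M = (metricDeriv G.D z t).toReal := ⟨_, rfl⟩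
  have hM0 : 0 ≤ M := hM ▸ ENNReal.toReal_nonneg
  have hq := G.tendsto_inner_quotient hmd hδ
  rw [← hM] at h
  -- the quotients of `Ψ ∘ z` converge to `-A F`
  have h1 : Tendsto (fun s => ‖(s - t)⁻¹ • (G.Ψ (z s) - G.Ψ (z t)) + G.A (z t) (G.F (z t))‖)
      (𝓝[≠] t) (𝓝 0) := by
    have h2 : ∀ ε : ℝ, 0 < ε → ∀ᶠ s in 𝓝[≠] t,
        ‖(s - t)⁻¹ • (G.Ψ (z s) - G.Ψ (z t)) + G.A (z t) (G.F (z t))‖ ^ 2 ≤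
          2 * M * ε + ε ^ 2 + 2 * ε := by
      intro ε hε
      filter_upwards [G.eventually_D_le hmd hε, self_mem_nhdsWithin,
        hq.eventually (gt_mem_nhds (lt_add_of_pos_right δ hε))] with s hs hst hs2
      have hst' : 0 < |s - t| := abs_pos.2 (sub_ne_zero.2 hst)
      have h3 : ‖(s - t)⁻¹ • (G.Ψ (z s) - G.Ψ (z t))‖ ≤ M + ε := by
        rw [norm_smul, norm_inv, Real.norm_eq_abs, inv_mul_le_iff₀ hst', mul_comm, hM]
        exact hs
      have h4 := pow_le_pow_left₀ (norm_nonneg _) h3 2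
      rw [norm_add_sq_real, real_inner_comm]
      change _ + _ + G.slope (z t) ^ 2 ≤ _
      nlinarith
    have h5 : Tendsto
        (fun s => ‖(s - t)⁻¹ • (G.Ψ (z s) - G.Ψ (z t)) + G.A (z t) (G.F (z t))‖ ^ 2)
        (𝓝[≠] t) (𝓝 0) := by
      refine tendsto_order.2 ⟨fun a ha => Eventually.of_forall fun s => ha.trans_le (sq_nonneg _),
        fun a ha => ?_⟩
      have hlim : Tendsto (fun ε : ℝ => 2 * M * ε + ε ^ 2 + 2 * ε) (𝓝[>] 0) (𝓝 0) := by
        have : Continuous fun ε : ℝ => 2 * M * ε + ε ^ 2 + 2 * ε := by fun_prop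
        have := this.tendsto 0
        simp only [mul_zero, ne_eq, OfNat.ofNat_ne_zero, not_false_eq_true, zero_pow,
          add_zero] at this
        exact this.mono_left nhdsWithin_le_nhds
      obtain ⟨ε, hε1, hε2⟩ :=
        ((hlim.eventually (gt_mem_nhds ha)).and self_mem_nhdsWithin).exists
      filter_upwards [h2 ε hε2] with s hs using hs.trans_lt hε1
    have h6 := h5.sqrt
    simpa [Real.sqrt_sq] using h6
  -- and they differ little from the image under `A` of the quotients of `z`
  have hD := G.tendsto_D_zero hmd
  rw [hasDerivAt_iff_tendsto_slope, tendsto_iff_norm_sub_tendsto_zero]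
  have hlim : Tendsto (fun s => C * (‖(s - t)⁻¹ • (G.Ψ (z s) - G.Ψ (z t)) +
      G.A (z t) (G.F (z t))‖ + C ^ 3 * (M + 1) * G.D (z s) (z t))) (𝓝[≠] t) (𝓝 0) := by
    have := (h1.add (hD.const_mul (C ^ 3 * (M + 1)))).const_mul C
    simpa using this
  refine squeeze_zero' (Eventually.of_forall fun _ => norm_nonneg _) ?_ hlim
  filter_upwards [G.eventually_D_le hmd one_pos, self_mem_nhdsWithin,
    hD.eventually (gt_mem_nhds one_pos)] with s hs hst hs1
  have hst' : 0 < |s - t| := abs_pos.2 (sub_ne_zero.2 hst)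
  rw [G.D_comm] at hs1
  obtain ⟨b1, -, b2, -⟩ := H (z t) (z s) hu (hv _ hs1.le)
  rw [slope_def_module, sub_neg_eq_add]
  refine ((H' (z t) hu).1 _).trans (mul_le_mul_of_nonneg_left ?_ (by linarith))
  have e : G.A (z t) ((s - t)⁻¹ • (z s - z t) + G.F (z t)) =
      ((s - t)⁻¹ • (G.Ψ (z s) - G.Ψ (z t)) + G.A (z t) (G.F (z t))) -
        (s - t)⁻¹ • (G.Ψ (z s) - G.Ψ (z t) - G.A (z t) (z s - z t)) := by
    rw [map_add, map_smul]
    module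
  rw [e]
  refine (norm_sub_le _ _).trans (add_le_add_right ?_ _)
  rw [norm_smul, norm_inv, Real.norm_eq_abs, inv_mul_le_iff₀ hst']
  refine b2.trans ?_
  rw [norm_sub_rev] at b1
  rw [G.D_comm] at b1
  have b3 := pow_le_pow_left₀ (norm_nonneg _) b1 2
  have b4 := mul_le_mul_of_nonneg_right hs (G.D_nonneg (z s) (z t))
  rw [← hM] at b4
  calc C * ‖z s - z t‖ ^ 2 ≤ C * (C * G.D (z s) (z t)) ^ 2 :=
        mul_le_mul_of_nonneg_left b3 (by linarith)
    _ = C ^ 3 * (G.D (z s) (z t) * G.D (z s) (z t)) := by ring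
    _ ≤ C ^ 3 * ((M + 1) * |s - t| * G.D (z s) (z t)) :=
        mul_le_mul_of_nonneg_left b4 (by positivity)
    _ = _ := by ring

/-- On a compact interval an absolutely continuous curve is bounded, it is absolutely continuous
with respect to the norm, and so is the energy along it. -/
theorem ACOn.exists_norm_bound {z : ℝ → X} {a b : ℝ} (hab : a ≤ b) (hz : ACOn G.D z (Icc a b)) :
    ∃ (C : ℝ) (m : ℝ → ℝ), IntegrableOn m (Icc a b) ∧
      (∀ s ∈ Icc a b, ∀ t ∈ Icc a b, s ≤ t → ‖z s - z t‖ ≤ C * ∫ r in s..t, m r) ∧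
      (∀ s ∈ Icc a b, ∀ t ∈ Icc a b, s ≤ t → |G.φ (z s) - G.φ (z t)| ≤ C * ∫ r in s..t, m r) := by
  obtain ⟨m, hm, h⟩ := hz
  have hm' : IntervalIntegrable m volume a b := by
    rw [intervalIntegrable_iff_integrableOn_Icc_of_le hab]; exact hm
  obtain ⟨R, hu, hR, hv⟩ := G.exists_ball_of_D (z a) (∫ r in a..b, |m r|)
  obtain ⟨C, hC, -, H⟩ := G.exists_const R hR
  have hb : ∀ t ∈ Icc a b, ‖z t‖ ≤ R := fun t ht => by
    refine hv _ ((h a (left_mem_Icc.2 hab) t ht ht.1).trans ?_)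
    refine (le_abs_self _).trans
      ((intervalIntegral.abs_integral_le_integral_abs ht.1).trans ?_)
    refine intervalIntegral.integral_mono_interval le_rfl ht.1 ht.2
      (Eventually.of_forall fun _ => abs_nonneg _) hm'.abs
  refine ⟨C, m, hm, fun s hs t ht hst => ?_, fun s hs t ht hst => ?_⟩
  · exact (H (z s) (z t) (hb s hs) (hb t ht)).1.trans
      (mul_le_mul_of_nonneg_left (h s hs t ht hst) (by linarith))
  · have := (H (z t) (z s) (hb t ht) (hb s hs)).2.2.2.2.2.2.1
    exact this.trans (mul_le_mul_of_nonneg_left (h s hs t ht hst) (by linarith))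

theorem ACOn.absolutelyContinuous {z : ℝ → X} {a b : ℝ} (hab : a ≤ b)
    (hz : ACOn G.D z (Icc a b)) : AbsolutelyContinuousOnInterval z a b := by
  obtain ⟨C, m, hm, h, -⟩ := exists_norm_bound G hab hz
  refine absolutelyContinuousOnInterval_of_dist_le hab hm (C := C) ?_
  simpa only [dist_eq_norm] using h

theorem ACOn.absolutelyContinuous_energy {z : ℝ → X} {a b : ℝ} (hab : a ≤ b)
    (hz : ACOn G.D z (Icc a b)) :
    AbsolutelyContinuousOnInterval (fun t => G.φ (z t)) a b := by
  obtain ⟨C, m, hm, -, h⟩ := exists_norm_bound G hab hz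
  refine absolutelyContinuousOnInterval_of_dist_le hab hm (C := C) ?_
  simpa only [Real.dist_eq] using h

theorem ACOn.mono {X : Type*} {d : X → X → ℝ} {z : ℝ → X} {J J' : Set ℝ} (h : ACOn d z J)
    (hJ : J' ⊆ J) : ACOn d z J' := by
  obtain ⟨m, hm, h⟩ := h
  exact ⟨m, hm.mono_set hJ, fun s hs t ht => h s (hJ hs) t (hJ ht)⟩

theorem isStrongUpperGradient :
    IsStrongUpperGradient G.D G.φ (fun x => ENNReal.ofReal (G.slope x)) := by
  intro a b z hz
  constructor
  · have hcont : ContinuousOn z (Ioo a b) := by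
      intro t ht
      obtain ⟨a', ha', hat⟩ := exists_between ht.1
      obtain ⟨b', hb', hbt⟩ := exists_between ht.2
      have hz' : ACOn G.D z (Icc a' b') := ACOn.mono hz fun r hr =>
        ⟨ha'.trans_le hr.1, hr.2.trans_lt hbt⟩
      have hab : a' ≤ b' := (hat.trans hb').le
      have h1 := (ACOn.absolutelyContinuous G hab hz').continuousOn
      rw [uIcc_of_le hab] at h1
      exact (h1.continuousAt (Icc_mem_nhds hat hb')).continuousWithinAt
    have h2 : Continuous fun t : Ioo a b => z t := hcont.domRestrict
    exact (ENNReal.continuous_ofReal.comp (G.continuous_slope.comp h2)).measurable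
  · intro s t has hst htb
    have hz' : ACOn G.D z (Icc s t) := ACOn.mono hz fun r hr =>
      ⟨has.trans_le hr.1, hr.2.trans_lt htb⟩
    have hac := ACOn.absolutelyContinuous_energy G hst hz'
    rw [← hac.integral_deriv_eq_sub, ← Real.enorm_eq_ofReal_abs,
      intervalIntegral.integral_of_le hst, integral_Ioc_eq_integral_Ioo]
    refine (enorm_integral_le_lintegral_enorm _).trans ?_
    refine lintegral_mono_ae ?_
    rw [ae_restrict_iff' measurableSet_Ioo]
    filter_upwards [hac.ae_differentiableAt, ACOn.ae_metricDeriv_ne_top G hst hz']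
      with r h1 h2 hr
    have h3 := h1 (by rw [uIcc_of_le hst]; exact Ioo_subset_Icc_self hr)
    have h4 := h2 hr
    have h5 := G.abs_deriv_le h4 h3.hasDerivAt
    rw [Real.enorm_eq_ofReal_abs]
    refine (ENNReal.ofReal_le_ofReal h5).trans ?_
    rw [ENNReal.ofReal_mul (G.slope_nonneg _), ENNReal.ofReal_toReal h4]

/-- A curve of maximal slope solves the ordinary differential equation `z' = -F(z)` in integral
form. -/
theorem eq_integral_of_maximal_slope {z : ℝ → X}
    (hz : IsCurveOfMaximalSlope G.D G.φ (fun x => ENNReal.ofReal (G.slope x)) z) :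
    ContinuousOn z (Ici 0) ∧ ∀ t, 0 ≤ t → z t = z 0 + ∫ r in (0 : ℝ)..t, -G.F (z r) := by
  have hcont : ∀ T : ℝ, 0 < T → ContinuousOn z (Icc 0 T) := fun T hT => by
    have := (ACOn.absolutelyContinuous G hT.le (hz.1 T hT)).continuousOn
    rwa [uIcc_of_le hT.le] at this
  constructor
  · intro t ht
    have h1 := hcont (t + 1) (by have : (0 : ℝ) ≤ t := ht; linarith) t ⟨ht, by linarith⟩
    refine h1.mono_of_mem_nhdsWithin ?_
    rw [← Ici_inter_Iic]
    exact inter_mem self_mem_nhdsWithin (nhdsWithin_le_nhds (Iic_mem_nhds (by linarith)))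
  intro T hT0
  rcases hT0.eq_or_lt with rfl | hT
  · simp
  obtain ⟨C, m, hm, h, -⟩ := ACOn.exists_norm_bound G hT.le (hz.1 T hT)
  have hFc : ContinuousOn (fun r => -G.F (z r)) (Icc 0 T) :=
    (G.continuous_F.comp_continuousOn (hcont T hT)).neg
  obtain ⟨B, hB⟩ := isCompact_Icc.exists_bound_of_continuousOn hFc
  have hFi : IntervalIntegrable (fun r => -G.F (z r)) volume 0 T :=
    (hFc.mono (by rw [uIcc_of_le hT.le])).intervalIntegrable
  have hm' : IntervalIntegrable m volume 0 T := by
    rw [intervalIntegrable_iff_integrableOn_Icc_of_le hT.le]; exact hm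
  have hsub : ∀ s ∈ Icc 0 T, ∀ t ∈ Icc 0 T, uIcc s t ⊆ uIcc 0 T := fun s hs t ht => by
    rw [uIcc_of_le hT.le]
    exact uIcc_subset_Icc hs ht
  have hac : AbsolutelyContinuousOnInterval
      (fun t => z t - ∫ r in (0 : ℝ)..t, -G.F (z r)) 0 T := by
    refine absolutelyContinuousOnInterval_of_dist_le hT.le (C := 1)
      (m := fun r => C * m r + B) ?_ fun s hs t ht hst => ?_
    · exact (hm.const_mul C).add (integrableOn_const (by simp))
    · have hz0 : (0 : ℝ) ∈ Icc 0 T := ⟨le_rfl, hT.le⟩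
      have e := intervalIntegral.integral_interval_sub_left
        (hFi.mono_set (hsub 0 hz0 t ht)) (hFi.mono_set (hsub 0 hz0 s hs))
      have hmst := hm'.mono_set (hsub s hs t ht)
      rw [dist_eq_norm, one_mul, intervalIntegral.integral_add (hmst.const_mul C)
        intervalIntegrable_const, intervalIntegral.integral_const_mul,
        intervalIntegral.integral_const, smul_eq_mul]
      have e2 : (z s - ∫ r in (0 : ℝ)..s, -G.F (z r)) - (z t - ∫ r in (0 : ℝ)..t, -G.F (z r)) =
          (z s - z t) + ∫ r in s..t, -G.F (z r) := by
        rw [← e]; abel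
      rw [e2]
      refine (norm_add_le _ _).trans (add_le_add (h s hs t ht hst) ?_)
      have := intervalIntegral.norm_integral_le_of_norm_le_const (a := s) (b := t)
        (f := fun r => -G.F (z r)) (C := B) (fun r hr => hB r ?_)
      · rwa [abs_of_nonneg (sub_nonneg.2 hst), mul_comm] at this
      · rw [uIoc_of_le hst] at hr
        exact ⟨hs.1.trans hr.1.le, hr.2.trans ht.2⟩
  have hzero : ∀ᵐ t, t ∈ uIcc 0 T →
      HasDerivAt (fun t => z t - ∫ r in (0 : ℝ)..t, -G.F (z r)) 0 t := by
    have h1 := (ae_restrict_iff' measurableSet_Ioi).1 hz.2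
    filter_upwards [h1, hFi.ae_hasDerivAt_integral,
      (measure_eq_zero_iff_ae_notMem.1 (measure_singleton (0 : ℝ)))] with t h1 h2 h3 ht
    have ht0 : 0 < t := by
      rw [uIcc_of_le hT.le] at ht
      exact lt_of_le_of_ne ht.1 fun h => h3 (by simp [← h])
    obtain ⟨hmd, -, δ, hδ, hle⟩ := h1 ht0
    rw [ENNReal.toReal_ofReal (G.slope_nonneg _)] at hle
    have := (G.hasDerivAt_of_maximal_slope hmd hδ hle).sub (h2 ht 0 left_mem_uIcc)
    rwa [sub_self] at this
  obtain ⟨c, hc⟩ := hac.const_of_ae_hasDerivAt_zero hzero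
  have h0 := hc 0 left_mem_uIcc
  have h1 := hc T right_mem_uIcc
  simp only [intervalIntegral.integral_same, sub_zero] at h0
  rw [h0, ← h1]
  abel

end GradSystem

/-! ### The gradient flow as an ordinary differential equation -/

/-- A bounded, globally Lipschitz vector field has global integral curves. -/
theorem exists_global_integral_curve {E : Type*} [NormedAddCommGroup E] [NormedSpace ℝ E]
    [CompleteSpace E] {v : E → E} {K L : NNReal} (hv : LipschitzWith K v) (hL : ∀ x, ‖v x‖ ≤ L)
    (x₀ : E) : ∃ z : ℝ → E, z 0 = x₀ ∧ ∀ t, HasDerivAt z (v (z t)) t := by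
  have hloc : ∀ n : ℕ, ∃ α : ℝ → E, α 0 = x₀ ∧
      ∀ t ∈ Ioo (-(n + 1 : ℝ)) (n + 1), HasDerivAt α (v (α t)) t := by
    intro n
    have h0 : (0 : ℝ) ∈ Icc (-(n + 1 : ℝ)) (n + 1) := ⟨by linarith, by positivity⟩
    have hp : IsPicardLindelof (fun _ => v) (tmin := -(n + 1 : ℝ)) (tmax := n + 1) ⟨0, h0⟩ x₀
        (L * (n + 1)) 0 L K :=
      { lipschitzOnWith := fun _ _ => hv.lipschitzOnWith
        continuousOn := fun _ _ => continuousOn_const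
        norm_le := fun _ _ x _ => hL x
        mul_max_le := by simp }
    obtain ⟨α, h1, h2⟩ := hp.exists_eq_forall_mem_Icc_hasDerivWithinAt (x := x₀) (by simp)
    exact ⟨α, h1, fun t ht => (h2 t (Ioo_subset_Icc_self ht)).hasDerivAt (Icc_mem_nhds ht.1 ht.2)⟩
  choose α hα0 hα using hloc
  have hagree : ∀ n m : ℕ, n ≤ m → EqOn (α n) (α m) (Ioo (-(n + 1 : ℝ)) (n + 1)) := by
    intro n m hnm
    have hnm' : (n : ℝ) ≤ m := by exact_mod_cast hnm
    refine ODE_solution_unique_of_mem_Ioo (v := fun _ => v) (s := fun _ => univ) (K := K)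
      (t₀ := 0) (fun _ _ => hv.lipschitzOnWith) ⟨by linarith, by positivity⟩
      (fun t ht => ⟨hα n t ht, trivial⟩)
      (fun t ht => ⟨hα m t ⟨by linarith [ht.1], by linarith [ht.2]⟩, trivial⟩)
      (by rw [hα0, hα0])
  refine ⟨fun t => α ⌈|t|⌉₊ t, hα0 _, fun t => ?_⟩
  obtain ⟨n, hn⟩ : ∃ n : ℕ, n = ⌈|t|⌉₊ + 1 := ⟨_, rfl⟩
  have hmem : ∀ s : ℝ, s ∈ Ioo (-((⌈|s|⌉₊ : ℝ) + 1)) (⌈|s|⌉₊ + 1) := fun s => by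
    have := Nat.le_ceil |s|
    have := abs_le.1 this
    exact ⟨by linarith, by linarith⟩
  have ht : t ∈ Ioo (-(n + 1 : ℝ)) (n + 1) := by
    have := hmem t
    rw [hn]; push_cast
    exact ⟨by linarith [this.1], by linarith [this.2]⟩
  have heq : (fun s => α ⌈|s|⌉₊ s) =ᶠ[𝓝 t] α n := by
    have h1 : ∀ᶠ s in 𝓝 t, |s| < |t| + 1 :=
      (continuous_abs.tendsto t).eventually (gt_mem_nhds (by linarith))
    filter_upwards [h1] with s hs
    refine hagree _ _ ?_ (hmem s)
    rw [hn, Nat.ceil_le]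
    push_cast
    exact hs.le.trans (add_le_add_left (Nat.le_ceil _) _)
  have := (hα n t ht).congr_of_eventuallyEq heq
  rwa [← heq.eq_of_nhds] at this

namespace GradSystem

variable {X Y : Type*} [NormedAddCommGroup X] [NormedSpace ℝ X]
  [NormedAddCommGroup Y] [InnerProductSpace ℝ Y] (G : GradSystem X Y)

theorem discrete_energy_le {τ : ℝ} (hτ : 0 < τ) {x₀ : X} {U : ℕ → X}
    (hU : IsDiscreteSolution G.D G.φ τ x₀ U) (n : ℕ) : G.φ (U n) ≤ G.φ x₀ := by
  induction n with
  | zero => rw [hU.1]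
  | succ n ih =>
    have h := hU.2 n (U n)
    have h0 : G.D (U n) (U n) = 0 := by simp [D]
    rw [h0] at h
    have : 0 ≤ 1 / (2 * τ) * G.D (U (n + 1)) (U n) ^ 2 := by positivity
    linarith

variable [CompleteSpace X]

/-- Solutions of `z' = -F(z)` exist for all times: with a cut-off in front of `F` the energy
still does not increase, so that solutions stay in a ball on which the cut-off equals one. -/
theorem exists_flow (x₀ : X) : ∃ z : ℝ → X, z 0 = x₀ ∧ (∀ t, 0 ≤ t → G.φ (z t) ≤ G.φ x₀) ∧
    ∀ t, 0 ≤ t → HasDerivAt z (-G.F (z t)) t := by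
  obtain ⟨R₀, hR₀⟩ := G.bounded_of_φ (G.φ x₀)
  have hR0 : 0 ≤ R₀ := (norm_nonneg _).trans (hR₀ x₀ le_rfl)
  obtain ⟨C, hC, H', H⟩ := G.exists_const (R₀ + 1) (by linarith)
  let χ : X → ℝ := fun x => max 0 (min 1 (R₀ + 1 - ‖x‖))
  have hχ0 : ∀ x, 0 ≤ χ x := fun x => le_max_left _ _
  have hχ1 : ∀ x, χ x ≤ 1 := fun x => max_le zero_le_one (min_le_left _ _)
  have hχz : ∀ x, R₀ + 1 < ‖x‖ → χ x = 0 := fun x hx =>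
    max_eq_left ((min_le_right _ _).trans (by linarith))
  have hχl : ∀ x y, |χ x - χ y| ≤ ‖x - y‖ := fun x y => by
    change |max 0 (min 1 (R₀ + 1 - ‖x‖)) - max 0 (min 1 (R₀ + 1 - ‖y‖))| ≤ _
    rw [max_comm 0, max_comm 0]
    refine (abs_max_sub_max_le_abs _ _ _).trans ?_
    refine (abs_min_sub_min_le_max _ _ _ _).trans ?_
    rw [sub_self, abs_zero, max_eq_right (abs_nonneg _)]
    have : R₀ + 1 - ‖x‖ - (R₀ + 1 - ‖y‖) = ‖y‖ - ‖x‖ := by ring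
    rw [this, norm_sub_rev]
    exact abs_norm_sub_norm_le y x
  have hone : ∀ x, ‖x‖ ≤ R₀ → χ x = 1 := fun x hx => by
    have : min 1 (R₀ + 1 - ‖x‖) = 1 := min_eq_left (by linarith)
    simp [χ, this]
  let v : X → X := fun x => -(χ x • G.F x)
  have hvl : ∀ x y, ‖v x - v y‖ ≤ 2 * C * ‖x - y‖ := by
    have key : ∀ x y, ‖x‖ ≤ R₀ + 1 → ‖v x - v y‖ ≤ 2 * C * ‖x - y‖ := by
      intro x y hx
      rcases le_or_gt ‖y‖ (R₀ + 1) with hy | hy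
      · have e : v x - v y = -(χ x • (G.F x - G.F y) + (χ x - χ y) • G.F y) := by
          simp only [v]; module
        rw [e, norm_neg]
        have b1 : ‖χ x • (G.F x - G.F y)‖ ≤ 1 * (C * ‖x - y‖) := by
          rw [norm_smul, Real.norm_of_nonneg (hχ0 x)]
          exact mul_le_mul (hχ1 x) (H x y hx hy).2.2.2.1 (norm_nonneg _) zero_le_one
        have b2 : ‖(χ x - χ y) • G.F y‖ ≤ ‖x - y‖ * C := by
          rw [norm_smul]
          exact mul_le_mul (hχl x y) (H' y hy).2.2.2.1 (norm_nonneg _) (norm_nonneg _)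
        refine (norm_add_le _ _).trans ?_
        linarith
      · have e : v x - v y = -((χ x - χ y) • G.F x) := by
          simp only [v, hχz y hy]; module
        rw [e, norm_neg, norm_smul]
        have b2 : ‖χ x - χ y‖ * ‖G.F x‖ ≤ ‖x - y‖ * C :=
          mul_le_mul (hχl x y) (H' x hx).2.2.2.1 (norm_nonneg _) (norm_nonneg _)
        have : 0 ≤ C * ‖x - y‖ := by positivity
        linarith
    intro x y
    rcases le_or_gt ‖x‖ (R₀ + 1) with hx | hx
    · exact key x y hx
    rcases le_or_gt ‖y‖ (R₀ + 1) with hy | hy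
    · rw [norm_sub_rev, norm_sub_rev x]; exact key y x hy
    · have : v x - v y = 0 := by simp [v, hχz x hx, hχz y hy]
      rw [this, norm_zero]; positivity
  have hvb : ∀ x, ‖v x‖ ≤ C := by
    intro x
    simp only [v]
    rw [norm_neg, norm_smul, Real.norm_of_nonneg (hχ0 x)]
    rcases le_or_gt ‖x‖ (R₀ + 1) with hx | hx
    · calc χ x * ‖G.F x‖ ≤ 1 * C :=
            mul_le_mul (hχ1 x) (H' x hx).2.2.2.1 (norm_nonneg _) zero_le_one
        _ = C := one_mul C
    · rw [hχz x hx, zero_mul]; linarith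
  have hC0 : 0 ≤ C := by linarith
  obtain ⟨z, hz0, hz⟩ := exists_global_integral_curve (v := v) (K := ⟨2 * C, by positivity⟩)
    (L := ⟨C, hC0⟩) (LipschitzWith.of_dist_le_mul fun x y => by
      rw [dist_eq_norm, dist_eq_norm]; exact hvl x y) hvb x₀
  have hφ : ∀ t, HasDerivAt (fun t => G.φ (z t)) (-(χ (z t) * G.slope (z t) ^ 2)) t := fun t => by
    have := (G.hasFDerivAt_φ (z t)).comp_hasDerivAt t (hz t)
    rwa [show G.dφ (z t) (v (z t)) = -(χ (z t) * G.slope (z t) ^ 2) by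
      simp only [v]; rw [map_neg, map_smul, G.inner_self_F, smul_eq_mul]] at this
  have hanti : Antitone fun t => G.φ (z t) :=
    antitone_of_deriv_nonpos (fun t => (hφ t).differentiableAt) fun t => by
      rw [(hφ t).deriv]
      exact neg_nonpos.2 (mul_nonneg (hχ0 _) (sq_nonneg _))
  have hle : ∀ t, 0 ≤ t → G.φ (z t) ≤ G.φ x₀ := fun t ht => by
    have := hanti ht
    simpa only [hz0] using this
  refine ⟨z, hz0, hle, fun t ht => ?_⟩
  have := hz t
  simpa only [v, hone _ (hR₀ _ (hle t ht)), one_smul] using this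

/-- Along integral curves of `-F` the energy dissipation is balanced. -/
theorem isCurveOfMaximalSlope_of_flow {x₀ : X} {z : ℝ → X}
    (hle : ∀ t, 0 ≤ t → G.φ (z t) ≤ G.φ x₀) (hz : ∀ t, 0 ≤ t → HasDerivAt z (-G.F (z t)) t) :
    IsCurveOfMaximalSlope G.D G.φ (fun x => ENNReal.ofReal (G.slope x)) z := by
  obtain ⟨R, hR⟩ := G.bounded_of_φ (G.φ x₀)
  have hR0 : 0 ≤ R := (norm_nonneg _).trans (hR x₀ le_rfl)
  obtain ⟨C, hC, H', H⟩ := G.exists_const R hR0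
  have hb : ∀ t, 0 ≤ t → ‖z t‖ ≤ R := fun t ht => hR _ (hle t ht)
  constructor
  · intro T hT
    refine ⟨fun _ => C * C, integrableOn_const (by simp), fun s hs t ht hst => ?_⟩
    rw [intervalIntegral.integral_const, smul_eq_mul]
    have h1 := (convex_Icc (0 : ℝ) T).norm_image_sub_le_of_norm_hasDerivWithin_le (C := C)
      (fun r hr => (hz r hr.1).hasDerivWithinAt)
      (fun r hr => by rw [norm_neg]; exact (H' _ (hb r hr.1)).2.2.2.1) ht hs
    rw [Real.norm_eq_abs, abs_sub_comm, abs_of_nonneg (sub_nonneg.2 hst)] at h1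
    have h2 := (H (z s) (z t) (hb s hs.1) (hb t ht.1)).2.1
    have h3 := mul_le_mul_of_nonneg_left h1 (by linarith : 0 ≤ C)
    linarith
  · rw [ae_restrict_iff' measurableSet_Ioi]
    refine Eventually.of_forall fun t ht => ?_
    have hz' := hz t (le_of_lt ht)
    have hmd := G.metricDeriv_eq hz'
    rw [map_neg, norm_neg] at hmd
    refine ⟨by rw [hmd]; exact ENNReal.ofReal_ne_top, ENNReal.ofReal_ne_top, _,
      (G.hasFDerivAt_φ (z t)).comp_hasDerivAt t hz', ?_⟩
    rw [hmd, map_neg, G.inner_self_F, ← slope, ENNReal.toReal_ofReal (G.slope_nonneg _)]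
    linarith

/-- A continuous curve that solves the equation in integral form is bounded, and the square of
its speed has finite integral over all times, as the energy is bounded from below. -/
theorem bounded_and_memLp_of_integral_equation {z : ℝ → X} (hc : ContinuousOn z (Ici 0))
    (hz : ∀ t, 0 ≤ t → z t = z 0 + ∫ r in (0 : ℝ)..t, -G.F (z r)) :
    (∃ R, ∀ t, 0 ≤ t → ‖z t‖ ≤ R) ∧
      MemLp (fun t => G.F (z t)) 2 (volume.restrict (Ioi (0 : ℝ))) := by
  have hFc : ContinuousOn (fun r => G.F (z r)) (Ici 0) := G.continuous_F.comp_continuousOn hc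
  have hsc : ContinuousOn (fun r => G.slope (z r)) (Ici 0) :=
    G.continuous_slope.comp_continuousOn hc
  have hd : ∀ t, 0 < t → HasDerivAt z (-G.F (z t)) t := by
    intro t ht
    have h1 : HasDerivAt (fun t => z 0 + ∫ r in (0 : ℝ)..t, -G.F (z r)) (-G.F (z t)) t := by
      refine (intervalIntegral.integral_hasDerivAt_right ?_ ?_ ?_).const_add _
      · refine (hFc.neg.mono ?_).intervalIntegrable
        rw [uIcc_of_le ht.le]; exact Icc_subset_Ici_self
      · exact (hFc.neg.mono Ioi_subset_Ici_self).stronglyMeasurableAtFilter isOpen_Ioi t ht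
      · exact hFc.neg.continuousAt (Ici_mem_nhds ht)
    refine h1.congr_of_eventuallyEq ?_
    filter_upwards [Ioi_mem_nhds ht] with s hs using hz s (le_of_lt hs)
  have hφ : ∀ t, 0 < t → HasDerivAt (fun t => G.φ (z t)) (-G.slope (z t) ^ 2) t := fun t ht => by
    have := (G.hasFDerivAt_φ (z t)).comp_hasDerivAt t (hd t ht)
    rwa [map_neg, G.inner_self_F] at this
  have hφc : ContinuousOn (fun t => G.φ (z t)) (Ici 0) := fun t ht =>
    (G.hasFDerivAt_φ (z t)).continuousAt.comp_continuousWithinAt (hc t ht)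
  have hbal : ∀ T, 0 ≤ T → ∫ t in (0 : ℝ)..T, -G.slope (z t) ^ 2 = G.φ (z T) - G.φ (z 0) := by
    intro T hT
    refine intervalIntegral.integral_eq_sub_of_hasDerivAt_of_le hT
      (hφc.mono Icc_subset_Ici_self) (fun t ht => hφ t ht.1) ?_
    refine (((hsc.pow 2).neg).mono ?_).intervalIntegrable
    rw [uIcc_of_le hT]; exact Icc_subset_Ici_self
  have hbal' : ∀ T, 0 ≤ T → ∫ t in (0 : ℝ)..T, G.slope (z t) ^ 2 = G.φ (z 0) - G.φ (z T) := by
    intro T hT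
    have := hbal T hT
    rw [intervalIntegral.integral_neg] at this
    linarith
  obtain ⟨R, hR⟩ := G.bounded_of_φ (G.φ (z 0))
  have hb : ∀ t, 0 ≤ t → ‖z t‖ ≤ R := fun t ht => by
    refine hR _ ?_
    have h1 := hbal' t ht
    have h2 : 0 ≤ ∫ t in (0 : ℝ)..t, G.slope (z t) ^ 2 :=
      intervalIntegral.integral_nonneg ht fun _ _ => sq_nonneg _
    linarith
  refine ⟨⟨R, hb⟩, ?_⟩
  have hR0 : 0 ≤ R := (norm_nonneg _).trans (hb 0 le_rfl)
  obtain ⟨C, hC, H', -⟩ := G.exists_const R hR0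
  obtain ⟨m, hm⟩ := G.bddBelow
  have hFm : AEStronglyMeasurable (fun t => G.F (z t)) (volume.restrict (Ioi (0 : ℝ))) :=
    (hFc.mono Ioi_subset_Ici_self).aestronglyMeasurable measurableSet_Ioi
  rw [memLp_two_iff_integrable_sq_norm hFm]
  have hint : IntegrableOn (fun t => G.slope (z t) ^ 2) (Ioi 0) := by
    refine integrableOn_Ioi_of_intervalIntegral_norm_bounded (b := fun n : ℕ => (n : ℝ))
      (l := atTop) (G.φ (z 0) - m) 0 (fun n => ?_) tendsto_natCast_atTop_atTop ?_
    · refine (ContinuousOn.integrableOn_Icc ?_).mono_set Ioc_subset_Icc_self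
      exact (hsc.pow 2).mono Icc_subset_Ici_self
    · refine Eventually.of_forall fun n => ?_
      have h1 := hbal' n n.cast_nonneg
      have h2 := hm (z n)
      simp only [norm_pow, Real.norm_eq_abs, sq_abs]
      linarith
  refine (hint.const_mul (C ^ 2)).mono' (hFm.norm.pow 2) ?_
  rw [ae_restrict_iff' measurableSet_Ioi]
  refine Eventually.of_forall fun t ht => ?_
  rw [Real.norm_of_nonneg (by positivity), ← mul_pow]
  exact pow_le_pow_left₀ (norm_nonneg _) ((H' _ (hb t (le_of_lt ht))).1 _) 2

/-! ### Convergence of the implicit Euler scheme -/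

/-- A minimizer of the incremental problem satisfies the implicit Euler equation up to an error
that is quadratic in the increment. -/
theorem norm_euler_step_le {R C τ : ℝ} (hτ : 0 < τ) (hC : 1 ≤ C)
    (H : ∀ x, ‖x‖ ≤ R → ∀ h, ‖h‖ ≤ C * ‖G.A x h‖)
    (Hr : ∀ x y, ‖x‖ ≤ R → ‖y‖ ≤ R → ‖G.Ψ y - G.Ψ x - G.A x (y - x)‖ ≤ C * ‖y - x‖ ^ 2)
    {U U' : X} (hU : ‖U‖ ≤ R) (hU' : ‖U'‖ ≤ R)
    (hmin : ∀ v, 1 / (2 * τ) * G.D U' U ^ 2 + G.φ U' ≤ 1 / (2 * τ) * G.D v U ^ 2 + G.φ v) :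
    ‖U' - U + τ • G.F U'‖ ≤ C ^ 2 * ‖U' - U‖ ^ 2 := by
  have h1 := (((G.hasFDerivAt_Ψ U').sub_const (G.Ψ U)).norm_sq.const_mul (1 / (2 * τ))).add
    (G.hasFDerivAt_φ U')
  have h2 := IsLocalMin.hasFDerivAt_eq_zero (Eventually.of_forall fun v => hmin v) h1
  have h3 : ∀ h, inner ℝ (G.Ψ U' - G.Ψ U) (G.A U' h) = -(τ * G.dφ U' h) := fun h => by
    have := congrArg (fun L : X →L[ℝ] ℝ => L h) h2
    simp only [add_apply, smul_apply, ContinuousLinearMap.comp_apply, innerSL_apply_apply,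
      smul_eq_mul, nsmul_eq_mul, zero_apply] at this
    field_simp at this
    push_cast at this
    linarith
  obtain ⟨ρ, hρ⟩ : ∃ ρ, ρ = -(G.Ψ U - G.Ψ U' - G.A U' (U - U')) := ⟨_, rfl⟩
  have hρ' : G.Ψ U' - G.Ψ U = G.A U' (U' - U) + ρ := by
    rw [hρ, ← neg_sub U' U, map_neg]; abel
  have hρb : ‖ρ‖ ≤ C * ‖U' - U‖ ^ 2 := by
    rw [hρ, norm_neg, norm_sub_rev U' U]; exact Hr _ _ hU' hU
  obtain ⟨e, he⟩ : ∃ e, e = U' - U + τ • G.F U' := ⟨_, rfl⟩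
  have h4 : inner ℝ (G.A U' e) (G.A U' e) = -inner ℝ ρ (G.A U' e) := by
    have h5 := h3 e
    rw [hρ', inner_add_left, ← G.inner_F] at h5
    nth_rewrite 1 [he]
    rw [map_add, map_smul, inner_add_left, inner_smul_left]
    simp only [conj_trivial]
    linarith
  have h5 : ‖G.A U' e‖ ≤ C * ‖U' - U‖ ^ 2 := by
    rcases (norm_nonneg (G.A U' e)).eq_or_lt with h0 | h0
    · rw [← h0]; positivity
    have h6 : ‖G.A U' e‖ * ‖G.A U' e‖ ≤ C * ‖U' - U‖ ^ 2 * ‖G.A U' e‖ := by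
      rw [← real_inner_self_eq_norm_mul_norm, h4]
      refine (neg_le_abs _).trans ((abs_real_inner_le_norm _ _).trans ?_)
      exact mul_le_mul_of_nonneg_right hρb (norm_nonneg _)
    exact le_of_mul_le_mul_right h6 h0
  rw [← he]
  calc ‖e‖ ≤ C * ‖G.A U' e‖ := H U' hU' e
    _ ≤ C * (C * ‖U' - U‖ ^ 2) := mul_le_mul_of_nonneg_left h5 (by linarith)
    _ = _ := by ring

/-- One step of the discrete solution against the exact flow, and summation over all steps. -/
theorem exists_discrete_error_bound {x₀ : X} {z : ℝ → X} (hz0 : z 0 = x₀)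
    (hle : ∀ t, 0 ≤ t → G.φ (z t) ≤ G.φ x₀) (hz : ∀ t, 0 ≤ t → HasDerivAt z (-G.F (z t)) t) :
    ∃ B C τ₀ : ℝ, 0 ≤ B ∧ 0 ≤ C ∧ 0 < τ₀ ∧ ∀ τ, 0 < τ → τ ≤ τ₀ → ∀ U : ℕ → X,
      IsDiscreteSolution G.D G.φ τ x₀ U → ∀ n : ℕ,
        ‖U n - z (n * τ)‖ ≤ (1 + 2 * C * τ) ^ n * (n * B * τ ^ 2) := by
  obtain ⟨R, hR⟩ := G.bounded_of_φ (G.φ x₀)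
  have hR0 : 0 ≤ R := (norm_nonneg _).trans (hR x₀ le_rfl)
  obtain ⟨C, hC, H', H⟩ := G.exists_const R hR0
  obtain ⟨m, hm⟩ := G.bddBelow
  have hC0 : 0 ≤ C := by linarith
  have hb : ∀ t, 0 ≤ t → ‖z t‖ ≤ R := fun t ht => hR _ (hle t ht)
  obtain ⟨M, hM⟩ : ∃ M, M = 2 * (G.φ x₀ - m) + 1 := ⟨_, rfl⟩
  have hM0 : 0 < M := by have := hm x₀; linarith
  -- the step size for which increments are at most `1 / (2 C²)`
  refine ⟨4 * C ^ 4 + C ^ 2, C, min (1 / (4 * C ^ 6 * M)) (1 / (2 * C)), by positivity, hC0,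
    by positivity, fun τ hτ hττ U hU n => ?_⟩
  have hτ1 : τ * (4 * C ^ 6 * M) ≤ 1 := by
    rw [← le_div_iff₀ (by positivity)]; exact hττ.trans (min_le_left _ _)
  have hτ2 : τ * (2 * C) ≤ 1 := by
    rw [← le_div_iff₀ (by positivity)]; exact hττ.trans (min_le_right _ _)
  have hUb : ∀ n, ‖U n‖ ≤ R := fun n => hR _ (G.discrete_energy_le hτ hU n)
  -- consistency of the discrete solution
  have hstep : ∀ n, ‖U (n + 1) - U n + τ • G.F (U (n + 1))‖ ≤ 4 * C ^ 4 * τ ^ 2 := by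
    intro n
    have h1 := G.norm_euler_step_le hτ hC (fun x hx => (H' x hx).1)
      (fun x y hx hy => (H x y hx hy).2.2.1) (hUb n) (hUb (n + 1)) (hU.2 n)
    obtain ⟨d, hd⟩ : ∃ d, d = ‖U (n + 1) - U n‖ := ⟨_, rfl⟩
    have hd0 : 0 ≤ d := hd ▸ norm_nonneg _
    have h2 : G.D (U (n + 1)) (U n) ^ 2 ≤ τ * M := by
      have h := hU.2 n (U n)
      have h0 : G.D (U n) (U n) = 0 := by simp [D]
      rw [h0] at h
      have h3 := G.discrete_energy_le hτ hU n
      have h4 := hm (U (n + 1))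
      have h5 : 1 / (2 * τ) * G.D (U (n + 1)) (U n) ^ 2 ≤ G.φ x₀ - m := by
        simp only [ne_eq, OfNat.ofNat_ne_zero, not_false_eq_true, zero_pow, mul_zero,
          zero_add] at h
        linarith
      rw [one_div, inv_mul_le_iff₀ (by positivity)] at h5
      nlinarith
    have h3 : d ≤ C * G.D (U (n + 1)) (U n) := hd ▸ (H _ _ (hUb (n + 1)) (hUb n)).1
    have h4 : C ^ 2 * d ≤ 1 / 2 := by
      have h5 : (C ^ 2 * d) ^ 2 ≤ (1 / 2) ^ 2 := by
        calc (C ^ 2 * d) ^ 2 ≤ (C ^ 2 * (C * G.D (U (n + 1)) (U n))) ^ 2 := by gcongr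
          _ = C ^ 6 * G.D (U (n + 1)) (U n) ^ 2 := by ring
          _ ≤ C ^ 6 * (τ * M) := by gcongr
          _ ≤ (1 / 2) ^ 2 := by linarith
      exact le_of_sq_le_sq h5 (by norm_num)
    have h6 : d ≤ 2 * C * τ := by
      have h7 : d ≤ C ^ 2 * d ^ 2 + τ * C := by
        calc d = ‖(U (n + 1) - U n + τ • G.F (U (n + 1))) - τ • G.F (U (n + 1))‖ := by
              rw [add_sub_cancel_right, hd]
          _ ≤ _ := (norm_sub_le _ _).trans (add_le_add (hd ▸ h1) (by
              rw [norm_smul, Real.norm_of_nonneg hτ.le]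
              exact mul_le_mul_of_nonneg_left (H' _ (hUb (n + 1))).2.2.2.1 hτ.le))
      have h8 : C ^ 2 * d ^ 2 ≤ 1 / 2 * d := by
        calc C ^ 2 * d ^ 2 = C ^ 2 * d * d := by ring
          _ ≤ _ := mul_le_mul_of_nonneg_right h4 hd0
      linarith
    refine h1.trans ?_
    rw [← hd]
    calc C ^ 2 * d ^ 2 ≤ C ^ 2 * (2 * C * τ) ^ 2 := by gcongr
      _ = _ := by ring
  -- consistency of the exact flow
  have hflow : ∀ t, 0 ≤ t → ‖z (t + τ) - z t + τ • G.F (z (t + τ))‖ ≤ C ^ 2 * τ ^ 2 := by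
    intro t ht
    have hlip : ∀ r ∈ Icc t (t + τ), ‖z (t + τ) - z r‖ ≤ C * τ := fun r hr => by
      have h1 := (convex_Icc t (t + τ)).norm_image_sub_le_of_norm_hasDerivWithin_le (C := C)
        (f := z) (fun r hr => (hz r (ht.trans hr.1)).hasDerivWithinAt)
        (fun r hr => by rw [norm_neg]; exact (H' _ (hb r (ht.trans hr.1))).2.2.2.1) hr
        (right_mem_Icc.2 (by linarith))
      refine h1.trans (mul_le_mul_of_nonneg_left ?_ hC0)
      rw [Real.norm_of_nonneg (by linarith [hr.2])]
      linarith [hr.1]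
    have h2 := (convex_Icc t (t + τ)).norm_image_sub_le_of_norm_hasDerivWithin_le
      (C := C * (C * τ)) (f := fun r => z r + r • G.F (z (t + τ)))
      (f' := fun r => -G.F (z r) + G.F (z (t + τ)))
      (fun r hr => by
        have h3 := (hz r (ht.trans hr.1)).add
          ((hasDerivAt_id r).smul_const (G.F (z (t + τ))))
        rw [one_smul] at h3
        exact h3.hasDerivWithinAt)
      (fun r hr => by
        rw [neg_add_eq_sub]
        exact ((H _ _ (hb _ (by linarith)) (hb r (ht.trans hr.1))).2.2.2.1).trans
          (mul_le_mul_of_nonneg_left (hlip r hr) hC0))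
      (left_mem_Icc.2 (by linarith)) (right_mem_Icc.2 (by linarith))
    rw [add_sub_cancel_left, Real.norm_of_nonneg hτ.le] at h2
    calc _ = ‖z (t + τ) + (t + τ) • G.F (z (t + τ)) - (z t + t • G.F (z (t + τ)))‖ := by
          congr 1; module
      _ ≤ _ := h2
      _ = _ := by ring
  induction n with
  | zero => simp [hU.1, hz0]
  | succ n ih =>
    have hn0 : 0 ≤ (n : ℝ) * τ := by positivity
    have e1 : ((n + 1 : ℕ) : ℝ) * τ = n * τ + τ := by push_cast; ring
    rw [e1]
    have h1 := hstep n
    have h2 := hflow (n * τ) hn0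
    have h3 := (H _ _ (hUb (n + 1)) (hb (n * τ + τ) (by linarith))).2.2.2.1
    obtain ⟨a, ha⟩ : ∃ a, a = ‖U (n + 1) - z (n * τ + τ)‖ := ⟨_, rfl⟩
    obtain ⟨p, hp⟩ : ∃ p, p = (1 + 2 * C * τ) ^ n * (n * (4 * C ^ 4 + C ^ 2) * τ ^ 2) := ⟨_, rfl⟩
    rw [← ha] at h3 ⊢
    rw [← hp] at ih
    have hp0 : 0 ≤ p := hp ▸ by positivity
    have ha0 : 0 ≤ a := ha ▸ norm_nonneg _
    have h4 : a ≤ p + τ * (C * a) + (4 * C ^ 4 + C ^ 2) * τ ^ 2 := by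
      have e : U (n + 1) - z (n * τ + τ) = (U n - z (n * τ))
          - τ • (G.F (U (n + 1)) - G.F (z (n * τ + τ)))
          + (U (n + 1) - U n + τ • G.F (U (n + 1)))
          - (z (n * τ + τ) - z (n * τ) + τ • G.F (z (n * τ + τ))) := by module
      have h5 : ‖τ • (G.F (U (n + 1)) - G.F (z (n * τ + τ)))‖ ≤ τ * (C * a) := by
        rw [norm_smul, Real.norm_of_nonneg hτ.le]
        exact mul_le_mul_of_nonneg_left h3 hτ.le
      have tri : ∀ u v w x : X, ‖u - v + w - x‖ ≤ ‖u‖ + ‖v‖ + ‖w‖ + ‖x‖ := fun u v w x =>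
        (norm_sub_le _ _).trans (add_le_add_left ((norm_add_le _ _).trans
          (add_le_add_left (norm_sub_le _ _) _)) _)
      have h10 : a ≤ _ := (ha.trans (congrArg norm e)).le.trans (tri _ _ _ _)
      linarith
    obtain ⟨q, hq⟩ : ∃ q, q = p + (4 * C ^ 4 + C ^ 2) * τ ^ 2 := ⟨_, rfl⟩
    have hq0 : 0 ≤ q := hq ▸ by positivity
    -- `1 / (1 - x) ≤ 1 + 2 x` for `0 ≤ x ≤ 1 / 2`
    have h6 : a ≤ (1 + 2 * C * τ) * q := by
      have h7 : a * (1 - C * τ) ≤ q := by linarith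
      have h8 : 1 ≤ (1 + 2 * C * τ) * (1 - C * τ) := by
        have : 0 ≤ C * τ := by positivity
        nlinarith
      calc a ≤ a * ((1 + 2 * C * τ) * (1 - C * τ)) := le_mul_of_one_le_right ha0 h8
        _ = (1 + 2 * C * τ) * (a * (1 - C * τ)) := by ring
        _ ≤ _ := mul_le_mul_of_nonneg_left h7 (by positivity)
    refine h6.trans ?_
    rw [pow_succ', mul_assoc (1 + 2 * C * τ)]
    refine mul_le_mul_of_nonneg_left ?_ (by positivity)
    have h9 : (4 * C ^ 4 + C ^ 2) * τ ^ 2 ≤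
        (1 + 2 * C * τ) ^ n * ((4 * C ^ 4 + C ^ 2) * τ ^ 2) :=
      le_mul_of_one_le_left (by positivity) (one_le_pow₀ (by
        have : 0 ≤ 2 * C * τ := by positivity
        linarith))
    rw [hq, hp]
    push_cast
    calc _ ≤ _ := add_le_add_right h9 _
      _ = _ := by ring

theorem tendsto_discrete {x₀ : X} {z : ℝ → X} (hz0 : z 0 = x₀)
    (hle : ∀ t, 0 ≤ t → G.φ (z t) ≤ G.φ x₀) (hz : ∀ t, 0 ≤ t → HasDerivAt z (-G.F (z t)) t)
    {τ : ℕ → ℝ} {U : ℕ → ℕ → X} (hτ : ∀ j, 0 < τ j) (hτ0 : Tendsto τ atTop (𝓝 0))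
    (hU : ∀ j, IsDiscreteSolution G.D G.φ (τ j) x₀ (U j)) {t : ℝ} (ht : 0 ≤ t) :
    Tendsto (fun j => G.D (interpolation (τ j) (U j) t) (z t)) atTop (𝓝 0) := by
  obtain ⟨B, c, τ₀, hB, hc, hτ₀, herr⟩ := G.exists_discrete_error_bound hz0 hle hz
  obtain ⟨R, hR⟩ := G.bounded_of_φ (G.φ x₀)
  have hR0 : 0 ≤ R := (norm_nonneg _).trans (hR x₀ le_rfl)
  obtain ⟨C, hC, H', H⟩ := G.exists_const R hR0
  have hb : ∀ t, 0 ≤ t → ‖z t‖ ≤ R := fun t ht => hR _ (hle t ht)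
  have hlim : Tendsto (fun j => C * (Real.exp (2 * c * (t + 1)) * ((t + 1) * B * τ j) + C * τ j))
      atTop (𝓝 0) := by
    have h := ((hτ0.const_mul ((t + 1) * B)).const_mul (Real.exp (2 * c * (t + 1)))).add
      (hτ0.const_mul C)
    simpa using h.const_mul C
  refine squeeze_zero' (Eventually.of_forall fun _ => G.D_nonneg _ _) ?_ hlim
  filter_upwards [hτ0.eventually (gt_mem_nhds hτ₀), hτ0.eventually (gt_mem_nhds one_pos)]
    with j hj hj1
  obtain ⟨n, hn⟩ : ∃ n, n = ⌈t / τ j⌉₊ := ⟨_, rfl⟩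
  have hn1 : t ≤ n * τ j := by
    rw [← div_le_iff₀ (hτ j), hn]; exact Nat.le_ceil _
  have hn2 : n * τ j ≤ t + τ j := by
    have h1 := (Nat.ceil_lt_add_one (div_nonneg ht (hτ j).le)).le
    rw [← hn] at h1
    have h2 := mul_le_mul_of_nonneg_right h1 (hτ j).le
    rwa [add_mul, one_mul, div_mul_cancel₀ _ (hτ j).ne'] at h2
  have h1 := herr (τ j) (hτ j) hj.le (U j) (hU j) n
  have h2 : ‖z (n * τ j) - z t‖ ≤ C * τ j := by
    have h3 := (convex_Ici t).norm_image_sub_le_of_norm_hasDerivWithin_le (C := C)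
        (f := z) (fun r hr => (hz r (ht.trans hr)).hasDerivWithinAt)
        (fun r hr => by rw [norm_neg]; exact (H' _ (hb r (ht.trans hr))).2.2.2.1)
        self_mem_Ici hn1
    refine h3.trans (mul_le_mul_of_nonneg_left ?_ (by linarith))
    rw [Real.norm_of_nonneg (by linarith)]
    linarith
  have h4 : (1 + 2 * c * τ j) ^ n * (n * B * τ j ^ 2) ≤
      Real.exp (2 * c * (t + 1)) * ((t + 1) * B * τ j) := by
    have h5 : (1 + 2 * c * τ j) ^ n ≤ Real.exp (2 * c * (t + 1)) := by
      calc (1 + 2 * c * τ j) ^ n ≤ Real.exp (2 * c * τ j) ^ n := by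
            refine pow_le_pow_left₀ ?_ ?_ n
            · have := (hτ j).le; positivity
            · rw [add_comm]; exact Real.add_one_le_exp _
        _ = Real.exp (2 * c * (n * τ j)) := by
            rw [← Real.exp_nat_mul]; congr 1; ring
        _ ≤ _ := by
            refine Real.exp_le_exp.2 (mul_le_mul_of_nonneg_left ?_ (by positivity))
            linarith
    have h6 : n * B * τ j ^ 2 ≤ (t + 1) * B * τ j := by
      calc n * B * τ j ^ 2 = (n * τ j) * (B * τ j) := by ring
        _ ≤ (t + 1) * (B * τ j) := by
            refine mul_le_mul_of_nonneg_right (by linarith) ?_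
            have := (hτ j).le; positivity
        _ = _ := by ring
    refine mul_le_mul h5 h6 ?_ (Real.exp_pos _).le
    have := (hτ j).le; positivity
  have h7 := (H (U j n) (z t) (hR _ (G.discrete_energy_le (hτ j) (hU j) n)) (hb t ht)).2.1
  change G.D (U j ⌈t / τ j⌉₊) (z t) ≤ _
  rw [← hn]
  refine h7.trans (mul_le_mul_of_nonneg_left ?_ (by linarith))
  calc ‖U j n - z t‖ = ‖(U j n - z (n * τ j)) + (z (n * τ j) - z t)‖ := by
        rw [sub_add_sub_cancel]
    _ ≤ _ := (norm_add_le _ _).trans (add_le_add (h1.trans h4) h2)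

end GradSystem

/-! ### Existence of discrete solutions -/

namespace GradSystem

variable {X Y : Type*} [NormedAddCommGroup X] [NormedSpace ℝ X]
  [NormedAddCommGroup Y] [InnerProductSpace ℝ Y] (G : GradSystem X Y) [CompleteSpace X]

/-- Minimizers of the incremental functional exist if distance and energy are convex up to a
term `ρ` that is compact: along a minimizing sequence the defect of convexity at midpoints tends
to zero, so that a subsequence is Cauchy in norm. -/
theorem exists_isDiscreteSolution (ρ : X → ℝ)
    (hD : ∀ R : ℝ, ∃ C : ℝ, ∀ x y u, ‖x‖ ≤ R → ‖y‖ ≤ R → ‖u‖ ≤ R →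
      G.D ((1 / 2 : ℝ) • (x + y)) u ^ 2 ≤
        1 / 2 * G.D x u ^ 2 + 1 / 2 * G.D y u ^ 2 - 1 / 4 * G.D x y ^ 2 + C * ρ (x - y))
    (hφ : ∀ R : ℝ, ∃ C : ℝ, ∀ x y, ‖x‖ ≤ R → ‖y‖ ≤ R →
      G.φ ((1 / 2 : ℝ) • (x + y)) ≤ 1 / 2 * G.φ x + 1 / 2 * G.φ y + C * ρ (x - y))
    (hρ : ∀ x, 0 ≤ ρ x)
    (hcomp : ∀ (x : ℕ → X) (R : ℝ), (∀ n, ‖x n‖ ≤ R) → ∃ σ : ℕ → ℕ, StrictMono σ ∧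
      ∀ ε : ℝ, 0 < ε → ∃ N, ∀ n ≥ N, ∀ m ≥ N, ρ (x (σ n) - x (σ m)) ≤ ε)
    {τ : ℝ} (hτ : 0 < τ) (x₀ : X) : ∃ U : ℕ → X, IsDiscreteSolution G.D G.φ τ x₀ U := by
  have key : ∀ u : X, ∃ u' : X, ∀ v : X,
      1 / (2 * τ) * G.D u' u ^ 2 + G.φ u' ≤ 1 / (2 * τ) * G.D v u ^ 2 + G.φ v := by
    intro u
    obtain ⟨k, hk⟩ : ∃ k, k = 1 / (2 * τ) := ⟨_, rfl⟩
    have hk0 : 0 < k := hk ▸ by positivity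
    rw [← hk]
    let J : X → ℝ := fun v => k * G.D v u ^ 2 + G.φ v
    obtain ⟨m, hm⟩ := G.bddBelow
    have hJm : ∀ v, m ≤ J v := fun v => by
      have : 0 ≤ k * G.D v u ^ 2 := by positivity
      have := hm v
      simp only [J]; linarith
    have hbdd : BddBelow (range J) := ⟨m, by rintro _ ⟨v, rfl⟩; exact hJm v⟩
    obtain ⟨i, hi⟩ : ∃ i, i = ⨅ v, J v := ⟨_, rfl⟩
    have hiJ : ∀ v, i ≤ J v := fun v => hi ▸ ciInf_le hbdd v
    have hseq : ∀ n : ℕ, ∃ v, J v < i + 1 / (n + 1) := fun n => by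
      have : iInf J < i + 1 / (n + 1) := by
        rw [← hi]; have : (0 : ℝ) < 1 / (n + 1) := by positivity
        linarith
      exact exists_lt_of_ciInf_lt this
    choose x hx using hseq
    obtain ⟨R₀, hR₀⟩ := G.bounded_of_φ (i + 1)
    have hxR₀ : ∀ n, ‖x n‖ ≤ R₀ := fun n => by
      refine hR₀ _ ?_
      have h1 := hx n
      have h2 : (1 : ℝ) / (n + 1) ≤ 1 := by
        rw [div_le_one (by positivity)]
        have : (0 : ℝ) ≤ n := n.cast_nonneg
        linarith
      have : 0 ≤ k * G.D (x n) u ^ 2 := by positivity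
      simp only [J] at h1
      linarith
    obtain ⟨R, hR⟩ : ∃ R, R = max R₀ ‖u‖ := ⟨_, rfl⟩
    have hxR : ∀ n, ‖x n‖ ≤ R := fun n => hR ▸ (hxR₀ n).trans (le_max_left _ _)
    have huR : ‖u‖ ≤ R := hR ▸ le_max_right _ _
    obtain ⟨σ, hσ, hσ'⟩ := hcomp x R hxR
    obtain ⟨C₁, hC₁⟩ := hD R
    obtain ⟨C₂, hC₂⟩ := hφ R
    obtain ⟨C₃, hC₃⟩ := G.lower R
    obtain ⟨c, hc⟩ : ∃ c, c = |k * C₁ + C₂| + 1 := ⟨_, rfl⟩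
    have hc0 : 0 < c := hc ▸ by positivity
    have hmid : ∀ a b : X, ‖a‖ ≤ R → ‖b‖ ≤ R →
        k / 4 * G.D a b ^ 2 ≤ 1 / 2 * (J a - i) + 1 / 2 * (J b - i) + c * ρ (a - b) := by
      intro a b ha hb
      have h1 := hiJ ((1 / 2 : ℝ) • (a + b))
      have h2 := mul_le_mul_of_nonneg_left (hC₁ a b u ha hb huR) hk0.le
      have h3 := hC₂ a b ha hb
      have h4 : (k * C₁ + C₂) * ρ (a - b) ≤ c * ρ (a - b) :=
        mul_le_mul_of_nonneg_right (by rw [hc]; linarith [le_abs_self (k * C₁ + C₂)]) (hρ _)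
      simp only [J] at h1 ⊢
      linarith
    have hcau : CauchySeq fun n => x (σ n) := by
      rw [Metric.cauchySeq_iff]
      intro ε hε
      obtain ⟨δ, hδ, hδε⟩ : ∃ δ : ℝ, 0 < δ ∧ |C₃| * δ < ε :=
        ⟨ε / (|C₃| + 1), by positivity, by
          rw [mul_div_assoc', div_lt_iff₀ (by positivity)]; nlinarith [abs_nonneg C₃]⟩
      obtain ⟨N₁, hN₁⟩ := hσ' (k / 4 * δ ^ 2 / (2 * c)) (by positivity)
      obtain ⟨N₂, hN₂⟩ := exists_nat_gt (1 / (k / 4 * δ ^ 2 / 2))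
      refine ⟨max N₁ N₂, fun n hn p hp => ?_⟩
      have hsmall : ∀ n ≥ max N₁ N₂, J (x (σ n)) - i < k / 4 * δ ^ 2 / 2 := fun n hn => by
        have h1 := hx (σ n)
        have h2 : (N₂ : ℝ) ≤ σ n := by
          exact_mod_cast ((le_max_right _ _).trans hn).trans (hσ.id_le n)
        have h3 : (1 : ℝ) / (σ n + 1) < k / 4 * δ ^ 2 / 2 := by
          rw [div_lt_comm₀ (by positivity) (by positivity)]
          linarith
        linarith
      have h1 := hmid _ _ (hxR (σ n)) (hxR (σ p))
      have h2 := hsmall n hn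
      have h3 := hsmall p hp
      have h4 := hN₁ n ((le_max_left _ _).trans hn) p ((le_max_left _ _).trans hp)
      have h5 : c * ρ (x (σ n) - x (σ p)) ≤ k / 4 * δ ^ 2 / 2 := by
        calc _ ≤ c * (k / 4 * δ ^ 2 / (2 * c)) := mul_le_mul_of_nonneg_left h4 hc0.le
          _ = _ := by field_simp
      have h6 : G.D (x (σ n)) (x (σ p)) ≤ δ := by
        refine le_of_sq_le_sq ?_ hδ.le
        have : k / 4 * G.D (x (σ n)) (x (σ p)) ^ 2 ≤ k / 4 * δ ^ 2 := by linarith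
        exact le_of_mul_le_mul_left this (by positivity)
      rw [dist_eq_norm]
      calc _ ≤ C₃ * G.D (x (σ n)) (x (σ p)) := hC₃ _ _ (hxR _) (hxR _)
        _ ≤ |C₃| * δ := mul_le_mul (le_abs_self _) h6 (G.D_nonneg _ _) (abs_nonneg _)
        _ < ε := hδε
    obtain ⟨u', hu'⟩ := cauchySeq_tendsto_of_complete hcau
    have hJc : Continuous J := by
      have h1 : Continuous G.Ψ :=
        continuous_iff_continuousAt.2 fun v => (G.hasFDerivAt_Ψ v).continuousAt
      have h2 : Continuous G.φ :=
        continuous_iff_continuousAt.2 fun v => (G.hasFDerivAt_φ v).continuousAt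
      simp only [J, D]
      fun_prop
    have hlim : J u' ≤ i := by
      have h1 := (hJc.tendsto u').comp hu'
      have h2 : Tendsto (fun n => i + 1 / ((σ n : ℝ) + 1)) atTop (𝓝 (i + 0)) :=
        (tendsto_one_div_add_atTop_nhds_zero_nat.comp hσ.tendsto_atTop).const_add i
      rw [add_zero] at h2
      exact le_of_tendsto_of_tendsto' h1 h2 fun n => (hx (σ n)).le
    exact ⟨u', fun v => hlim.trans (hiJ v)⟩
  choose f hf using key
  exact ⟨fun n => f^[n] x₀, rfl, fun n v => by
    simp only [Function.iterate_succ_apply']; exact hf _ v⟩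

end GradSystem

/-! ### Quadratic systems -/

/-- Data of a gradient system whose distance is `‖R (P x) - R (P y)‖` and whose energy is
`‖W (P x)‖² / 2 - ℓ x + e₀`, with a quadratic map `P x = c + L x + B x x` into an inner product
space and operators `R`, `W` that are bounded from below. The load `ℓ` grows at most linearly in
`P`, not merely in `x`, which makes the energy coercive; the quadratic part of `P` is compact. -/
structure QuadSystem (X Y : Type*) [NormedAddCommGroup X] [NormedSpace ℝ X]
    [NormedAddCommGroup Y] [InnerProductSpace ℝ Y] where
  c : Y
  L : X →L[ℝ] Y
  B : X →L[ℝ] X →L[ℝ] Y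
  symm : ∀ x y, B x y = B y x
  R : Y →L[ℝ] Y
  W : Y →L[ℝ] Y
  ℓ : X →L[ℝ] ℝ
  e₀ : ℝ
  R_lower : ∃ C : ℝ, ∀ y, ‖y‖ ≤ C * ‖R y‖
  W_lower : ∃ C : ℝ, ∀ y, ‖y‖ ≤ C * ‖W y‖
  lower : ∀ r : ℝ, ∃ C : ℝ, ∀ x y, ‖x‖ ≤ r → ‖y‖ ≤ r →
    ‖x - y‖ ≤ C * ‖(c + L x + B x x) - (c + L y + B y y)‖
  bounded : ∀ r : ℝ, ∃ C : ℝ, ∀ x, ‖c + L x + B x x‖ ≤ r → ‖x‖ ≤ C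
  load : ∃ C : ℝ, ∀ x, |ℓ x| ≤ C * (1 + ‖c + L x + B x x‖)
  compact : ∀ (x : ℕ → X) (r : ℝ), (∀ n, ‖x n‖ ≤ r) → ∃ σ : ℕ → ℕ, StrictMono σ ∧
      ∀ ε : ℝ, 0 < ε → ∃ N, ∀ n ≥ N, ∀ m ≥ N,
        ‖B (x (σ n) - x (σ m)) (x (σ n) - x (σ m))‖ ≤ ε

namespace QuadSystem

variable {X Y : Type*} [NormedAddCommGroup X] [NormedSpace ℝ X]
  [NormedAddCommGroup Y] [InnerProductSpace ℝ Y] (Q : QuadSystem X Y)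

/-- The quadratic map. -/
def P (x : X) : Y := Q.c + Q.L x + Q.B x x

/-- The derivative of the quadratic map. -/
def dP (x : X) : X →L[ℝ] Y := Q.L + (2 : ℝ) • Q.B x

/-- The energy. -/
def φ (x : X) : ℝ := 1 / 2 * ‖Q.W (Q.P x)‖ ^ 2 - Q.ℓ x + Q.e₀

/-- The derivative of the energy. -/
def dφ (x : X) : X →L[ℝ] ℝ := (innerSL ℝ (Q.W (Q.P x))).comp (Q.W.comp (Q.dP x)) - Q.ℓ

theorem dφ_apply (x h : X) : Q.dφ x h = inner ℝ (Q.W (Q.P x)) (Q.W (Q.dP x h)) - Q.ℓ h := rfl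

theorem P_add (x h : X) : Q.P (x + h) = Q.P x + Q.dP x h + Q.B h h := by
  simp only [P, dP, map_add, add_apply, smul_apply, Q.symm h x]
  module

theorem P_sub (x y : X) : Q.P y - Q.P x - Q.dP x (y - x) = Q.B (y - x) (y - x) := by
  have := Q.P_add x (y - x)
  rw [add_sub_cancel] at this
  rw [this]; abel

theorem dP_sub (x y : X) : Q.dP x - Q.dP y = (2 : ℝ) • Q.B (x - y) := by
  simp only [dP, map_sub]; module

theorem P_mid (x y : X) :
    Q.P ((1 / 2 : ℝ) • (x + y)) =
      (1 / 2 : ℝ) • (Q.P x + Q.P y) - (1 / 4 : ℝ) • Q.B (x - y) (x - y) := by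
  simp only [P, map_add, map_sub, map_smul, add_apply, smul_apply, sub_apply, Q.symm y x]
  module

theorem norm_B_le (x y : X) : ‖Q.B x y‖ ≤ ‖Q.B‖ * ‖x‖ * ‖y‖ := Q.B.le_opNorm₂ x y

theorem exists_W_lower : ∃ C : ℝ, 0 < C ∧ ∀ y, ‖y‖ ≤ C * ‖Q.W y‖ := by
  obtain ⟨C, hC⟩ := Q.W_lower
  refine ⟨|C| + 1, by positivity, fun y => (hC y).trans ?_⟩
  exact mul_le_mul_of_nonneg_right (by linarith [le_abs_self C]) (norm_nonneg _)

/-- Coercivity: the energy is quadratic in `P`, and the load at most linear. -/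
theorem exists_coercive : ∃ a b : ℝ, 0 < a ∧ ∀ x, a * ‖Q.P x‖ ^ 2 - b ≤ Q.φ x := by
  obtain ⟨C, hC0, hC⟩ := Q.exists_W_lower
  obtain ⟨K, hK⟩ := Q.load
  refine ⟨1 / (4 * C ^ 2), C ^ 2 * K ^ 2 + K - Q.e₀, by positivity, fun x => ?_⟩
  have h1 := hC (Q.P x)
  have h2 : |Q.ℓ x| ≤ K * (1 + ‖Q.P x‖) := hK x
  have h3 := (abs_le.1 h2).2
  obtain ⟨p, hp⟩ : ∃ p, p = ‖Q.P x‖ := ⟨_, rfl⟩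
  obtain ⟨w, hw⟩ : ∃ w, w = ‖Q.W (Q.P x)‖ := ⟨_, rfl⟩
  rw [← hp] at h1 h3 ⊢
  rw [← hw] at h1
  have hp0 : 0 ≤ p := hp ▸ norm_nonneg _
  have h4 : p ^ 2 ≤ C ^ 2 * w ^ 2 := by
    rw [← mul_pow]; exact pow_le_pow_left₀ hp0 h1 2
  have h5 : 1 / (2 * C ^ 2) * p ^ 2 ≤ 1 / 2 * w ^ 2 := by
    calc 1 / (2 * C ^ 2) * p ^ 2 ≤ 1 / (2 * C ^ 2) * (C ^ 2 * w ^ 2) :=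
          mul_le_mul_of_nonneg_left h4 (by positivity)
      _ = _ := by field_simp
  -- `K p ≤ p² / (4 C²) + C² K²`
  have h6 : K * p ≤ 1 / (4 * C ^ 2) * p ^ 2 + C ^ 2 * K ^ 2 := by
    have h7 : 1 / (4 * C ^ 2) * p ^ 2 + C ^ 2 * K ^ 2 - K * p = (p / (2 * C) - C * K) ^ 2 := by
      field_simp; ring
    have := sq_nonneg (p / (2 * C) - C * K)
    linarith
  have h8 : 1 / (2 * C ^ 2) * p ^ 2 = 1 / (4 * C ^ 2) * p ^ 2 + 1 / (4 * C ^ 2) * p ^ 2 := by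
    field_simp; ring
  simp only [φ, ← hw]
  linarith

theorem norm_P_le {r : ℝ} {x : X} (hx : ‖x‖ ≤ r) :
    ‖Q.P x‖ ≤ ‖Q.c‖ + ‖Q.L‖ * r + ‖Q.B‖ * r * r := by
  have hr : 0 ≤ r := (norm_nonneg _).trans hx
  refine (norm_add_le _ _).trans (add_le_add ((norm_add_le _ _).trans (add_le_add_right ?_ _)) ?_)
  · exact (Q.L.le_opNorm x).trans (mul_le_mul_of_nonneg_left hx (norm_nonneg _))
  · refine (Q.norm_B_le x x).trans ?_
    gcongr

theorem norm_dP_le {r : ℝ} {x : X} (hx : ‖x‖ ≤ r) (h : X) :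
    ‖Q.dP x h‖ ≤ (‖Q.L‖ + 2 * ‖Q.B‖ * r) * ‖h‖ := by
  simp only [dP, add_apply, smul_apply]
  refine (norm_add_le _ _).trans ?_
  rw [norm_smul, add_mul, Real.norm_of_nonneg (by norm_num)]
  refine add_le_add (Q.L.le_opNorm h) ?_
  have h1 := Q.norm_B_le x h
  have h2 : ‖Q.B‖ * ‖x‖ * ‖h‖ ≤ ‖Q.B‖ * r * ‖h‖ := by gcongr
  linarith

theorem φ_taylor (r : ℝ) : ∃ C : ℝ, ∀ x y, ‖x‖ ≤ r → ‖y‖ ≤ r →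
    |Q.φ y - Q.φ x - Q.dφ x (y - x)| ≤ C * ‖y - x‖ ^ 2 := by
  obtain ⟨p, hp⟩ : ∃ p, p = ‖Q.c‖ + ‖Q.L‖ * r + ‖Q.B‖ * r * r := ⟨_, rfl⟩
  obtain ⟨a, ha⟩ : ∃ a, a = ‖Q.L‖ + 2 * ‖Q.B‖ * r := ⟨_, rfl⟩
  obtain ⟨b, hb⟩ : ∃ b, b = a + ‖Q.B‖ * (2 * r) := ⟨_, rfl⟩
  refine ⟨1 / 2 * (‖Q.W‖ * b) ^ 2 + ‖Q.W‖ * p * (‖Q.W‖ * ‖Q.B‖), fun x y hx hy => ?_⟩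
  have hr : 0 ≤ r := (norm_nonneg _).trans hx
  obtain ⟨h, hh⟩ : ∃ h, h = y - x := ⟨_, rfl⟩
  have hhr : ‖h‖ ≤ 2 * r := by
    rw [hh]; exact (norm_sub_le _ _).trans (by linarith)
  have hy' : y = x + h := by rw [hh]; abel
  have e : Q.φ y - Q.φ x - Q.dφ x h = 1 / 2 * ‖Q.W (Q.dP x h + Q.B h h)‖ ^ 2
      + inner ℝ (Q.W (Q.P x)) (Q.W (Q.B h h)) := by
    rw [dφ_apply, φ, φ, hy', Q.P_add, add_assoc, map_add Q.W (Q.P x), norm_add_sq_real,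
      map_add Q.W (Q.dP x h), inner_add_right, map_add Q.ℓ]
    ring
  rw [← hh, e]
  have hBh : ‖Q.B h h‖ ≤ ‖Q.B‖ * ‖h‖ ^ 2 := by
    have := Q.norm_B_le h h
    rwa [mul_assoc, ← sq] at this
  have h1 : ‖Q.W (Q.dP x h + Q.B h h)‖ ≤ ‖Q.W‖ * b * ‖h‖ := by
    rw [mul_assoc]
    refine (Q.W.le_opNorm _).trans (mul_le_mul_of_nonneg_left ?_ (norm_nonneg _))
    refine (norm_add_le _ _).trans ?_
    rw [hb, add_mul]
    refine add_le_add (ha ▸ Q.norm_dP_le hx h) (hBh.trans ?_)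
    rw [sq, ← mul_assoc]
    gcongr
  have h2 : |inner ℝ (Q.W (Q.P x)) (Q.W (Q.B h h))| ≤
      ‖Q.W‖ * p * (‖Q.W‖ * (‖Q.B‖ * ‖h‖ ^ 2)) := by
    refine (abs_real_inner_le_norm _ _).trans ?_
    have h3 : ‖Q.W (Q.P x)‖ ≤ ‖Q.W‖ * p :=
      (Q.W.le_opNorm _).trans (mul_le_mul_of_nonneg_left (hp ▸ Q.norm_P_le hx) (norm_nonneg _))
    exact mul_le_mul h3 ((Q.W.le_opNorm _).trans (mul_le_mul_of_nonneg_left hBh (norm_nonneg _)))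
      (norm_nonneg _) ((norm_nonneg _).trans h3)
  have h4 := pow_le_pow_left₀ (norm_nonneg _) h1 2
  refine (abs_add_le _ _).trans ?_
  rw [abs_of_nonneg (by positivity)]
  calc _ ≤ 1 / 2 * (‖Q.W‖ * b * ‖h‖) ^ 2 + ‖Q.W‖ * p * (‖Q.W‖ * (‖Q.B‖ * ‖h‖ ^ 2)) := by
        linarith
    _ = _ := by ring

theorem norm_P_sub_le {r : ℝ} {x y : X} (hx : ‖x‖ ≤ r) (hy : ‖y‖ ≤ r) :
    ‖Q.P x - Q.P y‖ ≤ (‖Q.L‖ + 4 * ‖Q.B‖ * r) * ‖x - y‖ := by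
  have hr : 0 ≤ r := (norm_nonneg _).trans hx
  have h1 := Q.P_sub y x
  have e : Q.P x - Q.P y = Q.dP y (x - y) + Q.B (x - y) (x - y) := by rw [← h1]; abel
  have h2 : ‖x - y‖ ≤ 2 * r := (norm_sub_le _ _).trans (by linarith)
  rw [e]
  refine (norm_add_le _ _).trans ?_
  have h3 := Q.norm_dP_le hy (x - y)
  have h4 : ‖Q.B (x - y) (x - y)‖ ≤ ‖Q.B‖ * (2 * r) * ‖x - y‖ :=
    (Q.norm_B_le _ _).trans (by gcongr)
  linarith

theorem dφ_lip (r : ℝ) : ∃ C : ℝ, ∀ x y, ‖x‖ ≤ r → ‖y‖ ≤ r →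
    ‖Q.dφ x - Q.dφ y‖ ≤ C * ‖x - y‖ := by
  obtain ⟨p, hp⟩ : ∃ p, p = ‖Q.c‖ + ‖Q.L‖ * r + ‖Q.B‖ * r * r := ⟨_, rfl⟩
  obtain ⟨a, ha⟩ : ∃ a, a = ‖Q.L‖ + 2 * ‖Q.B‖ * r := ⟨_, rfl⟩
  obtain ⟨b, hb⟩ : ∃ b, b = ‖Q.L‖ + 4 * ‖Q.B‖ * r := ⟨_, rfl⟩
  refine ⟨‖Q.W‖ * b * (‖Q.W‖ * a) + ‖Q.W‖ * p * (‖Q.W‖ * (2 * ‖Q.B‖)), fun x y hx hy => ?_⟩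
  have hr : 0 ≤ r := (norm_nonneg _).trans hx
  have hp0 : 0 ≤ p := hp ▸ by positivity
  have ha0 : 0 ≤ a := ha ▸ by positivity
  have hb0 : 0 ≤ b := hb ▸ by positivity
  refine ContinuousLinearMap.opNorm_le_bound _ (by positivity) fun h => ?_
  have e : (Q.dφ x - Q.dφ y) h = inner ℝ (Q.W (Q.P x - Q.P y)) (Q.W (Q.dP x h))
      + inner ℝ (Q.W (Q.P y)) (Q.W ((2 : ℝ) • Q.B (x - y) h)) := by
    have h1 : (2 : ℝ) • Q.B (x - y) h = Q.dP x h - Q.dP y h := by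
      have := congrArg (fun T : X →L[ℝ] Y => T h) (Q.dP_sub x y)
      simpa using this.symm
    rw [h1, sub_apply, dφ_apply, dφ_apply, map_sub, map_sub, inner_sub_left, inner_sub_right]
    ring
  rw [e]
  have b1 : ‖Q.W (Q.P x - Q.P y)‖ ≤ ‖Q.W‖ * (b * ‖x - y‖) :=
    (Q.W.le_opNorm _).trans (mul_le_mul_of_nonneg_left (hb ▸ Q.norm_P_sub_le hx hy)
      (norm_nonneg _))
  have b2 : ‖Q.W (Q.dP x h)‖ ≤ ‖Q.W‖ * (a * ‖h‖) :=
    (Q.W.le_opNorm _).trans (mul_le_mul_of_nonneg_left (ha ▸ Q.norm_dP_le hx h) (norm_nonneg _))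
  have b3 : ‖Q.W (Q.P y)‖ ≤ ‖Q.W‖ * p :=
    (Q.W.le_opNorm _).trans (mul_le_mul_of_nonneg_left (hp ▸ Q.norm_P_le hy) (norm_nonneg _))
  have b4 : ‖Q.W ((2 : ℝ) • Q.B (x - y) h)‖ ≤ ‖Q.W‖ * (2 * (‖Q.B‖ * ‖x - y‖ * ‖h‖)) := by
    refine (Q.W.le_opNorm _).trans (mul_le_mul_of_nonneg_left ?_ (norm_nonneg _))
    rw [norm_smul, Real.norm_of_nonneg (by norm_num)]
    exact mul_le_mul_of_nonneg_left (Q.norm_B_le _ _) (by norm_num)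
  have c1 := (abs_real_inner_le_norm (Q.W (Q.P x - Q.P y)) (Q.W (Q.dP x h))).trans
    (mul_le_mul b1 b2 (norm_nonneg _) (by positivity))
  have c2 := (abs_real_inner_le_norm (Q.W (Q.P y)) (Q.W ((2 : ℝ) • Q.B (x - y) h))).trans
    (mul_le_mul b3 b4 (norm_nonneg _) (by positivity))
  rw [Real.norm_eq_abs]
  refine (abs_add_le _ _).trans ((add_le_add c1 c2).trans (le_of_eq ?_))
  ring

/-- The gradient system of a quadratic system. -/
def toGradSystem : GradSystem X Y where
  Ψ x := Q.R (Q.P x)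
  A x := Q.R.comp (Q.dP x)
  φ := Q.φ
  dφ := Q.dφ
  Ψ_taylor r := by
    refine ⟨‖Q.R‖ * ‖Q.B‖, fun x y _ _ => ?_⟩
    have e : Q.R (Q.P y) - Q.R (Q.P x) - (Q.R.comp (Q.dP x)) (y - x) =
        Q.R (Q.B (y - x) (y - x)) := by
      rw [← Q.P_sub, map_sub Q.R, map_sub Q.R]; rfl
    rw [e, mul_assoc, sq, ← mul_assoc ‖Q.B‖]
    exact (Q.R.le_opNorm _).trans (mul_le_mul_of_nonneg_left (Q.norm_B_le _ _) (norm_nonneg _))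
  A_lip r := by
    refine ⟨‖Q.R‖ * (2 * ‖Q.B‖), fun x y _ _ => ?_⟩
    have e : Q.R.comp (Q.dP x) - Q.R.comp (Q.dP y) = Q.R.comp ((2 : ℝ) • Q.B (x - y)) := by
      rw [← Q.dP_sub, ContinuousLinearMap.comp_sub]
    rw [e]
    refine (Q.R.opNorm_comp_le _).trans ?_
    rw [norm_smul, Real.norm_of_nonneg (by norm_num), mul_assoc, mul_assoc]
    refine mul_le_mul_of_nonneg_left ?_ (norm_nonneg _)
    exact mul_le_mul_of_nonneg_left (Q.B.le_opNorm _) (by norm_num)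
  lower r := by
    obtain ⟨C, hC⟩ := Q.lower r
    obtain ⟨K, hK⟩ := Q.R_lower
    refine ⟨|C| * K, fun x y hx hy => ?_⟩
    rw [← map_sub, mul_assoc]
    calc _ ≤ C * ‖Q.P x - Q.P y‖ := hC x y hx hy
      _ ≤ |C| * ‖Q.P x - Q.P y‖ := mul_le_mul_of_nonneg_right (le_abs_self _) (norm_nonneg _)
      _ ≤ _ := mul_le_mul_of_nonneg_left (hK _) (abs_nonneg _)
  φ_taylor := Q.φ_taylor
  dφ_lip := Q.dφ_lip
  bounded_of_Ψ r := by
    obtain ⟨K, hK⟩ := Q.R_lower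
    obtain ⟨C, hC⟩ := Q.bounded (|K| * r)
    refine ⟨C, fun x hx => hC x ?_⟩
    calc _ ≤ K * ‖Q.R (Q.P x)‖ := hK _
      _ ≤ |K| * r := mul_le_mul (le_abs_self _) hx (norm_nonneg _) (abs_nonneg _)
  bounded_of_φ r := by
    obtain ⟨a, b, ha, hab⟩ := Q.exists_coercive
    obtain ⟨C, hC⟩ := Q.bounded (Real.sqrt ((r + b) / a))
    refine ⟨C, fun x hx => hC x (Real.le_sqrt_of_sq_le ?_)⟩
    rw [le_div_iff₀ ha, mul_comm]
    have := hab x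
    rw [P] at this
    linarith
  bddBelow := by
    obtain ⟨a, b, ha, hab⟩ := Q.exists_coercive
    refine ⟨-b, fun x => ?_⟩
    have h1 := hab x
    have h2 : 0 ≤ a * ‖Q.P x‖ ^ 2 := by positivity
    linarith

theorem norm_sub_sq_mid {Y : Type*} [NormedAddCommGroup Y] [InnerProductSpace ℝ Y]
    (a b e : Y) : ‖(1 / 2 : ℝ) • (a + b) - e‖ ^ 2 ≤ 1 / 2 * ‖a‖ ^ 2 + 1 / 2 * ‖b‖ ^ 2
      - 1 / 4 * ‖a - b‖ ^ 2 + (‖a‖ + ‖b‖ + ‖e‖) * ‖e‖ := by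
  have h1 := norm_sub_sq_real ((1 / 2 : ℝ) • (a + b)) e
  have h2 := neg_le_abs (inner ℝ ((1 / 2 : ℝ) • (a + b)) e)
  have h3 := abs_real_inner_le_norm ((1 / 2 : ℝ) • (a + b)) e
  have h4 : ‖(1 / 2 : ℝ) • (a + b)‖ = 1 / 2 * ‖a + b‖ := by
    rw [norm_smul, Real.norm_of_nonneg (by norm_num)]
  have h5 := mul_le_mul_of_nonneg_right (norm_add_le a b) (norm_nonneg e)
  have h6 := norm_add_sq_real a b
  have h7 := norm_sub_sq_real a b
  rw [h4] at h1 h3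
  rw [h1, mul_pow]
  nlinarith

theorem exists_isDiscreteSolution [CompleteSpace X] {τ : ℝ} (hτ : 0 < τ) (x₀ : X) :
    ∃ U : ℕ → X, IsDiscreteSolution Q.toGradSystem.D Q.φ τ x₀ U := by
  have hB : ∀ (T : Y →L[ℝ] Y) (h : X),
      ‖T ((1 / 4 : ℝ) • Q.B h h)‖ ≤ ‖T‖ * ‖Q.B h h‖ := fun T h => by
    refine (T.le_opNorm _).trans (mul_le_mul_of_nonneg_left ?_ (norm_nonneg _))
    rw [norm_smul, Real.norm_of_nonneg (by norm_num)]
    linarith [norm_nonneg (Q.B h h)]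
  refine Q.toGradSystem.exists_isDiscreteSolution (fun h => ‖Q.B h h‖) (fun r => ?_) (fun r => ?_)
    (fun _ => norm_nonneg _) Q.compact hτ x₀
  · obtain ⟨p, hp⟩ : ∃ p, p = ‖Q.c‖ + ‖Q.L‖ * r + ‖Q.B‖ * r * r := ⟨_, rfl⟩
    refine ⟨(‖Q.R‖ * (4 * p) + ‖Q.R‖ * (‖Q.B‖ * (2 * r) * (2 * r))) * ‖Q.R‖,
      fun x y u hx hy hu => ?_⟩
    have hr : 0 ≤ r := (norm_nonneg _).trans hx
    have hP : ∀ a : X, ‖a‖ ≤ r → ‖Q.R (Q.P a) - Q.R (Q.P u)‖ ≤ ‖Q.R‖ * (2 * p) := fun a ha => by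
      rw [← map_sub]
      refine (Q.R.le_opNorm _).trans (mul_le_mul_of_nonneg_left ?_ (norm_nonneg _))
      have h1 := Q.norm_P_le ha
      have h2 := Q.norm_P_le hu
      exact (norm_sub_le _ _).trans (by rw [hp]; linarith)
    have e : Q.R (Q.P ((1 / 2 : ℝ) • (x + y))) - Q.R (Q.P u) =
        (1 / 2 : ℝ) • ((Q.R (Q.P x) - Q.R (Q.P u)) + (Q.R (Q.P y) - Q.R (Q.P u)))
          - Q.R ((1 / 4 : ℝ) • Q.B (x - y) (x - y)) := by
      rw [Q.P_mid, map_sub, map_smul, map_add]; module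
    change ‖Q.R (Q.P ((1 / 2 : ℝ) • (x + y))) - Q.R (Q.P u)‖ ^ 2 ≤ _
    rw [e]
    refine (norm_sub_sq_mid _ _ _).trans ?_
    rw [sub_sub_sub_cancel_right]
    refine add_le_add_right ?_ _
    have h1 := hP x hx
    have h2 := hP y hy
    have h3 := hB Q.R (x - y)
    have h4 : ‖Q.B (x - y) (x - y)‖ ≤ ‖Q.B‖ * (2 * r) * (2 * r) := by
      have : ‖x - y‖ ≤ 2 * r := (norm_sub_le _ _).trans (by linarith)
      exact (Q.norm_B_le _ _).trans (by gcongr)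
    have h5 := h3.trans (mul_le_mul_of_nonneg_left h4 (norm_nonneg _))
    rw [mul_assoc (_ + _)]
    refine mul_le_mul (by linarith) h3 (norm_nonneg _) ?_
    have h10 := (norm_nonneg _).trans h1
    have h11 : ‖Q.R‖ * (4 * p) = 2 * (‖Q.R‖ * (2 * p)) := by ring
    rw [h11]
    exact add_nonneg (mul_nonneg zero_le_two h10) (by positivity)
  · obtain ⟨p, hp⟩ : ∃ p, p = ‖Q.c‖ + ‖Q.L‖ * r + ‖Q.B‖ * r * r := ⟨_, rfl⟩
    refine ⟨(‖Q.W‖ * (2 * p) + ‖Q.W‖ * (‖Q.B‖ * (2 * r) * (2 * r))) * ‖Q.W‖,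
      fun x y hx hy => ?_⟩
    have hr : 0 ≤ r := (norm_nonneg _).trans hx
    have hP : ∀ a : X, ‖a‖ ≤ r → ‖Q.W (Q.P a)‖ ≤ ‖Q.W‖ * p := fun a ha =>
      (Q.W.le_opNorm _).trans (mul_le_mul_of_nonneg_left (hp ▸ Q.norm_P_le ha) (norm_nonneg _))
    have e : Q.W (Q.P ((1 / 2 : ℝ) • (x + y))) =
        (1 / 2 : ℝ) • (Q.W (Q.P x) + Q.W (Q.P y))
          - Q.W ((1 / 4 : ℝ) • Q.B (x - y) (x - y)) := by
      rw [Q.P_mid, map_sub, map_smul, map_add]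
    have h0 := norm_sub_sq_mid (Q.W (Q.P x)) (Q.W (Q.P y))
      (Q.W ((1 / 4 : ℝ) • Q.B (x - y) (x - y)))
    rw [← e] at h0
    have h1 := hP x hx
    have h2 := hP y hy
    have h3 := hB Q.W (x - y)
    have h4 : ‖Q.B (x - y) (x - y)‖ ≤ ‖Q.B‖ * (2 * r) * (2 * r) := by
      have : ‖x - y‖ ≤ 2 * r := (norm_sub_le _ _).trans (by linarith)
      exact (Q.norm_B_le _ _).trans (by gcongr)
    have h5 := h3.trans (mul_le_mul_of_nonneg_left h4 (norm_nonneg _))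
    have h6 : (‖Q.W (Q.P x)‖ + ‖Q.W (Q.P y)‖ + ‖Q.W ((1 / 4 : ℝ) • Q.B (x - y) (x - y))‖) *
        ‖Q.W ((1 / 4 : ℝ) • Q.B (x - y) (x - y))‖ ≤
        (‖Q.W‖ * (2 * p) + ‖Q.W‖ * (‖Q.B‖ * (2 * r) * (2 * r))) * (‖Q.W‖ *
          ‖Q.B (x - y) (x - y)‖) := by
      refine mul_le_mul (by linarith) h3 (norm_nonneg _) ?_
      have h10 := (norm_nonneg _).trans h1
      have h11 : ‖Q.W‖ * (2 * p) = 2 * (‖Q.W‖ * p) := by ring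
      rw [h11]
      exact add_nonneg (mul_nonneg zero_le_two h10) (by positivity)
    have h7 : Q.ℓ ((1 / 2 : ℝ) • (x + y)) = 1 / 2 * (Q.ℓ x + Q.ℓ y) := by
      rw [map_smul, map_add, smul_eq_mul]
    have h8 := sq_nonneg ‖Q.W (Q.P x) - Q.W (Q.P y)‖
    have h9 : 0 ≤ (‖Q.W‖ * (2 * p) + ‖Q.W‖ * (‖Q.B‖ * (2 * r) * (2 * r))) * (‖Q.W‖ *
          ‖Q.B (x - y) (x - y)‖) := le_trans (by positivity) h6
    change Q.φ _ ≤ 1 / 2 * Q.φ x + 1 / 2 * Q.φ y + _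
    simp only [φ, h7]
    linarith

end QuadSystem

/-! ### Test functions and primitives on an interval -/

theorem smooth_primitive {ψ : ℝ → ℝ} (hψ : ContDiff ℝ ∞ ψ) (a : ℝ) :
    ContDiff ℝ ∞ (fun x => ∫ t in a..x, ψ t) ∧ deriv (fun x => ∫ t in a..x, ψ t) = ψ := by
  have h2 : deriv (fun x => ∫ t in a..x, ψ t) = ψ :=
    funext fun x => Continuous.deriv_integral ψ hψ.continuous a x
  refine ⟨contDiff_infty_iff_deriv.2 ⟨fun x => ?_, by rwa [h2]⟩, h2⟩
  exact (intervalIntegral.integral_hasDerivAt_right (hψ.continuous.intervalIntegrable _ _)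
    (hψ.continuous.stronglyMeasurableAtFilter _ _) hψ.continuous.continuousAt).differentiableAt

theorem exists_test_integral_one {a b : ℝ} (hab : a < b) :
    ∃ η ∈ testFunctions (Ioo a b), ∫ x, η x = 1 := by
  let f : ContDiffBump ((a + b) / 2) := ⟨(b - a) / 8, (b - a) / 4, by linarith, by linarith⟩
  refine ⟨f.normed volume, ⟨f.contDiff_normed, f.hasCompactSupport_normed, ?_⟩,
    f.integral_normed⟩
  rw [f.tsupport_normed_eq, Real.closedBall_eq_Icc]
  intro x hx
  have h1 : (a + b) / 2 - (b - a) / 4 ≤ x := hx.1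
  have h2 : x ≤ (a + b) / 2 + (b - a) / 4 := hx.2
  exact ⟨by linarith, by linarith⟩

theorem exists_Icc_of_test {a b : ℝ} (hab : a < b) {φ : ℝ → ℝ}
    (hφ : φ ∈ testFunctions (Ioo a b)) :
    ∃ a' b', a < a' ∧ a' ≤ b' ∧ b' < b ∧ ∀ x, x ∉ Ioo a' b' → φ x = 0 := by
  have hK : IsCompact (tsupport φ) := hφ.2.1
  obtain ⟨c, hc⟩ : ∃ c, c = (a + b) / 2 := ⟨_, rfl⟩
  have hcmem : c ∈ Ioo a b := ⟨by linarith, by linarith⟩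
  have hK' : IsCompact (insert c (tsupport φ)) := hK.insert c
  have hne : (insert c (tsupport φ)).Nonempty := insert_nonempty _ _
  have hsub : insert c (tsupport φ) ⊆ Ioo a b := insert_subset hcmem hφ.2.2
  obtain ⟨p, hp, hpl⟩ := hK'.exists_isLeast hne
  obtain ⟨q, hq, hql⟩ := hK'.exists_isGreatest hne
  obtain ⟨a', h1, h2⟩ := exists_between (hsub hp).1
  obtain ⟨b', h3, h4⟩ := exists_between (hsub hq).2
  refine ⟨a', b', h1, (h2.le.trans (hpl hq)).trans h3.le, h4, fun x hx => ?_⟩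
  by_contra hne0
  have hxm : x ∈ insert c (tsupport φ) :=
    mem_insert_of_mem _ (subset_tsupport φ (Function.mem_support.2 hne0))
  exact hx ⟨h2.trans_le (hpl hxm), (hql hxm).trans_lt h3⟩

theorem mem_testFunctions_of_eq_zero {a b a' b' : ℝ} {φ : ℝ → ℝ} (hφ : ContDiff ℝ ∞ φ)
    (ha : a < a') (hb : b' < b) (h : ∀ x, x ∉ Ioo a' b' → φ x = 0) :
    φ ∈ testFunctions (Ioo a b) := by
  have hsub : tsupport φ ⊆ Icc a' b' := by
    refine closure_minimal (fun x hx => ?_) isClosed_Icc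
    by_contra hxn
    exact hx (h x fun hx' => hxn (Ioo_subset_Icc_self hx'))
  exact ⟨hφ, HasCompactSupport.of_support_subset_isCompact isCompact_Icc
    ((subset_tsupport φ).trans hsub),
    fun x hx => ⟨ha.trans_le (hsub hx).1, (hsub hx).2.trans_lt hb⟩⟩

theorem deriv_mem_test {Ω : Set ℝ} {φ : ℝ → ℝ} (hφ : φ ∈ testFunctions Ω) :
    deriv φ ∈ testFunctions Ω :=
  ⟨(contDiff_infty_iff_deriv.1 hφ.1).2, hφ.2.1.deriv,
    (closure_mono (support_deriv_subset)).trans (by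
      rw [isClosed_tsupport φ |>.closure_eq]; exact hφ.2.2)⟩

theorem setIntegral_mul_test {E : Type*} [NormedAddCommGroup E] [NormedSpace ℝ E]
    [MeasureSpace E] {Ω : Set E} {φ : E → ℝ} (hφ : φ ∈ testFunctions Ω) (f : E → ℝ) :
    ∫ x in Ω, f x * φ x = ∫ x, f x * φ x :=
  setIntegral_eq_integral_of_forall_compl_eq_zero fun x hx => by
    rw [image_eq_zero_of_notMem_tsupport fun h => hx (hφ.2.2 h), mul_zero]

/-- A test function with vanishing integral is the derivative of a test function. -/
theorem exists_test_primitive {a b : ℝ} (hab : a < b) {φ : ℝ → ℝ}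
    (hφ : φ ∈ testFunctions (Ioo a b)) (h0 : ∫ x, φ x = 0) :
    ∃ χ ∈ testFunctions (Ioo a b), deriv χ = φ := by
  obtain ⟨a', b', ha, hab', hb, hz⟩ := exists_Icc_of_test hab hφ
  obtain ⟨h1, h2⟩ := smooth_primitive hφ.1 a
  refine ⟨_, mem_testFunctions_of_eq_zero h1 ha hb fun x hx => ?_, h2⟩
  rcases le_or_gt x a' with hxa | hxa
  · have : ∀ t ∈ uIoc a x, φ t = 0 := fun t ht => hz t fun ht' => by
      rcases mem_uIoc.1 ht with ⟨-, h⟩ | ⟨-, h⟩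
      · exact absurd ht'.1 (not_lt.2 (h.trans hxa))
      · exact absurd ht'.1 (not_lt.2 (h.trans ha.le))
    exact intervalIntegral.integral_zero_ae (Eventually.of_forall this)
  · have hxb : b' ≤ x := not_lt.1 fun h => hx ⟨hxa, h⟩
    rw [intervalIntegral.integral_of_le (by linarith), ← h0]
    exact setIntegral_eq_integral_of_forall_compl_eq_zero fun t ht => hz t fun ht' =>
      ht ⟨ha.trans ht'.1, (ht'.2.trans_le hxb).le⟩

theorem exists_test_primitive_sub {a b : ℝ} (hab : a < b) {η ψ : ℝ → ℝ}
    (hη : η ∈ testFunctions (Ioo a b)) (hη1 : ∫ x, η x = 1) (hψ : ψ ∈ testFunctions (Ioo a b)) :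
    ∃ χ ∈ testFunctions (Ioo a b), deriv χ = fun x => ψ x - (∫ y, ψ y) * η x := by
  obtain ⟨a₁, b₁, ha₁, hab₁, hb₁, hz₁⟩ := exists_Icc_of_test hab hη
  obtain ⟨a₂, b₂, ha₂, hab₂, hb₂, hz₂⟩ := exists_Icc_of_test hab hψ
  refine exists_test_primitive hab (mem_testFunctions_of_eq_zero
    (hψ.1.sub (contDiff_const.mul hη.1)) (lt_min ha₁ ha₂) (max_lt hb₁ hb₂) fun x hx => ?_) ?_
  · have h1 : η x = 0 := hz₁ x fun h => hx ⟨(min_le_left _ _).trans_lt h.1,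
      h.2.trans_le (le_max_left _ _)⟩
    have h2 : ψ x = 0 := hz₂ x fun h => hx ⟨(min_le_right _ _).trans_lt h.1,
      h.2.trans_le (le_max_right _ _)⟩
    rw [h1, h2]; simp
  · rw [integral_sub (hψ.1.continuous.integrable_of_hasCompactSupport hψ.2.1)
      ((hη.1.continuous.integrable_of_hasCompactSupport hη.2.1).const_mul _),
      integral_const_mul, hη1, mul_one, sub_self]

/-! ### Sobolev functions of one variable -/

section Interval

variable {l : ℝ}

instance : IsFiniteMeasure (volume.restrict (I l)) :=
  ⟨by rw [Measure.restrict_apply_univ, I]; exact measure_Ioo_lt_top⟩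

theorem integral_I (hl : 0 < l) (f : ℝ → ℝ) :
    ∫ x in I l, f x = ∫ x in (-(l / 2))..(l / 2), f x := by
  rw [intervalIntegral.integral_of_le (by linarith), integral_Ioc_eq_integral_Ioo, I]

theorem integrable_L2I (g : L2I l) : Integrable g (volume.restrict (I l)) :=
  (Lp.memLp g).integrable one_le_two

theorem intervalIntegrable_L2I (hl : 0 < l) (g : L2I l) :
    IntervalIntegrable g volume (-(l / 2)) (l / 2) := by
  rw [intervalIntegrable_iff_integrableOn_Ioo_of_le (by linarith)]
  exact integrable_L2I g

theorem abs_setIntegral_le (g : L2I l) {s : Set ℝ} (hs : MeasurableSet s) :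
    |∫ x in s, g x ∂(volume.restrict (I l))| ≤
      Real.sqrt ((volume.restrict (I l)).real s) * ‖g‖ := by
  rw [← L2.inner_indicatorConstLp_one hs (measure_ne_top _ _) g]
  refine (abs_real_inner_le_norm _ _).trans_eq ?_
  rw [norm_indicatorConstLp (by norm_num) (by norm_num), norm_one, one_mul, Real.sqrt_eq_rpow]
  norm_num

/-- The primitive that vanishes at the left end point of `I`. -/
def prim (l : ℝ) (g : ℝ → ℝ) (x : ℝ) : ℝ := ∫ t in (-(l / 2))..x, g t

theorem abs_prim_sub_le (hl : 0 < l) (g : L2I l) {x y : ℝ} (hx : x ∈ Icc (-(l / 2)) (l / 2))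
    (hy : y ∈ Icc (-(l / 2)) (l / 2)) :
    |prim l g x - prim l g y| ≤ Real.sqrt |x - y| * ‖g‖ := by
  have key : ∀ x ∈ Icc (-(l / 2)) (l / 2), ∀ y ∈ Icc (-(l / 2)) (l / 2), x ≤ y →
      |prim l g y - prim l g x| ≤ Real.sqrt |y - x| * ‖g‖ := by
    intro x hx y hy hxy
    have hi : ∀ u ∈ Icc (-(l / 2)) (l / 2), IntervalIntegrable g volume (-(l / 2)) u :=
      fun u hu => (intervalIntegrable_L2I hl g).mono_set (by
        rw [uIcc_of_le hu.1, uIcc_of_le (by linarith)]; exact Icc_subset_Icc_right hu.2)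
    have hsub : Ioo x y ⊆ I l := Ioo_subset_Ioo hx.1 hy.2
    have e : prim l g y - prim l g x = ∫ t in Ioo x y, g t ∂(volume.restrict (I l)) := by
      rw [prim, prim, intervalIntegral.integral_interval_sub_left (hi y hy) (hi x hx),
        intervalIntegral.integral_of_le hxy, integral_Ioc_eq_integral_Ioo,
        Measure.restrict_restrict measurableSet_Ioo, inter_eq_left.2 hsub]
    rw [e]
    refine (abs_setIntegral_le g measurableSet_Ioo).trans_eq ?_
    rw [measureReal_restrict_apply measurableSet_Ioo, inter_eq_left.2 hsub,
      Real.volume_real_Ioo_of_le hxy, abs_of_nonneg (sub_nonneg.2 hxy)]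
  rcases le_total x y with h | h
  · rw [abs_sub_comm, abs_sub_comm x]; exact key x hx y hy h
  · exact key y hy x hx h

theorem abs_prim_le (hl : 0 < l) (g : L2I l) {x : ℝ} (hx : x ∈ Icc (-(l / 2)) (l / 2)) :
    |prim l g x| ≤ Real.sqrt l * ‖g‖ := by
  have h := abs_prim_sub_le hl g hx (left_mem_Icc.2 (by linarith))
  have h0 : prim l g (-(l / 2)) = 0 := intervalIntegral.integral_same
  rw [h0, sub_zero] at h
  refine h.trans (mul_le_mul_of_nonneg_right (Real.sqrt_le_sqrt ?_) (norm_nonneg _))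
  rw [abs_of_nonneg (by linarith [hx.1])]
  linarith [hx.2]

theorem ae_mem_I : ∀ᵐ x ∂(volume.restrict (I l)), x ∈ I l := ae_restrict_mem measurableSet_Ioo

theorem continuousOn_prim (hl : 0 < l) (g : L2I l) :
    ContinuousOn (prim l g) (Icc (-(l / 2)) (l / 2)) := by
  have := intervalIntegral.continuousOn_primitive_interval' (intervalIntegrable_L2I hl g)
    (left_mem_uIcc)
  rwa [uIcc_of_le (by linarith)] at this

theorem memLp_prim (hl : 0 < l) (g : L2I l) : MemLp (prim l g) 2 (volume.restrict (I l)) := by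
  refine MemLp.of_bound (((continuousOn_prim hl g).mono
    Ioo_subset_Icc_self).aestronglyMeasurable measurableSet_Ioo) (Real.sqrt l * ‖g‖) ?_
  filter_upwards [ae_mem_I] with x hx using abs_prim_le hl g (Ioo_subset_Icc_self hx)

theorem prim_integral_by_parts (hl : 0 < l) (g : L2I l) {φ : ℝ → ℝ} (hφ : ContDiff ℝ ∞ φ) :
    ∫ x in I l, prim l g x * deriv φ x =
      (∫ x in I l, g x) * φ (l / 2) - ∫ x in I l, g x * φ x := by
  have hle : -(l / 2) ≤ l / 2 := by linarith
  have h1 : AbsolutelyContinuousOnInterval (prim l g) (-(l / 2)) (l / 2) :=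
    (intervalIntegrable_L2I hl g).absolutelyContinuousOnInterval_intervalIntegral left_mem_uIcc
  have h2 : AbsolutelyContinuousOnInterval φ (-(l / 2)) (l / 2) :=
    ContDiffOn.absolutelyContinuousOnInterval ((hφ.of_le (by simp)).contDiffOn)
  have h3 := h1.integral_mul_deriv_eq_deriv_mul h2
  have h0 : prim l g (-(l / 2)) = 0 := intervalIntegral.integral_same
  rw [integral_I hl, h3, h0, zero_mul, sub_zero, integral_I hl, integral_I hl]
  congr 1
  refine intervalIntegral.integral_congr_ae ?_
  filter_upwards [(intervalIntegrable_L2I hl g).ae_hasDerivAt_integral] with x hx hx'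
  change deriv (fun x => ∫ t in (-(l / 2))..x, g t) x * φ x = _
  rw [(hx (uIoc_subset_uIcc hx') _ left_mem_uIcc).deriv]

theorem integrable_prim_mul (hl : 0 < l) (g : L2I l) {ψ : ℝ → ℝ}
    (hψ : MemLp ψ 2 (volume.restrict (I l))) :
    Integrable (fun x => prim l g x * ψ x) (volume.restrict (I l)) :=
  (memLp_prim hl g).integrable_mul hψ

/-- A function that is orthogonal to all test functions vanishes. -/
theorem ae_eq_zero_of_test_of_isOpen {E : Type*} [NormedAddCommGroup E] [NormedSpace ℝ E]
    [FiniteDimensional ℝ E] [MeasureSpace E] [BorelSpace E] {Ω : Set E} (hΩ : IsOpen Ω)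
    {u : E → ℝ} (hu : Integrable u (volume.restrict Ω))
    (h : ∀ φ ∈ testFunctions Ω, ∫ x in Ω, u x * φ x = 0) :
    ∀ᵐ x ∂(volume.restrict Ω), u x = 0 := by
  refine (ae_restrict_iff' hΩ.measurableSet).2 ?_
  have hu' : IntegrableOn u Ω volume := hu
  refine hΩ.ae_eq_zero_of_integral_contDiff_smul_eq_zero hu'.locallyIntegrableOn
    fun φ h1 h2 h3 => ?_
  have h4 := h φ ⟨h1, h2, h3⟩
  rw [setIntegral_mul_test ⟨h1, h2, h3⟩] at h4
  simpa only [smul_eq_mul, mul_comm] using h4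

theorem ae_eq_zero_of_test {u : ℝ → ℝ} (hu : Integrable u (volume.restrict (I l)))
    (h : ∀ φ ∈ testFunctions (I l), ∫ x in I l, u x * φ x = 0) :
    ∀ᵐ x ∂(volume.restrict (I l)), u x = 0 :=
  ae_eq_zero_of_test_of_isOpen isOpen_Ioo hu h

theorem W12zero_le : W12zero l ≤ W12sub l := fun _ hp φ hφ => hp φ hφ.1

theorem W22zero_le : W22zero l ≤ W22sub l := fun _ hp => ⟨W12zero_le hp.1, W12zero_le hp.2⟩

theorem integral_eq_zero_of_W12zero {p : L2I l × L2I l} (hp : p ∈ W12zero l) :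
    ∫ x in I l, p.2 x = 0 := by
  have h := hp (fun _ => 1) (show ContDiff ℝ ∞ _ from contDiff_const)
  simp only [deriv_const', mul_zero, integral_zero, mul_one] at h
  linarith

/-- A function with zero boundary values is the primitive of its weak derivative. -/
theorem ae_eq_prim_of_W12zero (hl : 0 < l) {p : L2I l × L2I l} (hp : p ∈ W12zero l) :
    ∀ᵐ x ∂(volume.restrict (I l)), p.1 x = prim l p.2 x := by
  have h : ∀ᵐ x ∂(volume.restrict (I l)), p.1 x - prim l p.2 x = 0 := by
    refine ae_eq_zero_of_test ((integrable_L2I p.1).sub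
      ((memLp_prim hl p.2).integrable one_le_two)) fun φ hφ => ?_
    obtain ⟨h1, h2⟩ := smooth_primitive hφ.1 0
    have h3 := hp _ h1
    have h4 := prim_integral_by_parts hl p.2 h1
    rw [h2] at h3 h4
    rw [integral_eq_zero_of_W12zero hp, zero_mul, zero_sub] at h4
    have hm := (memLp_test l φ hφ).1
    simp only [sub_mul]
    rw [integral_sub (integrable_mul_Lp p.1 hm) (integrable_prim_mul hl p.2 hm), h3, h4,
      sub_self]
  filter_upwards [h] with x hx using sub_eq_zero.1 hx

/-- The fundamental theorem of calculus in `W^{1,2}(I)`: a function is a constant plus the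
primitive of its weak derivative. -/
theorem exists_ae_eq_const_add_prim (hl : 0 < l) {p : L2I l × L2I l} (hp : p ∈ W12sub l) :
    ∃ c : ℝ, ∀ᵐ x ∂(volume.restrict (I l)), p.1 x = c + prim l p.2 x := by
  have hab : -(l / 2) < l / 2 := by linarith
  obtain ⟨η, hη, hη1⟩ := exists_test_integral_one hab
  have hint : Integrable (fun x => p.1 x - prim l p.2 x) (volume.restrict (I l)) :=
    (integrable_L2I p.1).sub ((memLp_prim hl p.2).integrable one_le_two)
  have hmul : ∀ φ ∈ testFunctions (I l),
      Integrable (fun x => (p.1 x - prim l p.2 x) * φ x) (volume.restrict (I l)) := fun φ hφ => by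
    simp only [sub_mul]
    exact (integrable_mul_Lp p.1 (memLp_test l φ hφ).1).sub
      (integrable_prim_mul hl p.2 (memLp_test l φ hφ).1)
  refine ⟨∫ x in I l, (p.1 x - prim l p.2 x) * η x, ?_⟩
  have h : ∀ᵐ x ∂(volume.restrict (I l)),
      (p.1 x - prim l p.2 x) - ∫ x in I l, (p.1 x - prim l p.2 x) * η x = 0 := by
    refine ae_eq_zero_of_test (hint.sub (integrable_const _)) fun ψ hψ => ?_
    obtain ⟨χ, hχ, hχd⟩ := exists_test_primitive_sub hab hη hη1 hψ
    have h1 := hp χ hχ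
    have h2 := prim_integral_by_parts hl p.2 hχ.1
    have hend : χ (l / 2) = 0 :=
      image_eq_zero_of_notMem_tsupport fun h => absurd (hχ.2.2 h).2 (lt_irrefl _)
    rw [hend, mul_zero, zero_sub] at h2
    have h3 : ∫ x in I l, (p.1 x - prim l p.2 x) * deriv χ x = 0 := by
      simp only [sub_mul]
      rw [integral_sub (integrable_mul_Lp p.1 (memLp_test l χ hχ).2)
        (integrable_prim_mul hl p.2 (memLp_test l χ hχ).2), h1, h2, sub_self]
    have e : ∀ x, (p.1 x - prim l p.2 x) * deriv χ x =
        (p.1 x - prim l p.2 x) * ψ x - (∫ y, ψ y) * ((p.1 x - prim l p.2 x) * η x) := fun x => by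
      rw [hχd]; ring
    simp only [e] at h3
    rw [integral_sub (hmul ψ hψ) ((hmul η hη).const_mul _), integral_const_mul] at h3
    have hψI : ∫ x in I l, ψ x = ∫ x, ψ x := by
      simpa using setIntegral_mul_test hψ (fun _ => 1)
    have hψi : Integrable ψ (volume.restrict (I l)) :=
      (memLp_test l ψ hψ).1.integrable one_le_two
    simp only [sub_mul _ (∫ x in I l, (p.1 x - prim l p.2 x) * η x)]
    rw [integral_sub (hmul ψ hψ) (hψi.const_mul _), integral_const_mul, hψI]
    linarith
  filter_upwards [h] with x hx
  linarith

/-- A weak derivative is determined by the function. -/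
theorem weak_deriv_unique {u g g' : L2I l} (h : (u, g) ∈ W12sub l) (h' : (u, g') ∈ W12sub l) :
    g = g' := by
  refine Lp.ext ?_
  have : ∀ᵐ x ∂(volume.restrict (I l)), g x - g' x = 0 := by
    refine ae_eq_zero_of_test ((integrable_L2I g).sub (integrable_L2I g')) fun φ hφ => ?_
    simp only [sub_mul]
    rw [integral_sub (integrable_mul_Lp g (memLp_test l φ hφ).1)
      (integrable_mul_Lp g' (memLp_test l φ hφ).1)]
    have h1 := h φ hφ
    have h2 := h' φ hφ
    simp only at h1 h2
    linarith
  filter_upwards [this] with x hx using sub_eq_zero.1 hx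

theorem exists_norm_le_of_ae_bound (l : ℝ) :
    ∃ C : ℝ, 0 ≤ C ∧ ∀ (f : L2I l) (K : ℝ), 0 ≤ K →
      (∀ᵐ x ∂(volume.restrict (I l)), |f x| ≤ K) → ‖f‖ ≤ C * K :=
  ⟨_, by positivity, fun _ _ hK h => Lp.norm_le_of_ae_bound hK h⟩

theorem toLp_coe_eq {f : ℝ → ℝ} (hf : MemLp f 2 (volume.restrict (I l))) :
    ∀ᵐ x ∂(volume.restrict (I l)), (hf.toLp f : L2I l) x = f x := hf.coeFn_toLp

theorem exists_ae_sqrt_bound_of_W12zero (hl : 0 < l) {p : L2I l × L2I l} (hp : p ∈ W12zero l) :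
    ∀ᵐ x ∂(volume.restrict (I l)), |p.1 x| ≤ Real.sqrt l * ‖p.2‖ := by
  filter_upwards [ae_eq_prim_of_W12zero hl hp, ae_mem_I] with x hx hxI
  rw [hx]
  exact abs_prim_le hl p.2 (Ioo_subset_Icc_self hxI)

/-- The Poincaré inequality. -/
theorem exists_poincare (hl : 0 < l) : ∃ C : ℝ, 0 ≤ C ∧ ∀ p ∈ W12zero l, ‖p.1‖ ≤ C * ‖p.2‖ := by
  obtain ⟨C, hC, h⟩ := exists_norm_le_of_ae_bound l
  refine ⟨C * Real.sqrt l, by positivity, fun p hp => ?_⟩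
  rw [mul_assoc]
  exact h _ _ (by positivity) (exists_ae_sqrt_bound_of_W12zero hl hp)

/-- The Sobolev embedding of `W^{1,2}(I)` into `L^∞(I)`. -/
theorem exists_ae_sup_bound (hl : 0 < l) : ∃ C : ℝ, 0 ≤ C ∧ ∀ p ∈ W12sub l,
    ∀ᵐ x ∂(volume.restrict (I l)), |p.1 x| ≤ C * ‖p‖ := by
  obtain ⟨K, hK, hK'⟩ := exists_norm_le_of_ae_bound l
  -- the constant of integration is controlled by the norm of a constant function
  let one : L2I l := (memLp_const (1 : ℝ)).toLp _
  have hone : ∀ᵐ x ∂(volume.restrict (I l)), one x = 1 := toLp_coe_eq _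
  have hone0 : 0 < ‖one‖ := by
    rw [norm_pos_iff]
    intro h0
    have h1 : ∫ x in I l, one x = 0 := by
      rw [h0]
      exact integral_eq_zero_of_ae (Lp.coeFn_zero ℝ 2 _)
    rw [integral_congr_ae hone] at h1
    simp only [integral_const, smul_eq_mul, mul_one, measureReal_restrict_apply_univ, I] at h1
    rw [Real.volume_real_Ioo_of_le (by linarith)] at h1
    linarith
  refine ⟨(1 + K * Real.sqrt l) / ‖one‖ + Real.sqrt l, by positivity, fun p hp => ?_⟩
  obtain ⟨c, hc⟩ := exists_ae_eq_const_add_prim hl hp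
  have h1 : ‖p.1‖ ≤ ‖p‖ := norm_fst_le p
  have h2 : ‖p.2‖ ≤ ‖p‖ := norm_snd_le p
  let q : L2I l := (memLp_prim hl p.2).toLp _
  have hq : ‖q‖ ≤ K * (Real.sqrt l * ‖p.2‖) := by
    refine hK' _ _ (by positivity) ?_
    filter_upwards [toLp_coe_eq (memLp_prim hl p.2), ae_mem_I] with x hx hxI
    rw [hx]; exact abs_prim_le hl p.2 (Ioo_subset_Icc_self hxI)
  have e : c • one = p.1 - q := by
    refine Lp.ext ?_
    filter_upwards [Lp.coeFn_smul c one, Lp.coeFn_sub p.1 q, toLp_coe_eq (memLp_prim hl p.2),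
      hone, hc] with x h1 h2 h3 h4 h5
    rw [h1, h2, Pi.smul_apply, Pi.sub_apply, h3, h4, h5]
    simp
  have hcb : |c| ≤ (1 + K * Real.sqrt l) / ‖one‖ * ‖p‖ := by
    have h3 : |c| * ‖one‖ ≤ (1 + K * Real.sqrt l) * ‖p‖ := by
      rw [← Real.norm_eq_abs, ← norm_smul, e]
      refine (norm_sub_le _ _).trans ?_
      have : K * (Real.sqrt l * ‖p.2‖) ≤ K * (Real.sqrt l * ‖p‖) := by gcongr
      linarith
    rw [div_mul_eq_mul_div, le_div_iff₀ hone0]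
    exact h3
  filter_upwards [hc, ae_mem_I] with x hx hxI
  rw [hx]
  refine (abs_add_le _ _).trans ?_
  have h4 := abs_prim_le hl p.2 (Ioo_subset_Icc_self hxI)
  have h5 : Real.sqrt l * ‖p.2‖ ≤ Real.sqrt l * ‖p‖ := by gcongr
  linarith

/-- Primitives of a bounded sequence in `L²(I)` are compact, by the theorem of Arzelà and
Ascoli. -/
theorem exists_subseq_prim_cauchy (hl : 0 < l) (g : ℕ → L2I l) (r : ℝ) (hg : ∀ n, ‖g n‖ ≤ r) :
    ∃ σ : ℕ → ℕ, StrictMono σ ∧ ∀ ε : ℝ, 0 < ε → ∃ N, ∀ n ≥ N, ∀ m ≥ N,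
      ∀ x ∈ Icc (-(l / 2)) (l / 2), |prim l (g (σ n)) x - prim l (g (σ m)) x| ≤ ε := by
  have hr : 0 ≤ r := (norm_nonneg _).trans (hg 0)
  let F : ℕ → BoundedContinuousFunction (Icc (-(l / 2)) (l / 2)) ℝ := fun n =>
    BoundedContinuousFunction.mkOfCompact ⟨_, (continuousOn_prim hl (g n)).domRestrict⟩
  have hF : ∀ n x, F n x = prim l (g n) x := fun n x => rfl
  have hcomp : IsCompact (closure (range F)) := by
    refine BoundedContinuousFunction.arzela_ascoli (Icc (-(Real.sqrt l * r)) (Real.sqrt l * r))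
      isCompact_Icc _ ?_ ?_
    · rintro _ x ⟨n, rfl⟩
      rw [hF]
      refine abs_le.1 ((abs_prim_le hl (g n) x.2).trans ?_)
      exact mul_le_mul_of_nonneg_left (hg n) (Real.sqrt_nonneg _)
    · refine Metric.equicontinuous_of_continuity_modulus (fun t => Real.sqrt |t| * r) ?_ _ ?_
      · have : Continuous fun t : ℝ => Real.sqrt |t| * r := by fun_prop
        simpa using this.tendsto 0
      · rintro x y ⟨_, n, rfl⟩
        simp only [hF]
        rw [Real.dist_eq, Subtype.dist_eq, Real.dist_eq, abs_abs]
        exact (abs_prim_sub_le hl (g n) x.2 y.2).trans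
          (mul_le_mul_of_nonneg_left (hg n) (Real.sqrt_nonneg _))
  obtain ⟨f, -, σ, hσ, hlim⟩ := hcomp.tendsto_subseq fun n => subset_closure (mem_range_self n)
  refine ⟨σ, hσ, fun ε hε => ?_⟩
  obtain ⟨N, hN⟩ := Metric.cauchySeq_iff.1 hlim.cauchySeq ε hε
  refine ⟨N, fun n hn m hm x hx => ?_⟩
  have h1 := (BoundedContinuousFunction.dist_coe_le_dist (f := F (σ n)) (g := F (σ m))
    ⟨x, hx⟩).trans (hN n hn m hm).le
  rwa [hF, hF, Real.dist_eq] at h1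

end Interval

/-! ### Effective quadratic forms -/

theorem iInf_add_mul_sq (k s : ℝ) {D : ℝ} (hD : 0 ≤ D) : ⨅ α : ℝ, (k + D * (α + s) ^ 2) = k := by
  refine le_antisymm ((ciInf_le ⟨k, ?_⟩ (-s)).trans_eq (by simp)) (le_ciInf fun α => ?_)
  · rintro _ ⟨α, rfl⟩
    exact le_add_of_nonneg_right (by positivity)
  · exact le_add_of_nonneg_right (by positivity)

theorem exists_coeffs (Q : QuadraticForm ℝ (Matrix (Fin 2) (Fin 2) ℝ)) :
    ∃ A B D p q r : ℝ, ∀ a b α : ℝ, Q !![a, b; b, α] =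
      A * a ^ 2 + B * b ^ 2 + D * α ^ 2 + p * (a * b) + q * (a * α) + r * (b * α) := by
  refine ⟨Q !![1, 0; 0, 0], Q !![0, 1; 1, 0], Q !![0, 0; 0, 1],
    QuadraticMap.polar Q !![1, 0; 0, 0] !![0, 1; 1, 0],
    QuadraticMap.polar Q !![1, 0; 0, 0] !![0, 0; 0, 1],
    QuadraticMap.polar Q !![0, 1; 1, 0] !![0, 0; 0, 1], fun a b α => ?_⟩
  have e : (!![a, b; b, α] : Matrix (Fin 2) (Fin 2) ℝ) =
      a • !![1, 0; 0, 0] + b • !![0, 1; 1, 0] + α • !![0, 0; 0, 1] := by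
    ext i j
    fin_cases i <;> fin_cases j <;> simp
  rw [e, QuadraticMap.map_add Q, QuadraticMap.map_add Q, QuadraticMap.map_smul, QuadraticMap.map_smul,
    QuadraticMap.map_smul, QuadraticMap.polar_add_left]
  simp only [QuadraticMap.polar_smul_left, QuadraticMap.polar_smul_right, smul_eq_mul]
  ring

/-- Completing the square twice diagonalizes the effective form `Q¹`. -/
theorem exists_form1_eq {Q : QuadraticForm ℝ (Matrix (Fin 2) (Fin 2) ℝ)}
    (hQ : IsAdmissibleForm Q) : ∃ C γ ρ : ℝ, 0 < C ∧ 0 < γ ∧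
      ∀ a b, form1 Q a b = C * a ^ 2 + γ * (b + ρ * a) ^ 2 := by
  obtain ⟨A, B, D, p, q, r, h⟩ := exists_coeffs Q
  have hpos : ∀ a b α : ℝ, (a ≠ 0 ∨ b ≠ 0 ∨ α ≠ 0) → 0 < Q !![a, b; b, α] := by
    intro a b α hne
    refine hQ.2 _ ?_ fun h0 => ?_
    · ext i j
      fin_cases i <;> fin_cases j <;> simp
    · have h1 := congrFun (congrFun h0 0) 0
      have h2 := congrFun (congrFun h0 0) 1
      have h3 := congrFun (congrFun h0 1) 1
      simp at h1 h2 h3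
      simp [h1, h2, h3] at hne
  have hD : 0 < D := by
    have := hpos 0 0 1 (by simp)
    rw [h] at this
    linarith
  have hγ : 0 < B - r ^ 2 / (4 * D) := by
    have := hpos 0 1 (-(r / (2 * D))) (by simp)
    rw [h] at this
    have e : A * 0 ^ 2 + B * 1 ^ 2 + D * (-(r / (2 * D))) ^ 2 + p * (0 * 1) +
        q * (0 * -(r / (2 * D))) + r * (1 * -(r / (2 * D))) = B - r ^ 2 / (4 * D) := by
      field_simp; ring
    rwa [e] at this
  obtain ⟨γ, hγe⟩ : ∃ γ, γ = B - r ^ 2 / (4 * D) := ⟨_, rfl⟩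
  obtain ⟨m, hm⟩ : ∃ m, m = p - q * r / (2 * D) := ⟨_, rfl⟩
  rw [← hγe] at hγ
  have key : ∀ a b α : ℝ, Q !![a, b; b, α] = ((A - q ^ 2 / (4 * D) - m ^ 2 / (4 * γ)) * a ^ 2 +
      γ * (b + m / (2 * γ) * a) ^ 2) + D * (α + (q * a + r * b) / (2 * D)) ^ 2 := by
    intro a b α
    rw [h]
    have e1 : γ * (b + m / (2 * γ) * a) ^ 2 = γ * b ^ 2 + m * a * b + m ^ 2 / (4 * γ) * a ^ 2 := by
      field_simp; ring
    rw [e1, hγe, hm]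
    field_simp; ring
  refine ⟨A - q ^ 2 / (4 * D) - m ^ 2 / (4 * γ), γ, m / (2 * γ), ?_, hγ, fun a b => ?_⟩
  · have := hpos 1 (-(m / (2 * γ))) (-((q * 1 + r * -(m / (2 * γ))) / (2 * D))) (by simp)
    rw [key] at this
    simpa using this
  · rw [form1]
    simp only [key]
    exact iInf_add_mul_sq _ _ hD.le

section

variable {Q : QuadraticForm ℝ (Matrix (Fin 2) (Fin 2) ℝ)} {C γ ρ : ℝ}

theorem form0_eq (hγ : 0 < γ) (h : ∀ a b, form1 Q a b = C * a ^ 2 + γ * (b + ρ * a) ^ 2) (a : ℝ) :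
    form0 Q a = C * a ^ 2 := by
  rw [form0]
  simp only [h]
  exact iInf_add_mul_sq _ _ hγ.le

theorem const0_eq (hγ : 0 < γ) (h : ∀ a b, form1 Q a b = C * a ^ 2 + γ * (b + ρ * a) ^ 2) :
    const0 Q = C := by
  rw [const0, form0_eq hγ h]; ring

theorem form1_d1_eq (h : ∀ a b, form1 Q a b = C * a ^ 2 + γ * (b + ρ * a) ^ 2) (a b : ℝ) :
    form1_d1 Q a b = 2 * (C * a + γ * ρ * (b + ρ * a)) := by
  rw [form1_d1]
  simp only [h]
  have h1 : HasDerivAt (fun s : ℝ => C * s ^ 2 + γ * (b + ρ * s) ^ 2)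
      (C * (2 * a) + γ * (2 * (b + ρ * a) * ρ)) a := by
    have h2 : HasDerivAt (fun s : ℝ => b + ρ * s) ρ a := by
      simpa using ((hasDerivAt_id a).const_mul ρ).const_add b
    have h3 := (h2.pow 2).const_mul γ
    have h4 := ((hasDerivAt_id a).pow 2).const_mul C
    refine (h4.add h3).congr_deriv ?_
    simp
  rw [h1.deriv]; ring

theorem form1_d2_eq (h : ∀ a b, form1 Q a b = C * a ^ 2 + γ * (b + ρ * a) ^ 2) (a b : ℝ) :
    form1_d2 Q a b = 2 * (γ * (b + ρ * a)) := by
  rw [form1_d2]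
  simp only [h]
  have h1 : HasDerivAt (fun s : ℝ => C * a ^ 2 + γ * (s + ρ * a) ^ 2)
      (γ * (2 * (b + ρ * a))) b := by
    have h2 : HasDerivAt (fun s : ℝ => s + ρ * a) 1 b := (hasDerivAt_id b).add_const _
    refine (((h2.pow 2).const_mul γ).const_add (C * a ^ 2)).congr_deriv ?_
    simp
  rw [h1.deriv]; ring

end

/-! ### The one-dimensional gradient system -/

section Concrete

-- nested spaces of continuous linear maps need a deeper instance search
set_option maxSynthPendingDepth 3

variable {l : ℝ}

theorem ae_abs_mul_le (hl : 0 < l) : ∃ C : ℝ, 0 ≤ C ∧ ∀ p q : W12 l,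
    ∀ᵐ x ∂(volume.restrict (I l)), |p.fn x * q.fn x| ≤ (C * ‖p‖) * |q.fn x| := by
  obtain ⟨C, hC, h⟩ := exists_ae_sup_bound hl
  refine ⟨C, hC, fun p q => ?_⟩
  filter_upwards [h p.1 p.2] with x hx
  rw [abs_mul]
  exact mul_le_mul_of_nonneg_right hx (abs_nonneg _)

theorem memLp_mul (hl : 0 < l) (p q : W12 l) :
    MemLp (fun x => p.fn x * q.fn x) 2 (volume.restrict (I l)) := by
  obtain ⟨C, -, h⟩ := ae_abs_mul_le hl
  exact (Lp.memLp q.1.1).of_le_mul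
    ((Lp.aestronglyMeasurable p.1.1).mul (Lp.aestronglyMeasurable q.1.1)) (h p q)

/-- The product of two functions in `W^{1,2}(I)`, as a continuous bilinear map into `L²(I)`. -/
def mulW (hl : 0 < l) : W12 l →L[ℝ] W12 l →L[ℝ] L2I l :=
  LinearMap.mkContinuous₂ (LinearMap.mk₂ ℝ (fun p q => (memLp_mul hl p q).toLp _)
    (fun p p' q => by
      refine Lp.ext ?_
      filter_upwards [toLp_coe_eq (memLp_mul hl (p + p') q), toLp_coe_eq (memLp_mul hl p q),
        toLp_coe_eq (memLp_mul hl p' q), Lp.coeFn_add p.1.1 p'.1.1,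
        Lp.coeFn_add ((memLp_mul hl p q).toLp _) ((memLp_mul hl p' q).toLp _)] with x h1 h2 h3 h4 h5
      rw [h1, h5, Pi.add_apply, h2, h3]
      change (p.1.1 + p'.1.1 : L2I l) x * _ = _
      rw [h4, Pi.add_apply, add_mul])
    (fun c p q => by
      refine Lp.ext ?_
      filter_upwards [toLp_coe_eq (memLp_mul hl (c • p) q), toLp_coe_eq (memLp_mul hl p q),
        Lp.coeFn_smul c p.1.1, Lp.coeFn_smul c ((memLp_mul hl p q).toLp _)] with x h1 h2 h4 h5
      rw [h1, h5, Pi.smul_apply, h2]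
      change (c • p.1.1 : L2I l) x * _ = _
      rw [h4, Pi.smul_apply, smul_eq_mul, smul_eq_mul, mul_assoc])
    (fun p q q' => by
      refine Lp.ext ?_
      filter_upwards [toLp_coe_eq (memLp_mul hl p (q + q')), toLp_coe_eq (memLp_mul hl p q),
        toLp_coe_eq (memLp_mul hl p q'), Lp.coeFn_add q.1.1 q'.1.1,
        Lp.coeFn_add ((memLp_mul hl p q).toLp _) ((memLp_mul hl p q').toLp _)] with x h1 h2 h3 h4 h5
      rw [h1, h5, Pi.add_apply, h2, h3]
      change _ * (q.1.1 + q'.1.1 : L2I l) x = _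
      rw [h4, Pi.add_apply, mul_add])
    (fun c p q => by
      refine Lp.ext ?_
      filter_upwards [toLp_coe_eq (memLp_mul hl p (c • q)), toLp_coe_eq (memLp_mul hl p q),
        Lp.coeFn_smul c q.1.1, Lp.coeFn_smul c ((memLp_mul hl p q).toLp _)] with x h1 h2 h4 h5
      rw [h1, h5, Pi.smul_apply, h2]
      change _ * (c • q.1.1 : L2I l) x = _
      rw [h4, Pi.smul_apply, smul_eq_mul, smul_eq_mul]
      ring))
    (ae_abs_mul_le hl).choose (fun p q => by
      obtain ⟨hC, h⟩ := (ae_abs_mul_le hl).choose_spec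
      refine (Lp.norm_le_mul_norm_of_ae_le_mul (g := q.1.1) (c := _ * ‖p‖) ?_).trans
        (mul_le_mul_of_nonneg_left ((norm_fst_le q.1).trans_eq rfl) (by positivity))
      filter_upwards [h p q, toLp_coe_eq (memLp_mul hl p q)] with x h1 h2
      change ‖((memLp_mul hl p q).toLp _ : L2I l) x‖ ≤ _
      rw [h2]
      exact h1)

theorem mulW_coe (hl : 0 < l) (p q : W12 l) :
    ∀ᵐ x ∂(volume.restrict (I l)), mulW hl p q x = p.fn x * q.fn x :=
  toLp_coe_eq (memLp_mul hl p q)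

theorem mulW_comm (hl : 0 < l) (p q : W12 l) : mulW hl p q = mulW hl q p := by
  refine Lp.ext ?_
  filter_upwards [mulW_coe hl p q, mulW_coe hl q p] with x h1 h2
  rw [h1, h2, mul_comm]

/-- The derivative `ξ₁'` of a state. -/
def D1 (l : ℝ) : V l →L[ℝ] L2I l :=
  (ContinuousLinearMap.snd ℝ _ _).comp ((W12sub l).subtypeL.comp (ContinuousLinearMap.fst ℝ _ _))

/-- The second derivative `ξ₂''` of a state. -/
def D2 (l : ℝ) : V l →L[ℝ] L2I l :=
  ((ContinuousLinearMap.snd ℝ _ _).comp (ContinuousLinearMap.snd ℝ _ _)).comp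
    ((W22sub l).subtypeL.comp ((ContinuousLinearMap.fst ℝ _ _).comp
      (ContinuousLinearMap.snd ℝ _ _)))

/-- The derivative `w'` of a state, as a Sobolev function with derivative `w''`. -/
def Dw (l : ℝ) : V l →L[ℝ] W12 l :=
  ((ContinuousLinearMap.snd ℝ _ _).comp ((W22sub l).subtypeL.comp
    ((ContinuousLinearMap.fst ℝ _ _).comp ((ContinuousLinearMap.snd ℝ _ _).comp
      (ContinuousLinearMap.snd ℝ _ _))))).codRestrict (W12sub l) fun k => (V.w k).2.2

/-- The second derivative `w''` of a state. -/
def D3 (l : ℝ) : V l →L[ℝ] L2I l :=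
  (ContinuousLinearMap.snd ℝ _ _).comp ((W12sub l).subtypeL.comp (Dw l))

/-- The derivative `θ'` of a state. -/
def D4 (l : ℝ) : V l →L[ℝ] L2I l :=
  (ContinuousLinearMap.snd ℝ _ _).comp ((W12sub l).subtypeL.comp
    ((ContinuousLinearMap.snd ℝ _ _).comp ((ContinuousLinearMap.snd ℝ _ _).comp
      (ContinuousLinearMap.snd ℝ _ _))))

theorem D1_apply (k : V l) : D1 l k = (V.ξ₁ k).1.2 := rfl
theorem D2_apply (k : V l) : D2 l k = (V.ξ₂ k).1.2.2 := rfl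

/-- The target space of the strains. -/
abbrev Y (l : ℝ) : Type := PiLp 2 (fun _ : Fin 4 => L2I l)

/-- The bounded operator with the given four components. -/
def toY {E : Type*} [NormedAddCommGroup E] [NormedSpace ℝ E] (a b c d : E →L[ℝ] L2I l) :
    E →L[ℝ] Y l :=
  ((PiLp.continuousLinearEquiv 2 ℝ (fun _ : Fin 4 => L2I l)).symm : _ →L[ℝ] _).comp
    (ContinuousLinearMap.pi ![a, b, c, d])

/-- The coordinates of `Y`. -/
def projY (l : ℝ) (i : Fin 4) : Y l →L[ℝ] L2I l := PiLp.proj 2 (fun _ : Fin 4 => L2I l) i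

theorem Y_ext {y y' : Y l} (h0 : y 0 = y' 0) (h1 : y 1 = y' 1) (h2 : y 2 = y' 2)
    (h3 : y 3 = y' 3) : y = y' := by
  ext1 i
  fin_cases i
  · exact h0
  · exact h1
  · exact h2
  · exact h3

theorem norm_sq_Y (y : Y l) :
    ‖y‖ ^ 2 = ‖y 0‖ ^ 2 + ‖y 1‖ ^ 2 + ‖y 2‖ ^ 2 + ‖y 3‖ ^ 2 := by
  rw [PiLp.norm_sq_eq_of_L2, Fin.sum_univ_four]

theorem inner_Y (y y' : Y l) : inner ℝ y y' =
    inner ℝ (y 0) (y' 0) + inner ℝ (y 1) (y' 1) + inner ℝ (y 2) (y' 2) + inner ℝ (y 3) (y' 3) := by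
  rw [PiLp.inner_apply, Fin.sum_univ_four]

/-- The operator that turns the norm of `Y` into the form with coefficients `C` and `γ, ρ`. -/
def opT (l α β δ ρ : ℝ) : Y l →L[ℝ] Y l :=
  toY (α • projY l 0) (β • projY l 1) (β • projY l 2) (δ • (projY l 3 + ρ • projY l 2))

theorem opT_0 (α β δ ρ : ℝ) (y : Y l) : opT l α β δ ρ y 0 = α • y 0 := rfl
theorem opT_1 (α β δ ρ : ℝ) (y : Y l) : opT l α β δ ρ y 1 = β • y 1 := rfl
theorem opT_2 (α β δ ρ : ℝ) (y : Y l) : opT l α β δ ρ y 2 = β • y 2 := rfl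
theorem opT_3 (α β δ ρ : ℝ) (y : Y l) : opT l α β δ ρ y 3 = δ • (y 3 + ρ • y 2) := rfl

theorem exists_opT_lower {α β δ : ℝ} (hα : α ≠ 0) (hβ : β ≠ 0) (hδ : δ ≠ 0) (ρ : ℝ) :
    ∃ C : ℝ, ∀ y : Y l, ‖y‖ ≤ C * ‖opT l α β δ ρ y‖ := by
  refine ⟨‖opT l α⁻¹ β⁻¹ δ⁻¹ (-(ρ * δ * β⁻¹))‖, fun y => ?_⟩
  have e : opT l α⁻¹ β⁻¹ δ⁻¹ (-(ρ * δ * β⁻¹)) (opT l α β δ ρ y) = y := by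
    refine Y_ext ?_ ?_ ?_ ?_
    · rw [opT_0, opT_0, inv_smul_smul₀ hα]
    · rw [opT_1, opT_1, inv_smul_smul₀ hβ]
    · rw [opT_2, opT_2, inv_smul_smul₀ hβ]
    · rw [opT_3, opT_3, opT_2, smul_smul, neg_mul, inv_mul_cancel_right₀ hβ, smul_add, smul_add,
        smul_add, smul_smul, smul_smul, smul_smul, smul_smul, inv_mul_cancel₀ hδ, one_smul,
        add_assoc, ← add_smul]
      have : 1 * ρ + δ⁻¹ * -(ρ * δ) = 0 := by
        field_simp
        ring
      rw [this, zero_smul, add_zero]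
  calc ‖y‖ = ‖opT l α⁻¹ β⁻¹ δ⁻¹ (-(ρ * δ * β⁻¹)) (opT l α β δ ρ y)‖ := by rw [e]
    _ ≤ _ := ContinuousLinearMap.le_opNorm _ _

/-- The linear part `(ξ₁', ξ₂'', w'', θ')` of the strains. -/
def strainL (l : ℝ) : V l →L[ℝ] Y l := toY (D1 l) (D2 l) (D3 l) (D4 l)

/-- The quadratic part `(|w'|² / 2, 0, 0, 0)` of the strains, as a symmetric bilinear map. -/
def strainB (hl : 0 < l) : V l →L[ℝ] V l →L[ℝ] Y l :=
  (ContinuousLinearMap.compL ℝ (V l) (L2I l) (Y l)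
    (toY ((1 / 2 : ℝ) • ContinuousLinearMap.id ℝ (L2I l)) 0 0 0)).comp
    ((mulW hl).bilinearComp (Dw l) (Dw l))

theorem strainB_0 (hl : 0 < l) (k k' : V l) :
    strainB hl k k' 0 = (1 / 2 : ℝ) • mulW hl (Dw l k) (Dw l k') := rfl
theorem strainB_1 (hl : 0 < l) (k k' : V l) : strainB hl k k' 1 = 0 := rfl
theorem strainB_2 (hl : 0 < l) (k k' : V l) : strainB hl k k' 2 = 0 := rfl
theorem strainB_3 (hl : 0 < l) (k k' : V l) : strainB hl k k' 3 = 0 := rfl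

theorem strainB_comm (hl : 0 < l) (k k' : V l) : strainB hl k k' = strainB hl k' k := by
  refine Y_ext ?_ rfl rfl rfl
  rw [strainB_0, strainB_0, mulW_comm]

/-- The strains `(ξ₁' + |w'|² / 2, ξ₂'', w'', θ')`. -/
def strain (hl : 0 < l) (k : V l) : Y l := strainL l k + strainB hl k k

theorem strain_0 (hl : 0 < l) (k : V l) :
    strain hl k 0 = D1 l k + (1 / 2 : ℝ) • mulW hl (Dw l k) (Dw l k) := rfl
theorem strain_1 (hl : 0 < l) (k : V l) : strain hl k 1 = D2 l k := add_zero _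
theorem strain_2 (hl : 0 < l) (k : V l) : strain hl k 2 = D3 l k := add_zero _
theorem strain_3 (hl : 0 < l) (k : V l) : strain hl k 3 = D4 l k := add_zero _

theorem strain_0_coe (hl : 0 < l) (k : V l) : ∀ᵐ x ∂(volume.restrict (I l)),
    strain hl k 0 x = (V.ξ₁ k).d x + ((V.w k).d x) ^ 2 / 2 := by
  rw [strain_0]
  filter_upwards [Lp.coeFn_add (D1 l k) ((1 / 2 : ℝ) • mulW hl (Dw l k) (Dw l k)),
    Lp.coeFn_smul (1 / 2 : ℝ) (mulW hl (Dw l k) (Dw l k)), mulW_coe hl (Dw l k) (Dw l k)]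
    with x h1 h2 h3
  rw [h1, Pi.add_apply, h2, Pi.smul_apply, h3, smul_eq_mul]
  change (V.ξ₁ k).d x + 1 / 2 * ((V.w k).d x * (V.w k).d x) = _
  ring

/-- The space of directions: `W_0^{1,2}(I) × W_0^{2,2}(I) × W_0^{2,2}(I) × W_0^{1,2}(I)`. -/
def V0 (l : ℝ) : Submodule ℝ (V l) :=
  ((W12zero l).comap (W12sub l).subtype).prod (((W22zero l).comap (W22sub l).subtype).prod
    (((W22zero l).comap (W22sub l).subtype).prod ((W12zero l).comap (W12sub l).subtype)))

theorem mem_V0 {h : V l} : h ∈ V0 l ↔ (V.ξ₁ h).1 ∈ W12zero l ∧ (V.ξ₂ h).1 ∈ W22zero l ∧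
    (V.w h).1 ∈ W22zero l ∧ (V.θ h).1 ∈ W12zero l := Iff.rfl

theorem mem_K_iff {u₁hat : W12 l} {u₂hat vhat : W22 l} {k : V l} :
    k ∈ K l u₁hat u₂hat vhat ↔ k - (u₁hat, u₂hat, vhat, 0) ∈ V0 l := by
  rw [mem_V0]
  have : V.θ (k - (u₁hat, u₂hat, vhat, 0)) = V.θ k := sub_zero _
  rw [this]
  rfl

theorem isClosed_W12zero : IsClosed (W12zero l : Set (L2I l × L2I l)) :=
  isClosed_ibpSpace _ _ (memLp_smooth l)

theorem isClosed_W22zero : IsClosed (W22zero l : Set (L2I l × L2I l × L2I l)) :=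
  (isClosed_W12zero.preimage (f := fun p : L2I l × L2I l × L2I l => (p.1, p.2.1))
    (by fun_prop)).inter
    (isClosed_W12zero.preimage (f := fun p : L2I l × L2I l × L2I l => p.2) (by fun_prop))

instance : CompleteSpace (V0 l) := by
  have h1 : IsClosed ((W12zero l).comap (W12sub l).subtype : Set (W12 l)) :=
    isClosed_W12zero.preimage continuous_subtype_val
  have h2 : IsClosed ((W22zero l).comap (W22sub l).subtype : Set (W22 l)) :=
    isClosed_W22zero.preimage continuous_subtype_val
  have h3 : IsClosed (V0 l : Set (V l)) := h1.prod (h2.prod (h2.prod h1))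
  exact h3.completeSpace_coe

theorem exists_W12zero_bound (hl : 0 < l) : ∃ C : ℝ, 0 ≤ C ∧ ∀ p ∈ W12zero l,
    ‖p‖ ≤ C * ‖p.2‖ := by
  obtain ⟨C, hC, h⟩ := exists_poincare hl
  refine ⟨max C 1, by positivity, fun p hp => max_le ((h p hp).trans ?_) ?_⟩
  · gcongr; exact le_max_left _ _
  · exact le_mul_of_one_le_left (norm_nonneg _) (le_max_right _ _)

theorem exists_W22zero_bound (hl : 0 < l) : ∃ C : ℝ, 0 ≤ C ∧ ∀ p ∈ W22zero l,
    ‖p‖ ≤ C * ‖p.2.2‖ := by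
  obtain ⟨C, hC, h⟩ := exists_W12zero_bound hl
  refine ⟨C * C + C, by positivity, fun p hp => ?_⟩
  have h1 := h _ hp.1
  have h2 := h _ hp.2
  have h3 : ‖p.1‖ ≤ C * ‖p.2.1‖ := (norm_fst_le (p.1, p.2.1)).trans h1
  have h4 : ‖p.2.1‖ ≤ C * ‖p.2.2‖ := (norm_fst_le p.2).trans h2
  have h5 : ‖p.2‖ ≤ C * ‖p.2.2‖ := h2
  have h6 : 0 ≤ C * ‖p.2.2‖ := by positivity
  have h7 : 0 ≤ C * C * ‖p.2.2‖ := by positivity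
  refine max_le (h3.trans ?_) ?_
  · have : C * ‖p.2.1‖ ≤ C * (C * ‖p.2.2‖) := by gcongr
    linarith
  · linarith

/-- The Poincaré inequality for directions. -/
theorem exists_V0_bound (hl : 0 < l) : ∃ C : ℝ, 0 ≤ C ∧ ∀ h ∈ V0 l,
    ‖V.w h‖ ≤ C * ‖D3 l h‖ ∧ ‖V.ξ₂ h‖ ≤ C * ‖D2 l h‖ ∧
    ‖h‖ ≤ C * (‖D1 l h‖ + ‖D2 l h‖ + ‖D3 l h‖ + ‖D4 l h‖) := by
  obtain ⟨C1, hC1, h1⟩ := exists_W12zero_bound hl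
  obtain ⟨C2, hC2, h2⟩ := exists_W22zero_bound hl
  refine ⟨C1 + C2, by positivity, fun h hh => ?_⟩
  obtain ⟨ha, hb, hc, hd⟩ := mem_V0.1 hh
  have ea : ‖V.ξ₁ h‖ ≤ C1 * ‖D1 l h‖ := h1 _ ha
  have eb : ‖V.ξ₂ h‖ ≤ C2 * ‖D2 l h‖ := h2 _ hb
  have ec : ‖V.w h‖ ≤ C2 * ‖D3 l h‖ := h2 _ hc
  have ed : ‖V.θ h‖ ≤ C1 * ‖D4 l h‖ := h1 _ hd
  have n1 := norm_nonneg (D1 l h)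
  have n2 := norm_nonneg (D2 l h)
  have n3 := norm_nonneg (D3 l h)
  have n4 := norm_nonneg (D4 l h)
  refine ⟨by nlinarith, by nlinarith, ?_⟩
  refine max_le ?_ (max_le ?_ (max_le ?_ ?_))
  · change ‖V.ξ₁ h‖ ≤ _; nlinarith
  · change ‖V.ξ₂ h‖ ≤ _; nlinarith
  · change ‖V.w h‖ ≤ _; nlinarith
  · change ‖V.θ h‖ ≤ _; nlinarith

theorem norm_Dw_le (k : V l) : ‖Dw l k‖ ≤ ‖V.w k‖ := norm_snd_le (V.w k).1

theorem norm_V_w_le (k : V l) : ‖V.w k‖ ≤ ‖k‖ :=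
  (norm_fst_le k.2.2).trans ((norm_snd_le k.2).trans (norm_snd_le k))

theorem norm_Y_apply_le (y : Y l) (i : Fin 4) : ‖y i‖ ≤ ‖y‖ := PiLp.norm_apply_le y i

/-- On bounded sets, the strains of two states with the same boundary values control the distance
of the states. -/
theorem exists_strain_lower (hl : 0 < l) (r : ℝ) : ∃ C : ℝ, ∀ k k' : V l, k - k' ∈ V0 l →
    ‖k‖ ≤ r → ‖k'‖ ≤ r → ‖k - k'‖ ≤ C * ‖strain hl k - strain hl k'‖ := by
  obtain ⟨C, hC, h⟩ := exists_V0_bound hl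
  obtain ⟨M, hM⟩ : ∃ M, M = ‖mulW hl‖ := ⟨_, rfl⟩
  refine ⟨C * (4 + M * C * |r|), fun k k' hkk hk hk' => ?_⟩
  obtain ⟨hw, -, hall⟩ := h _ hkk
  obtain ⟨N, hN⟩ : ∃ N, N = ‖strain hl k - strain hl k'‖ := ⟨_, rfl⟩
  have n2 : ‖D2 l (k - k')‖ ≤ N := by
    have := norm_Y_apply_le (strain hl k - strain hl k') 1
    rwa [PiLp.sub_apply, strain_1, strain_1, ← map_sub, ← hN] at this
  have n3 : ‖D3 l (k - k')‖ ≤ N := by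
    have := norm_Y_apply_le (strain hl k - strain hl k') 2
    rwa [PiLp.sub_apply, strain_2, strain_2, ← map_sub, ← hN] at this
  have n4 : ‖D4 l (k - k')‖ ≤ N := by
    have := norm_Y_apply_le (strain hl k - strain hl k') 3
    rwa [PiLp.sub_apply, strain_3, strain_3, ← map_sub, ← hN] at this
  have n0 : ‖(strain hl k - strain hl k') 0‖ ≤ N := by
    rw [hN]; exact norm_Y_apply_le _ 0
  have e : D1 l (k - k') = (strain hl k - strain hl k') 0 -
      (1 / 2 : ℝ) • mulW hl (Dw l (k - k')) (Dw l k + Dw l k') := by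
    rw [PiLp.sub_apply, strain_0, strain_0, map_sub, map_sub, map_sub, map_add, sub_apply,
      sub_apply, mulW_comm hl (Dw l k') (Dw l k)]
    module
  have hd : ‖Dw l (k - k')‖ ≤ C * N :=
    (norm_Dw_le _).trans (hw.trans (mul_le_mul_of_nonneg_left n3 hC))
  have hs : ‖Dw l k + Dw l k'‖ ≤ 2 * |r| := by
    have h1 := (norm_Dw_le k).trans ((norm_V_w_le k).trans hk)
    have h2 := (norm_Dw_le k').trans ((norm_V_w_le k').trans hk')
    have h3 := le_abs_self r
    exact (norm_add_le _ _).trans (by linarith)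
  have n1 : ‖D1 l (k - k')‖ ≤ N + M * C * |r| * N := by
    rw [e]
    refine (norm_sub_le _ _).trans (add_le_add n0 ?_)
    rw [norm_smul, Real.norm_of_nonneg (by norm_num)]
    have h1 := (mulW hl).le_opNorm₂ (Dw l (k - k')) (Dw l k + Dw l k')
    have hM0 : 0 ≤ M := hM ▸ norm_nonneg _
    rw [← hM] at h1
    have hN0 : 0 ≤ N := hN ▸ norm_nonneg _
    have h2 : M * ‖Dw l (k - k')‖ * ‖Dw l k + Dw l k'‖ ≤ M * (C * N) * (2 * |r|) := by gcongr
    nlinarith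
  rw [← hN]
  refine hall.trans ?_
  rw [mul_assoc]
  refine mul_le_mul_of_nonneg_left ?_ hC
  linarith

/-- The strains control a state with given boundary values. -/
theorem exists_strain_bounded (hl : 0 < l) (k₀ : V l) (r : ℝ) : ∃ C : ℝ, ∀ h ∈ V0 l,
    ‖strain hl (k₀ + h)‖ ≤ r → ‖h‖ ≤ C := by
  obtain ⟨C, hC, hV⟩ := exists_V0_bound hl
  obtain ⟨M, hM⟩ : ∃ M, M = ‖mulW hl‖ := ⟨_, rfl⟩
  obtain ⟨a1, ha1⟩ : ∃ a, a = ‖D1 l k₀‖ := ⟨_, rfl⟩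
  obtain ⟨a2, ha2⟩ : ∃ a, a = ‖D2 l k₀‖ := ⟨_, rfl⟩
  obtain ⟨a3, ha3⟩ : ∃ a, a = ‖D3 l k₀‖ := ⟨_, rfl⟩
  obtain ⟨a4, ha4⟩ : ∃ a, a = ‖D4 l k₀‖ := ⟨_, rfl⟩
  obtain ⟨s, hs⟩ : ∃ s, s = ‖V.w k₀‖ + C * (r + a3) := ⟨_, rfl⟩
  refine ⟨C * ((r + M * s * s + a1) + (r + a2) + (r + a3) + (r + a4)), fun h hh hr => ?_⟩
  obtain ⟨hw, -, hall⟩ := hV _ hh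
  have split : ∀ a b : L2I l, ‖b‖ ≤ ‖a + b‖ + ‖a‖ := fun a b => by
    have := norm_sub_le (a + b) a
    rwa [add_sub_cancel_left] at this
  have n2 : ‖D2 l h‖ ≤ r + a2 := by
    have h1 := (norm_Y_apply_le (strain hl (k₀ + h)) 1).trans hr
    rw [strain_1, map_add] at h1
    have := split (D2 l k₀) (D2 l h)
    linarith
  have n3 : ‖D3 l h‖ ≤ r + a3 := by
    have h1 := (norm_Y_apply_le (strain hl (k₀ + h)) 2).trans hr
    rw [strain_2, map_add] at h1
    have := split (D3 l k₀) (D3 l h)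
    linarith
  have n4 : ‖D4 l h‖ ≤ r + a4 := by
    have h1 := (norm_Y_apply_le (strain hl (k₀ + h)) 3).trans hr
    rw [strain_3, map_add] at h1
    have := split (D4 l k₀) (D4 l h)
    linarith
  have hd : ‖Dw l (k₀ + h)‖ ≤ s := by
    refine (norm_Dw_le _).trans ((norm_add_le (V.w k₀) (V.w h)).trans ?_)
    rw [hs]
    exact add_le_add_right (hw.trans (mul_le_mul_of_nonneg_left n3 hC)) _
  have n1 : ‖D1 l h‖ ≤ r + M * s * s + a1 := by
    have h1 := (norm_Y_apply_le (strain hl (k₀ + h)) 0).trans hr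
    rw [strain_0] at h1
    have h2 := norm_sub_le (D1 l (k₀ + h) + (1 / 2 : ℝ) • mulW hl (Dw l (k₀ + h)) (Dw l (k₀ + h)))
      ((1 / 2 : ℝ) • mulW hl (Dw l (k₀ + h)) (Dw l (k₀ + h)))
    rw [add_sub_cancel_right, norm_smul, Real.norm_of_nonneg (by norm_num)] at h2
    have h3 := (mulW hl).le_opNorm₂ (Dw l (k₀ + h)) (Dw l (k₀ + h))
    rw [← hM] at h3
    have hM0 : 0 ≤ M := hM ▸ norm_nonneg _
    have h4 : M * ‖Dw l (k₀ + h)‖ * ‖Dw l (k₀ + h)‖ ≤ M * s * s := by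
      have : 0 ≤ s := (norm_nonneg _).trans hd
      gcongr
    have h5 := split (D1 l k₀) (D1 l h)
    have h6 := norm_nonneg (mulW hl (Dw l (k₀ + h)) (Dw l (k₀ + h)))
    rw [(D1 l).map_add] at h1 h2
    linarith
  exact hall.trans (mul_le_mul_of_nonneg_left (by linarith) hC)

theorem integral_abs_le (u : L2I l) :
    ∫ x in I l, |u x| ≤ Real.sqrt ((volume.restrict (I l)).real univ) * ‖u‖ := by
  have h := abs_setIntegral_le |u| MeasurableSet.univ
  rw [setIntegral_univ, norm_abs_eq_norm] at h
  refine le_trans (le_of_eq ?_) ((le_abs_self _).trans h)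
  refine integral_congr_ae ?_
  filter_upwards [Lp.coeFn_abs u] with x hx
  rw [hx]

/-- The in-plane displacement grows at most linearly in the strains, although `ξ₁'` is a strain
minus the quadratic term `|w'|² / 2`: since `ξ₁` is fixed on `∂I`, the integral of this term is
controlled by that of the strain. -/
theorem exists_xi1_bound (hl : 0 < l) (k₀ : V l) : ∃ C : ℝ, 0 ≤ C ∧ ∀ h ∈ V0 l,
    ‖(V.ξ₁ h).1.1‖ ≤ C * (1 + ‖strain hl (k₀ + h)‖) := by
  obtain ⟨K, hK, hK'⟩ := exists_norm_le_of_ae_bound l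
  obtain ⟨m, hm⟩ : ∃ m, m = Real.sqrt ((volume.restrict (I l)).real univ) := ⟨_, rfl⟩
  have hm0 : 0 ≤ m := hm ▸ Real.sqrt_nonneg _
  refine ⟨K * (2 * m * (1 + ‖D1 l k₀‖)), by positivity, fun h hh => ?_⟩
  have hp := (mem_V0.1 hh).1
  obtain ⟨u, hu⟩ : ∃ u, u = strain hl (k₀ + h) 0 - D1 l k₀ := ⟨_, rfl⟩
  obtain ⟨s, hs⟩ : ∃ s : L2I l, s = (1 / 2 : ℝ) • mulW hl (Dw l (k₀ + h)) (Dw l (k₀ + h)) :=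
    ⟨_, rfl⟩
  have e : (V.ξ₁ h).1.2 = u - s := by
    rw [hu, hs, strain_0, map_add, ← D1_apply]
    abel
  have hs0 : ∀ᵐ x ∂(volume.restrict (I l)), 0 ≤ s x := by
    rw [hs]
    filter_upwards [Lp.coeFn_smul (1 / 2 : ℝ) (mulW hl (Dw l (k₀ + h)) (Dw l (k₀ + h))),
      mulW_coe hl (Dw l (k₀ + h)) (Dw l (k₀ + h))] with x h1 h2
    rw [h1, Pi.smul_apply, h2, smul_eq_mul]
    exact mul_nonneg (by norm_num) (mul_self_nonneg _)
  have hsub : ∀ᵐ x ∂(volume.restrict (I l)), (V.ξ₁ h).1.2 x = u x - s x := by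
    rw [e]; exact Lp.coeFn_sub u s
  have hint : ∫ x in I l, s x = ∫ x in I l, u x := by
    have h1 := integral_eq_zero_of_W12zero hp
    rw [integral_congr_ae hsub, integral_sub (integrable_L2I u) (integrable_L2I s)] at h1
    linarith
  have hJ : ∫ x in I l, |(V.ξ₁ h).1.2 x| ≤ 2 * (m * ‖u‖) := by
    have h1 : ∫ x in I l, |(V.ξ₁ h).1.2 x| ≤ ∫ x in I l, (|u x| + s x) := by
      refine integral_mono_ae (integrable_L2I _).abs ((integrable_L2I u).abs.add
        (integrable_L2I s)) ?_
      filter_upwards [hsub, hs0] with x h1 h2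
      change |(V.ξ₁ h).1.2 x| ≤ |u x| + s x
      rw [h1]
      refine (abs_sub _ _).trans ?_
      rw [abs_of_nonneg h2]
    rw [integral_add (integrable_L2I u).abs (integrable_L2I s), hint] at h1
    have h2 : ∫ x in I l, u x ≤ ∫ x in I l, |u x| :=
      integral_mono (integrable_L2I u) (integrable_L2I u).abs fun x => le_abs_self _
    have h3 := integral_abs_le u
    rw [← hm] at h3
    linarith
  have hu' : ‖u‖ ≤ (1 + ‖D1 l k₀‖) * (1 + ‖strain hl (k₀ + h)‖) := by
    rw [hu]
    refine (norm_sub_le _ _).trans ?_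
    have h1 := norm_Y_apply_le (strain hl (k₀ + h)) 0
    have h2 := mul_nonneg (norm_nonneg (D1 l k₀)) (norm_nonneg (strain hl (k₀ + h)))
    linarith
  have hsup : ‖(V.ξ₁ h).1.1‖ ≤ K * (2 * (m * ‖u‖)) := by
    refine hK' _ _ (by positivity) ?_
    filter_upwards [ae_eq_prim_of_W12zero hl hp, ae_mem_I] with x hx hxI
    rw [hx]
    refine le_trans ?_ hJ
    rw [prim, intervalIntegral.integral_of_le hxI.1.le, integral_Ioc_eq_integral_Ioo]
    refine abs_integral_le_integral_abs.trans ?_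
    refine setIntegral_mono_set (integrable_L2I _).abs (Eventually.of_forall fun x => abs_nonneg _)
      (Eventually.of_forall ?_)
    exact Ioo_subset_Ioo_right hxI.2.le
  refine hsup.trans ?_
  have : m * ‖u‖ ≤ m * ((1 + ‖D1 l k₀‖) * (1 + ‖strain hl (k₀ + h)‖)) := by gcongr
  calc K * (2 * (m * ‖u‖)) ≤ K * (2 * (m * ((1 + ‖D1 l k₀‖) * (1 + ‖strain hl (k₀ + h)‖)))) := by
        gcongr
    _ = _ := by ring

/-- The work `∫ f w + g₁ ξ₁ + g₂ ξ₂` of the loads. -/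
def work (f g₁ g₂ : L2I l) : V l →L[ℝ] ℝ :=
  (innerSL ℝ f).comp ((ContinuousLinearMap.fst ℝ _ _).comp ((W22sub l).subtypeL.comp
    ((ContinuousLinearMap.fst ℝ _ _).comp ((ContinuousLinearMap.snd ℝ _ _).comp
      (ContinuousLinearMap.snd ℝ _ _))))) +
  ((innerSL ℝ g₁).comp ((ContinuousLinearMap.fst ℝ _ _).comp ((W12sub l).subtypeL.comp
    (ContinuousLinearMap.fst ℝ _ _))) +
  (innerSL ℝ g₂).comp ((ContinuousLinearMap.fst ℝ _ _).comp ((W22sub l).subtypeL.comp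
    ((ContinuousLinearMap.fst ℝ _ _).comp (ContinuousLinearMap.snd ℝ _ _)))))

theorem work_apply (f g₁ g₂ : L2I l) (k : V l) : work f g₁ g₂ k =
    inner ℝ f (V.w k).1.1 + (inner ℝ g₁ (V.ξ₁ k).1.1 + inner ℝ g₂ (V.ξ₂ k).1.1) := rfl

theorem exists_work_bound (hl : 0 < l) (f g₁ g₂ : L2I l) (k₀ : V l) : ∃ C : ℝ, ∀ h ∈ V0 l,
    |work f g₁ g₂ h| ≤ C * (1 + ‖strain hl (k₀ + h)‖) := by
  obtain ⟨C, hC, hV⟩ := exists_V0_bound hl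
  obtain ⟨C', hC', hξ⟩ := exists_xi1_bound hl k₀
  refine ⟨‖f‖ * (C * (1 + ‖D3 l k₀‖)) + (‖g₁‖ * C' + ‖g₂‖ * (C * (1 + ‖D2 l k₀‖))),
    fun h hh => ?_⟩
  obtain ⟨hw, h2, -⟩ := hV h hh
  obtain ⟨N, hN⟩ : ∃ N, N = ‖strain hl (k₀ + h)‖ := ⟨_, rfl⟩
  have hN0 : 0 ≤ N := hN ▸ norm_nonneg _
  have split : ∀ a b : L2I l, ‖b‖ ≤ ‖a + b‖ + ‖a‖ := fun a b => by
    have := norm_sub_le (a + b) a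
    rwa [add_sub_cancel_left] at this
  have n2 : ‖D2 l h‖ ≤ (1 + ‖D2 l k₀‖) * (1 + N) := by
    have h1 := norm_Y_apply_le (strain hl (k₀ + h)) 1
    rw [strain_1, map_add, ← hN] at h1
    have := split (D2 l k₀) (D2 l h)
    have := mul_nonneg (norm_nonneg (D2 l k₀)) hN0
    linarith
  have n3 : ‖D3 l h‖ ≤ (1 + ‖D3 l k₀‖) * (1 + N) := by
    have h1 := norm_Y_apply_le (strain hl (k₀ + h)) 2
    rw [strain_2, map_add, ← hN] at h1
    have := split (D3 l k₀) (D3 l h)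
    have := mul_nonneg (norm_nonneg (D3 l k₀)) hN0
    linarith
  have m1 : ‖(V.w h).1.1‖ ≤ C * ((1 + ‖D3 l k₀‖) * (1 + N)) :=
    (norm_fst_le (V.w h).1).trans (hw.trans (mul_le_mul_of_nonneg_left n3 hC))
  have m2 : ‖(V.ξ₂ h).1.1‖ ≤ C * ((1 + ‖D2 l k₀‖) * (1 + N)) :=
    (norm_fst_le (V.ξ₂ h).1).trans (h2.trans (mul_le_mul_of_nonneg_left n2 hC))
  have m3 := hξ h hh
  rw [← hN] at m3 ⊢
  rw [work_apply]
  have i1 := (abs_real_inner_le_norm f (V.w h).1.1).trans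
    (mul_le_mul_of_nonneg_left m1 (norm_nonneg _))
  have i2 := (abs_real_inner_le_norm g₁ (V.ξ₁ h).1.1).trans
    (mul_le_mul_of_nonneg_left m3 (norm_nonneg _))
  have i3 := (abs_real_inner_le_norm g₂ (V.ξ₂ h).1.1).trans
    (mul_le_mul_of_nonneg_left m2 (norm_nonneg _))
  refine (abs_add_le _ _).trans ((add_le_add i1 ((abs_add_le _ _).trans
    (add_le_add i2 i3))).trans_eq ?_)
  ring

/-- The quadratic part of the strains is compact. -/
theorem exists_subseq_strainB (hl : 0 < l) (h : ℕ → V l) (hV : ∀ n, h n ∈ V0 l) (r : ℝ)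
    (hr : ∀ n, ‖h n‖ ≤ r) : ∃ σ : ℕ → ℕ, StrictMono σ ∧
      ∀ ε : ℝ, 0 < ε → ∃ N, ∀ n ≥ N, ∀ m ≥ N,
        ‖strainB hl (h (σ n) - h (σ m)) (h (σ n) - h (σ m))‖ ≤ ε := by
  obtain ⟨K, hK, hK'⟩ := exists_norm_le_of_ae_bound l
  obtain ⟨σ, hσ, hc⟩ := exists_subseq_prim_cauchy hl (fun n => D3 l (h n)) r fun n =>
    (norm_snd_le (Dw l (h n)).1).trans ((norm_Dw_le _).trans ((norm_V_w_le _).trans (hr n)))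
  refine ⟨σ, hσ, fun ε hε => ?_⟩
  obtain ⟨δ, hδ0, hδ1, hδ⟩ : ∃ δ : ℝ, 0 < δ ∧ δ ≤ 1 ∧ K * δ ≤ ε := by
    refine ⟨min 1 (ε / (K + 1)), by positivity, min_le_left _ _, ?_⟩
    have h1 : K * min 1 (ε / (K + 1)) ≤ K * (ε / (K + 1)) := by gcongr; exact min_le_right _ _
    have h2 : K * (ε / (K + 1)) ≤ ε := by
      rw [mul_div_assoc', div_le_iff₀ (by positivity)]
      nlinarith
    linarith
  obtain ⟨N, hN⟩ := hc δ hδ0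
  refine ⟨N, fun n hn m hm => ?_⟩
  obtain ⟨d, hd⟩ : ∃ d, d = h (σ n) - h (σ m) := ⟨_, rfl⟩
  rw [← hd]
  have hmul : ‖mulW hl (Dw l d) (Dw l d)‖ ≤ K * δ := by
    refine hK' _ _ hδ0.le ?_
    filter_upwards [mulW_coe hl (Dw l d) (Dw l d), ae_mem_I,
      ae_eq_prim_of_W12zero hl (mem_V0.1 (hV (σ n))).2.2.1.2,
      ae_eq_prim_of_W12zero hl (mem_V0.1 (hV (σ m))).2.2.1.2,
      Lp.coeFn_sub (Dw l (h (σ n))).1.1 (Dw l (h (σ m))).1.1] with x h1 h2 h3 h4 h5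
    have e : (Dw l d).fn x = prim l (D3 l (h (σ n))) x - prim l (D3 l (h (σ m))) x := by
      have e1 : (Dw l d).1.1 = (Dw l (h (σ n))).1.1 - (Dw l (h (σ m))).1.1 := by
        rw [hd, map_sub]; rfl
      change (Dw l d).1.1 x = _
      rw [e1, h5, Pi.sub_apply]
      exact congrArg₂ (· - ·) h3 h4
    have h6 := hN n hn m hm x (Ioo_subset_Icc_self h2)
    rw [h1, e, abs_mul]
    calc _ ≤ δ * δ := mul_le_mul h6 h6 (abs_nonneg _) hδ0.le
      _ ≤ δ := mul_le_of_le_one_left hδ0.le hδ1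
  have hsq : ‖strainB hl d d‖ ^ 2 = ‖strainB hl d d 0‖ ^ 2 := by
    rw [norm_sq_Y, strainB_1, strainB_2, strainB_3]; simp
  have heq : ‖strainB hl d d‖ = ‖strainB hl d d 0‖ :=
    (sq_eq_sq₀ (norm_nonneg _) (norm_nonneg _)).1 hsq
  rw [heq, strainB_0, norm_smul, Real.norm_of_nonneg (by norm_num)]
  have := norm_nonneg (mulW hl (Dw l d) (Dw l d))
  linarith

/-- The coefficients of an effective form `C a² + γ (b + ρ a)²`. -/
structure FormCoeffs where
  C : ℝ
  γ : ℝ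
  ρ : ℝ
  C_pos : 0 < C
  γ_pos : 0 < γ

/-- The operator `T` with `‖T y‖² = C ‖y₀‖² + (C ‖y₁‖² + C ‖y₂‖² + γ ‖y₃ + ρ y₂‖²) / 12`. -/
def FormCoeffs.op (T : FormCoeffs) (l : ℝ) : Y l →L[ℝ] Y l :=
  opT l (Real.sqrt T.C) (Real.sqrt (T.C / 12)) (Real.sqrt (T.γ / 12)) T.ρ

theorem FormCoeffs.exists_lower (T : FormCoeffs) (l : ℝ) :
    ∃ C : ℝ, ∀ y : Y l, ‖y‖ ≤ C * ‖T.op l y‖ := by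
  have h1 := T.C_pos
  have h2 := T.γ_pos
  exact exists_opT_lower (Real.sqrt_pos.2 h1).ne' (Real.sqrt_pos.2 (by positivity)).ne'
    (Real.sqrt_pos.2 (by positivity)).ne' _

theorem FormCoeffs.inner_op (T : FormCoeffs) (y y' : Y l) :
    inner ℝ (T.op l y) (T.op l y') = T.C * inner ℝ (y 0) (y' 0) + 1 / 12 * (T.C *
      inner ℝ (y 1) (y' 1) + T.C * inner ℝ (y 2) (y' 2) +
      T.γ * inner ℝ (y 3 + T.ρ • y 2) (y' 3 + T.ρ • y' 2)) := by
  have h1 := T.C_pos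
  have h2 := T.γ_pos
  have s1 := Real.mul_self_sqrt h1.le
  have s2 : Real.sqrt (T.C / 12) * Real.sqrt (T.C / 12) = T.C / 12 :=
    Real.mul_self_sqrt (by positivity)
  have s3 : Real.sqrt (T.γ / 12) * Real.sqrt (T.γ / 12) = T.γ / 12 :=
    Real.mul_self_sqrt (by positivity)
  have hin : ∀ (c : ℝ) (a b : L2I l), inner ℝ (c • a) (c • b) = c * c * inner ℝ a b :=
    fun c a b => by rw [real_inner_smul_left, real_inner_smul_right, mul_assoc]
  rw [inner_Y]
  simp only [FormCoeffs.op, opT_0, opT_1, opT_2, opT_3, hin, s1, s2, s3]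
  ring

theorem strain_add (hl : 0 < l) (k h : V l) : strain hl (k + h) =
    strain hl k + (strainL l + (2 : ℝ) • strainB hl k) h + strainB hl h h := by
  simp only [strain, map_add, add_apply, smul_apply, strainB_comm hl h k]
  module

/-- The part of the strain of `k₀ + h` that is linear in the direction `h`. -/
def dirL (hl : 0 < l) (k₀ : V l) : V0 l →L[ℝ] Y l :=
  (strainL l + (2 : ℝ) • strainB hl k₀).comp (V0 l).subtypeL

/-- The part of the strain of `k₀ + h` that is quadratic in `h`, as a bilinear map. -/
def dirB (hl : 0 < l) : V0 l →L[ℝ] V0 l →L[ℝ] Y l :=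
  (strainB hl).bilinearComp (V0 l).subtypeL (V0 l).subtypeL

/-- The work of the loads along a direction. -/
def dirWork (f g₁ g₂ : L2I l) : V0 l →L[ℝ] ℝ := (work f g₁ g₂).comp (V0 l).subtypeL

theorem dirL_apply (hl : 0 < l) (k₀ : V l) (h : V0 l) :
    dirL hl k₀ h = strainL l h + (2 : ℝ) • strainB hl k₀ h := rfl

theorem dirB_apply (hl : 0 < l) (h h' : V0 l) : dirB hl h h' = strainB hl h h' := rfl

theorem dirWork_apply (f g₁ g₂ : L2I l) (h : V0 l) : dirWork f g₁ g₂ h = work f g₁ g₂ h := rfl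

theorem strain_add_dir (hl : 0 < l) (k₀ : V l) (x : V0 l) :
    strain hl k₀ + dirL hl k₀ x + dirB hl x x = strain hl (k₀ + x) :=
  (strain_add hl k₀ x).symm

theorem exists_dir_lower (hl : 0 < l) (k₀ : V l) (r : ℝ) : ∃ C : ℝ, ∀ x y : V0 l, ‖x‖ ≤ r →
    ‖y‖ ≤ r → ‖x - y‖ ≤ C * ‖(strain hl k₀ + dirL hl k₀ x + dirB hl x x) -
      (strain hl k₀ + dirL hl k₀ y + dirB hl y y)‖ := by
  obtain ⟨C, hC⟩ := exists_strain_lower hl (‖k₀‖ + r)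
  refine ⟨C, fun x y hx hy => ?_⟩
  have e : (k₀ + x : V l) - (k₀ + y) = (x - y : V0 l) := add_sub_add_left_eq_sub (x : V l) y k₀
  have h := hC (k₀ + x) (k₀ + y) (e ▸ (x - y).2)
    ((norm_add_le _ _).trans (add_le_add_right hx _))
    ((norm_add_le _ _).trans (add_le_add_right hy _))
  rw [e] at h
  rw [strain_add_dir, strain_add_dir]
  exact h

theorem exists_dir_bounded (hl : 0 < l) (k₀ : V l) (r : ℝ) : ∃ C : ℝ, ∀ x : V0 l,
    ‖strain hl k₀ + dirL hl k₀ x + dirB hl x x‖ ≤ r → ‖x‖ ≤ C := by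
  obtain ⟨C, hC⟩ := exists_strain_bounded hl k₀ r
  refine ⟨C, fun x hx => hC x x.2 ?_⟩
  rwa [strain_add_dir] at hx

theorem exists_dirWork_bound (hl : 0 < l) (f g₁ g₂ : L2I l) (k₀ : V l) : ∃ C : ℝ, ∀ x : V0 l,
    |dirWork f g₁ g₂ x| ≤ C * (1 + ‖strain hl k₀ + dirL hl k₀ x + dirB hl x x‖) := by
  obtain ⟨C, hC⟩ := exists_work_bound hl f g₁ g₂ k₀
  refine ⟨C, fun x => ?_⟩
  rw [strain_add_dir, dirWork_apply]
  exact hC x x.2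

theorem exists_subseq_dirB (hl : 0 < l) (x : ℕ → V0 l) (r : ℝ) (hx : ∀ n, ‖x n‖ ≤ r) :
    ∃ σ : ℕ → ℕ, StrictMono σ ∧ ∀ ε : ℝ, 0 < ε → ∃ N, ∀ n ≥ N, ∀ m ≥ N,
      ‖dirB hl (x (σ n) - x (σ m)) (x (σ n) - x (σ m))‖ ≤ ε := by
  obtain ⟨σ, hσ, h⟩ := exists_subseq_strainB hl (fun n => (x n : V l)) (fun n => (x n).2) r hx
  exact ⟨σ, hσ, h⟩

/-- The gradient system on directions `h`, which stand for the states `k₀ + h`. -/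
def ribbonSystem (hl : 0 < l) (R W : FormCoeffs) (f g₁ g₂ : L2I l) (k₀ : V l) :
    QuadSystem (V0 l) (Y l) where
  c := strain hl k₀
  L := dirL hl k₀
  B := dirB hl
  symm _ _ := strainB_comm hl _ _
  R := R.op l
  W := W.op l
  ℓ := dirWork f g₁ g₂
  e₀ := -work f g₁ g₂ k₀
  R_lower := R.exists_lower l
  W_lower := W.exists_lower l
  lower := exists_dir_lower hl k₀
  bounded := exists_dir_bounded hl k₀
  load := exists_dirWork_bound hl f g₁ g₂ k₀
  compact := exists_subseq_dirB hl

theorem ribbonSystem_P (hl : 0 < l) (R W : FormCoeffs) (f g₁ g₂ : L2I l) (k₀ : V l) (x : V0 l) :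
    (ribbonSystem hl R W f g₁ g₂ k₀).P x = strain hl (k₀ + x) :=
  strain_add_dir hl k₀ x

theorem ribbonSystem_dP (hl : 0 < l) (R W : FormCoeffs) (f g₁ g₂ : L2I l) (k₀ : V l)
    (x h : V0 l) : (ribbonSystem hl R W f g₁ g₂ k₀).dP x h =
      strainL l h + (2 : ℝ) • strainB hl (k₀ + x) h := by
  change dirL hl k₀ h + (2 : ℝ) • dirB hl x h = _
  rw [dirL_apply, dirB_apply, map_add, add_apply]
  module

end Concrete

/-! ### Tensor products and moments on the rectangle -/

section Plane

variable {l : ℝ}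

instance : IsProbabilityMeasure (volume.restrict (I 1)) :=
  ⟨by rw [Measure.restrict_apply_univ, I, Real.volume_Ioo]; norm_num⟩

theorem restrict_S (l : ℝ) :
    (volume.restrict (S l)) = (volume.restrict (I l)).prod (volume.restrict (I 1)) := by
  rw [Measure.prod_restrict]; rfl

instance : IsFiniteMeasure (volume.restrict (S l)) := by rw [restrict_S]; infer_instance

theorem measurePreserving_fst_S (l : ℝ) :
    MeasurePreserving Prod.fst (volume.restrict (S l)) (volume.restrict (I l)) := by
  rw [restrict_S]; exact measurePreserving_fst

theorem ae_lift {P : ℝ → Prop} (h : ∀ᵐ x ∂(volume.restrict (I l)), P x) :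
    ∀ᵐ p ∂(volume.restrict (S l)), P p.1 :=
  (measurePreserving_fst_S l).quasiMeasurePreserving.ae h

theorem ae_mem_S : ∀ᵐ p ∂(volume.restrict (S l)), p ∈ S l :=
  ae_restrict_mem (measurableSet_Ioo.prod measurableSet_Ioo)

theorem exists_bound_second (l : ℝ) (c : C(ℝ, ℝ)) : ∃ K : ℝ, 0 ≤ K ∧
    ∀ᵐ p ∂(volume.restrict (S l)), |c p.2| ≤ K := by
  obtain ⟨K, hK⟩ := (isCompact_Icc (a := -(1 / 2 : ℝ)) (b := 1 / 2)).exists_bound_of_continuousOn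
    c.continuous.continuousOn
  refine ⟨|K|, abs_nonneg _, ?_⟩
  filter_upwards [ae_mem_S] with p hp
  exact (hK p.2 (Ioo_subset_Icc_self hp.2)).trans (le_abs_self K)

theorem ae_abs_ten_le (c : C(ℝ, ℝ)) : ∃ K : ℝ, 0 ≤ K ∧ ∀ f : L2I l,
    ∀ᵐ p ∂(volume.restrict (S l)), |f p.1 * c p.2| ≤
      K * |Lp.compMeasurePreserving Prod.fst (measurePreserving_fst_S l) f p| := by
  obtain ⟨K, hK, h⟩ := exists_bound_second l c
  refine ⟨K, hK, fun f => ?_⟩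
  filter_upwards [h, Lp.coeFn_compMeasurePreserving f (measurePreserving_fst_S l)] with p h1 h2
  rw [h2, Function.comp_apply, abs_mul, mul_comm]
  exact mul_le_mul_of_nonneg_right h1 (abs_nonneg _)

theorem memLp_ten (c : C(ℝ, ℝ)) (f : L2I l) :
    MemLp (fun p : ℝ × ℝ => f p.1 * c p.2) 2 (volume.restrict (S l)) := by
  obtain ⟨K, -, h⟩ := ae_abs_ten_le (l := l) c
  refine (Lp.memLp (Lp.compMeasurePreserving Prod.fst
    (measurePreserving_fst_S l) f)).of_le_mul ?_ (h f)
  exact ((Lp.aestronglyMeasurable f).comp_measurePreserving (measurePreserving_fst_S l)).mul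
    (c.continuous.comp continuous_snd).aestronglyMeasurable

/-- The function `f(x₁) c(x₂)` on the rectangle. -/
def ten (c : C(ℝ, ℝ)) : L2I l →L[ℝ] L2S l :=
  LinearMap.mkContinuous
    { toFun := fun f => (memLp_ten c f).toLp _
      map_add' := fun f g => by
        refine Lp.ext ?_
        filter_upwards [(memLp_ten c (f + g)).coeFn_toLp, (memLp_ten c f).coeFn_toLp,
          (memLp_ten c g).coeFn_toLp, ae_lift (Lp.coeFn_add f g),
          Lp.coeFn_add ((memLp_ten c f).toLp _) ((memLp_ten c g).toLp _)] with p h1 h2 h3 h4 h5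
        rw [h1, h5, Pi.add_apply, h2, h3, h4, Pi.add_apply, add_mul]
      map_smul' := fun a f => by
        refine Lp.ext ?_
        filter_upwards [(memLp_ten c (a • f)).coeFn_toLp, (memLp_ten c f).coeFn_toLp,
          ae_lift (Lp.coeFn_smul a f), Lp.coeFn_smul a ((memLp_ten c f).toLp _)] with p h1 h2 h3 h4
        rw [h1, RingHom.id_apply, h4, Pi.smul_apply, h2, h3, Pi.smul_apply, smul_eq_mul,
          smul_eq_mul, mul_assoc] }
    (ae_abs_ten_le (l := l) c).choose fun f => by
      obtain ⟨-, h⟩ := (ae_abs_ten_le (l := l) c).choose_spec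
      rw [← Lp.norm_compMeasurePreserving f (measurePreserving_fst_S l)]
      refine Lp.norm_le_mul_norm_of_ae_le_mul ?_
      filter_upwards [h f, (memLp_ten c f).coeFn_toLp] with p h1 h2
      change ‖((memLp_ten c f).toLp _ : L2S l) p‖ ≤ _
      rw [h2]
      exact h1

theorem ten_coe (c : C(ℝ, ℝ)) (f : L2I l) :
    ∀ᵐ p ∂(volume.restrict (S l)), ten c f p = f p.1 * c p.2 := (memLp_ten c f).coeFn_toLp

/-- The pairing of two functions of the second variable. -/
def pair (c d : C(ℝ, ℝ)) : ℝ := ∫ x in I 1, c x * d x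

theorem inner_ten (c d : C(ℝ, ℝ)) (f g : L2I l) :
    inner ℝ (ten c f) (ten d g) = pair c d * inner ℝ f g := by
  rw [L2.inner_def, L2.inner_def, pair, mul_comm, ← integral_prod_mul, ← restrict_S]
  refine integral_congr_ae ?_
  filter_upwards [ten_coe c f, ten_coe d g] with p h1 h2
  simp only [RCLike.inner_apply, conj_trivial]
  rw [h1, h2]
  ring

/-- The moment `∫ h(x₁, x₂) ψ(x₂) dx₂`, as the adjoint of the tensor product with `ψ`. -/
def mom (ψ : C(ℝ, ℝ)) : L2S l →L[ℝ] L2I l := ContinuousLinearMap.adjoint (ten ψ)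

theorem inner_mom (ψ : C(ℝ, ℝ)) (h : L2S l) (f : L2I l) :
    inner ℝ (mom ψ h) f = inner ℝ h (ten ψ f) := ContinuousLinearMap.adjoint_inner_left _ _ _

theorem mom_ten (ψ c : C(ℝ, ℝ)) (f : L2I l) : mom ψ (ten c f) = pair c ψ • f := by
  refine ext_inner_right ℝ fun g => ?_
  rw [inner_mom, inner_ten, real_inner_smul_left]

theorem integral_mul_eq_inner {α : Type*} [MeasurableSpace α] {μ : Measure α} (u : Lp ℝ 2 μ)
    {φ : α → ℝ} (hφ : MemLp φ 2 μ) : ∫ x, u x * φ x ∂μ = inner ℝ u (hφ.toLp φ) := by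
  rw [L2.inner_def]
  refine integral_congr_ae ?_
  filter_upwards [hφ.coeFn_toLp] with x hx
  simp [hx, mul_comm]

theorem integral_mom (ψ : C(ℝ, ℝ)) (h : L2S l) {φ : ℝ → ℝ}
    (hφ : MemLp φ 2 (volume.restrict (I l))) :
    ∫ x in I l, mom ψ h x * φ x = ∫ p in S l, h p * (φ p.1 * ψ p.2) := by
  rw [integral_mul_eq_inner _ hφ, inner_mom, L2.inner_def]
  refine integral_congr_ae ?_
  filter_upwards [ten_coe ψ (hφ.toLp φ), ae_lift (toLp_coe_eq hφ)] with p h1 h2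
  simp only [RCLike.inner_apply, conj_trivial]
  rw [h1, h2, mul_comm]

/-- A function whose integrals over all rectangles vanish is zero. -/
theorem ae_eq_zero_of_setIntegral_prod {α β : Type*} [MeasurableSpace α] [MeasurableSpace β]
    {μ : Measure (α × β)} [IsFiniteMeasure μ] {h : α × β → ℝ} (hh : Integrable h μ)
    (h0 : ∀ A : Set α, ∀ B : Set β, MeasurableSet A → MeasurableSet B →
      ∫ p in A ×ˢ B, h p ∂μ = 0) : ∀ᵐ p ∂μ, h p = 0 := by
  have huniv : ∫ p, h p ∂μ = 0 := by
    have := h0 univ univ MeasurableSet.univ MeasurableSet.univ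
    rwa [univ_prod_univ, setIntegral_univ] at this
  refine hh.ae_eq_zero_of_forall_setIntegral_eq_zero fun s hs _ => ?_
  refine MeasurableSpace.induction_on_inter (C := fun s _ => ∫ p in s, h p ∂μ = 0)
    generateFrom_prod.symm isPiSystem_prod (by simp) ?_ ?_ ?_ s hs
  · rintro - ⟨A, hA, B, hB, rfl⟩
    exact h0 A B hA hB
  · intro t ht hzero
    have := integral_add_compl ht hh
    rw [hzero, huniv, zero_add] at this
    exact this
  · intro f hd hm hf
    rw [integral_iUnion hm hd hh.integrableOn]
    simp [hf]

/-- The continuous function underlying a test function. -/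
def tst {Ω : Set ℝ} {ψ : ℝ → ℝ} (hψ : ψ ∈ testFunctions Ω) : C(ℝ, ℝ) := ⟨ψ, hψ.1.continuous⟩

theorem tst_apply {Ω : Set ℝ} {ψ : ℝ → ℝ} (hψ : ψ ∈ testFunctions Ω) (x : ℝ) :
    tst hψ x = ψ x := rfl

/-- A function on the rectangle is determined by its moments. -/
theorem eq_zero_of_mom {h : L2S l}
    (h0 : ∀ ψ (hψ : ψ ∈ testFunctions (I 1)), mom (tst hψ) h = 0) : h = 0 := by
  have hint : Integrable h (volume.restrict (S l)) := (Lp.memLp h).integrable one_le_two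
  have hint' : Integrable h ((volume.restrict (I l)).prod (volume.restrict (I 1))) := by
    rwa [← restrict_S]
  refine Lp.ext ?_
  have : ∀ᵐ p ∂(volume.restrict (S l)), h p = 0 := by
    refine ae_eq_zero_of_setIntegral_prod hint fun A B hA hB => ?_
    have hintA : Integrable h (((volume.restrict (I l)).restrict A).prod
        (volume.restrict (I 1))) := by
      have := hint'.integrableOn (s := A ×ˢ univ)
      rwa [IntegrableOn, ← Measure.prod_restrict, Measure.restrict_univ] at this
    have hslice : ∀ᵐ y ∂(volume.restrict (I 1)),
        ∫ x, h (x, y) ∂((volume.restrict (I l)).restrict A) = 0 := by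
      refine ae_eq_zero_of_test hintA.integral_prod_right fun ψ hψ => ?_
      obtain ⟨K, -, hK⟩ := exists_bound_second l (tst hψ)
      have hmul : Integrable (fun p : ℝ × ℝ => h p * ψ p.2)
          (((volume.restrict (I l)).restrict A).prod (volume.restrict (I 1))) := by
        refine hintA.mul_bdd (c := ‖K‖)
          (hψ.1.continuous.comp continuous_snd).aestronglyMeasurable ?_
        have hK' : ∀ᵐ p ∂((volume.restrict (I l)).prod (volume.restrict (I 1))),
            |tst hψ p.2| ≤ K := by rwa [← restrict_S]
        have hac : (((volume.restrict (I l)).restrict A).prod (volume.restrict (I 1))) ≪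
            ((volume.restrict (I l)).prod (volume.restrict (I 1))) :=
          Measure.absolutelyContinuous_of_le Measure.restrict_le_self |>.prod
            Measure.AbsolutelyContinuous.rfl
        filter_upwards [hac hK'] with p hp
        exact hp.trans (le_abs_self K)
      simp_rw [← integral_mul_const]
      rw [← integral_prod_symm _ hmul]
      have hA1 : MemLp (A.indicator fun _ => (1 : ℝ)) 2 (volume.restrict (I l)) :=
        memLp_indicator_const 2 hA 1 (Or.inr (measure_ne_top _ _))
      have h1 := integral_mom (tst hψ) h hA1
      rw [h0 ψ hψ] at h1
      have h2 : ∫ x in I l, (0 : L2I l) x * A.indicator (fun _ => (1 : ℝ)) x = 0 := by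
        refine integral_eq_zero_of_ae ?_
        filter_upwards [Lp.coeFn_zero ℝ 2 (volume.restrict (I l))] with x hx
        rw [hx]; simp
      rw [h2] at h1
      have h3 : ((volume.restrict (I l)).restrict A).prod (volume.restrict (I 1)) =
          (volume.restrict (S l)).restrict (A ×ˢ univ) := by
        rw [restrict_S, ← Measure.prod_restrict, Measure.restrict_univ]
      rw [h3, ← integral_indicator (hA.prod MeasurableSet.univ), h1]
      refine integral_congr_ae (Eventually.of_forall fun p => ?_)
      by_cases hp : p.1 ∈ A
      · simp [indicator, hp, tst_apply]
      · simp [indicator, hp]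
    have h3 : (volume.restrict (S l)).restrict (A ×ˢ B) =
        ((volume.restrict (I l)).restrict A).prod ((volume.restrict (I 1)).restrict B) := by
      rw [restrict_S]
      exact (Measure.prod_restrict A B).symm
    rw [h3, integral_prod_symm]
    · exact integral_eq_zero_of_ae (ae_restrict_of_ae hslice)
    · rw [← h3]
      exact hint.integrableOn
  filter_upwards [this, Lp.coeFn_zero ℝ 2 (volume.restrict (S l))] with p h1 h2
  rw [h1, h2]; rfl

end Plane

/-! ### Sobolev functions on the rectangle -/

section PlaneSobolev

variable {l : ℝ}

theorem hasDerivAt_slice1 {φ : ℝ × ℝ → ℝ} (hφ : ContDiff ℝ ∞ φ) (p : ℝ × ℝ) :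
    HasDerivAt (fun x => φ (x, p.2)) (pd1 φ p) p.1 :=
  ((hφ.differentiable (by simp)) p).hasFDerivAt.comp_hasDerivAt p.1
    ((hasDerivAt_id p.1).prodMk (hasDerivAt_const p.1 p.2))

theorem hasDerivAt_slice2 {φ : ℝ × ℝ → ℝ} (hφ : ContDiff ℝ ∞ φ) (p : ℝ × ℝ) :
    HasDerivAt (fun y => φ (p.1, y)) (pd2 φ p) p.2 :=
  ((hφ.differentiable (by simp)) p).hasFDerivAt.comp_hasDerivAt p.2
    ((hasDerivAt_const p.2 p.1).prodMk (hasDerivAt_id p.2))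

theorem slice_mem_test {E F : Type*} [NormedAddCommGroup E] [NormedSpace ℝ E]
    [NormedAddCommGroup F] [NormedSpace ℝ F] {Ω : Set F} {Ω' : Set E} {φ : F → ℝ}
    (hφ : φ ∈ testFunctions Ω) {i : E → F} {r : F → E} (hi : ContDiff ℝ ∞ i) (hr : Continuous r)
    (hri : ∀ x, r (i x) = x) (hΩ : ∀ x, i x ∈ Ω → x ∈ Ω') :
    (fun x => φ (i x)) ∈ testFunctions Ω' := by
  have hsub : tsupport (fun x => φ (i x)) ⊆ i ⁻¹' tsupport φ :=
    closure_minimal (fun x hx => subset_tsupport φ hx)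
      ((isClosed_tsupport φ).preimage hi.continuous)
  refine ⟨hφ.1.comp hi, HasCompactSupport.of_support_subset_isCompact
    (hφ.2.1.isCompact.image hr) fun x hx => ?_, fun x hx => hΩ x (hφ.2.2 (hsub hx))⟩
  exact ⟨i x, hsub (subset_tsupport _ hx), hri x⟩

theorem tensor_mem_test {A B : Set ℝ} {φ ψ : ℝ → ℝ} (hφ : φ ∈ testFunctions A)
    (hψ : ψ ∈ testFunctions B) : (fun p : ℝ × ℝ => φ p.1 * ψ p.2) ∈ testFunctions (A ×ˢ B) := by
  have hsub : Function.support (fun p : ℝ × ℝ => φ p.1 * ψ p.2) ⊆ tsupport φ ×ˢ tsupport ψ := by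
    intro p hp
    have hp' : φ p.1 * ψ p.2 ≠ 0 := hp
    exact ⟨subset_tsupport φ (left_ne_zero_of_mul hp'), subset_tsupport ψ (right_ne_zero_of_mul hp')⟩
  have hcl : IsClosed (tsupport φ ×ˢ tsupport ψ) :=
    (isClosed_tsupport φ).prod (isClosed_tsupport ψ)
  exact ⟨(hφ.1.comp contDiff_fst).mul (hψ.1.comp contDiff_snd),
    HasCompactSupport.of_support_subset_isCompact (hφ.2.1.isCompact.prod hψ.2.1.isCompact) hsub,
    (closure_minimal hsub hcl).trans (Set.prod_mono hφ.2.2 hψ.2.2)⟩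

theorem pd1_tensor {φ ψ : ℝ → ℝ} (hφ : ContDiff ℝ ∞ φ) (hψ : ContDiff ℝ ∞ ψ) (p : ℝ × ℝ) :
    pd1 (fun p : ℝ × ℝ => φ p.1 * ψ p.2) p = deriv φ p.1 * ψ p.2 :=
  (hasDerivAt_slice1 (φ := fun p : ℝ × ℝ => φ p.1 * ψ p.2)
    ((hφ.comp contDiff_fst).mul (hψ.comp contDiff_snd)) p).unique
    (((hφ.differentiable (by simp)) p.1).hasDerivAt.mul_const (ψ p.2))

theorem pd2_tensor {φ ψ : ℝ → ℝ} (hφ : ContDiff ℝ ∞ φ) (hψ : ContDiff ℝ ∞ ψ) (p : ℝ × ℝ) :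
    pd2 (fun p : ℝ × ℝ => φ p.1 * ψ p.2) p = φ p.1 * deriv ψ p.2 :=
  (hasDerivAt_slice2 (φ := fun p : ℝ × ℝ => φ p.1 * ψ p.2)
    ((hφ.comp contDiff_fst).mul (hψ.comp contDiff_snd)) p).unique
    (((hψ.differentiable (by simp)) p.2).hasDerivAt.const_mul (φ p.1))

theorem mem_W12Ssub {p : L2S l × L2S l × L2S l} : p ∈ W12Ssub l ↔
    IBP (volume.restrict (S l)) (testFunctions (S l)) pd1 p.1 p.2.1 ∧
    IBP (volume.restrict (S l)) (testFunctions (S l)) pd2 p.1 p.2.2 := Iff.rfl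

theorem isOpen_S : IsOpen (S l) := isOpen_Ioo.prod isOpen_Ioo

theorem IBP_unique {D : (ℝ × ℝ → ℝ) → (ℝ × ℝ → ℝ)} {u g g' : L2S l}
    (h : IBP (volume.restrict (S l)) (testFunctions (S l)) D u g)
    (h' : IBP (volume.restrict (S l)) (testFunctions (S l)) D u g') : g = g' := by
  refine Lp.ext ?_
  have hi : ∀ g : L2S l, Integrable g (volume.restrict (S l)) :=
    fun g => (Lp.memLp g).integrable one_le_two
  have : ∀ᵐ x ∂(volume.restrict (S l)), g x - g' x = 0 := by
    refine ae_eq_zero_of_test_of_isOpen isOpen_S ((hi g).sub (hi g')) fun φ hφ => ?_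
    simp only [sub_mul]
    rw [integral_sub (integrable_mul_Lp g (memLp_test1 l φ hφ).1)
      (integrable_mul_Lp g' (memLp_test1 l φ hφ).1)]
    have h1 := h φ hφ
    have h2 := h' φ hφ
    linarith
  filter_upwards [this] with x hx using sub_eq_zero.1 hx

/-- Weak partial derivatives are determined by the function. -/
theorem W12S_ext {y y' : W12S l} (h : y.1.1 = y'.1.1) : y = y' := by
  obtain ⟨⟨u, g₁, g₂⟩, hy⟩ := y
  obtain ⟨⟨u', g₁', g₂'⟩, hy'⟩ := y'
  simp only at h
  subst h
  have h1 : g₁ = g₁' := IBP_unique (mem_W12Ssub.1 hy).1 (mem_W12Ssub.1 hy').1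
  have h2 : g₂ = g₂' := IBP_unique (mem_W12Ssub.1 hy).2 (mem_W12Ssub.1 hy').2
  subst h1; subst h2; rfl

theorem W12_ext {u v : W12 l} (h : u.1.1 = v.1.1) : u = v := by
  obtain ⟨⟨u, g⟩, hu⟩ := u
  obtain ⟨⟨v, g'⟩, hv⟩ := v
  simp only at h
  subst h
  have h1 : g = g' := weak_deriv_unique hu hv
  subst h1; rfl

theorem W22_ext {u v : W22 l} (h : u.1.1 = v.1.1) : u = v := by
  obtain ⟨⟨u, g, k⟩, hu⟩ := u
  obtain ⟨⟨v, g', k'⟩, hv⟩ := v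
  simp only at h
  subst h
  have h1 : g = g' := weak_deriv_unique hu.1 hv.1
  subst h1
  have h2 : k = k' := weak_deriv_unique hu.2 hv.2
  subst h2; rfl

/-- Moments of a Sobolev function on the rectangle are Sobolev functions on the interval. -/
theorem mom_mem_W12sub {ψ : ℝ → ℝ} (hψ : ψ ∈ testFunctions (I 1)) {u g : L2S l}
    (h : IBP (volume.restrict (S l)) (testFunctions (S l)) pd1 u g) :
    (mom (tst hψ) u, mom (tst hψ) g) ∈ W12sub l := by
  intro φ hφ
  simp only
  rw [integral_mom _ _ (memLp_test l φ hφ).1, integral_mom _ _ (memLp_test l φ hφ).2]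
  have := h _ (tensor_mem_test hφ hψ)
  simp only [pd1_tensor hφ.1 hψ.1] at this
  exact this

theorem mom_deriv {ψ : ℝ → ℝ} (hψ : ψ ∈ testFunctions (I 1)) {u g : L2S l}
    (h : IBP (volume.restrict (S l)) (testFunctions (S l)) pd2 u g) :
    mom (tst (deriv_mem_test hψ)) u = -mom (tst hψ) g := by
  have : ∀ᵐ x ∂(volume.restrict (I l)),
      (mom (tst (deriv_mem_test hψ)) u + mom (tst hψ) g : L2I l) x = 0 := by
    refine ae_eq_zero_of_test (integrable_L2I _) fun φ hφ => ?_
    rw [integral_add_Lp _ _ (memLp_test l φ hφ).1, integral_mom _ _ (memLp_test l φ hφ).1,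
      integral_mom _ _ (memLp_test l φ hφ).1]
    have := h _ (tensor_mem_test hφ hψ)
    simp only [pd2_tensor hφ.1 hψ.1] at this
    simp only [tst_apply]
    linarith
  rw [← add_eq_zero_iff_eq_neg]
  refine Lp.ext ?_
  filter_upwards [this, Lp.coeFn_zero ℝ 2 (volume.restrict (I l))] with x h1 h2
  rw [h1, h2]; rfl

theorem memLp_gamma (l : ℝ) : ∀ φ ∈ testFunctions (univ ×ˢ Ioo (-(1 / 2)) (1 / 2) : Set (ℝ × ℝ)),
    MemLp φ 2 (volume.restrict (S l)) ∧ MemLp (pd1 φ) 2 (volume.restrict (S l)) := by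
  intro φ hφ
  have h := hφ.1.continuous_fderiv (by simp)
  exact ⟨memLp_S l hφ.1.continuous, memLp_S l (h.clm_apply continuous_const)⟩

/-- The pairs `(u, ∂₁u)` such that `u` vanishes on `Γ`. -/
def gammaSpace (l : ℝ) : Submodule ℝ (L2S l × L2S l) :=
  ibpSpace (volume.restrict (S l)) (testFunctions (univ ×ˢ Ioo (-(1 / 2)) (1 / 2))) pd1
    (memLp_gamma l)

theorem vanishesOnGamma_iff {u g : ℝ × ℝ → ℝ} {U G : L2S l}
    (hu : ∀ᵐ p ∂(volume.restrict (S l)), u p = U p)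
    (hg : ∀ᵐ p ∂(volume.restrict (S l)), g p = G p) :
    VanishesOnGamma l u g ↔ (U, G) ∈ gammaSpace l := by
  have e1 : ∀ ψ : ℝ × ℝ → ℝ, ∫ p in S l, u p * ψ p = ∫ p in S l, U p * ψ p := fun ψ =>
    integral_congr_ae (by filter_upwards [hu] with p hp; rw [hp])
  have e2 : ∀ ψ : ℝ × ℝ → ℝ, ∫ p in S l, g p * ψ p = ∫ p in S l, G p * ψ p := fun ψ =>
    integral_congr_ae (by filter_upwards [hg] with p hp; rw [hp])
  change (∀ φ ∈ _, _) ↔ (∀ φ ∈ _, _)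
  simp only [e1, e2]

/-- Moments of a function that vanishes on `Γ` vanish on `∂I`. -/
theorem mom_mem_W12zero (hl : 0 < l) {ψ : ℝ → ℝ} (hψ : ψ ∈ testFunctions (I 1)) {u g : L2S l}
    (h : (u, g) ∈ gammaSpace l) : (mom (tst hψ) u, mom (tst hψ) g) ∈ W12zero l := by
  intro φ hφ
  -- cut off `φ` outside a neighbourhood of `I`
  let b : ContDiffBump (0 : ℝ) := ⟨l, 2 * l, hl, by linarith⟩
  have hφ' : ContDiff ℝ ∞ φ := hφ
  have hbφ : (fun x => b x * φ x) ∈ testFunctions univ :=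
    ⟨b.contDiff.mul hφ', b.hasCompactSupport.mul_right, subset_univ _⟩
  have hone : ∀ x ∈ I l, (fun x => b x * φ x) =ᶠ[𝓝 x] φ := fun x hx => by
    have hball : Metric.ball (0 : ℝ) l ∈ 𝓝 x := by
      refine Metric.isOpen_ball.mem_nhds ?_
      rw [mem_ball_zero_iff, Real.norm_eq_abs, abs_lt]
      exact ⟨by linarith [hx.1], by linarith [hx.2]⟩
    filter_upwards [hball] with y hy
    rw [b.one_of_mem_closedBall (Metric.ball_subset_closedBall hy), one_mul]
  have h1 := h _ (tensor_mem_test hbφ hψ)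
  simp only [pd1_tensor hbφ.1 hψ.1] at h1
  simp only
  rw [integral_mom _ _ (memLp_smooth l φ hφ).1, integral_mom _ _ (memLp_smooth l φ hφ).2]
  have e1 : ∫ p in S l, u p * (deriv (fun x => b x * φ x) p.1 * ψ p.2) =
      ∫ p in S l, u p * (deriv φ p.1 * tst hψ p.2) := by
    refine integral_congr_ae ?_
    filter_upwards [ae_mem_S] with p hp
    rw [(hone p.1 hp.1).deriv_eq, tst_apply]
  have e2 : ∫ p in S l, g p * ((b p.1 * φ p.1) * ψ p.2) =
      ∫ p in S l, g p * (φ p.1 * tst hψ p.2) := by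
    refine integral_congr_ae ?_
    filter_upwards [ae_mem_S] with p hp
    have : b p.1 * φ p.1 = φ p.1 := (hone p.1 hp.1).eq_of_nhds
    rw [this, tst_apply]
  rw [← e1, ← e2]
  exact h1

/-- Integration by parts in the first variable, slice by slice. -/
theorem ten_IBP {T : Set (ℝ → ℝ)} {T' : Set (ℝ × ℝ → ℝ)}
    (hT' : ∀ φ ∈ T', ContDiff ℝ ∞ φ)
    (hT : ∀ φ ∈ T', ∀ y ∈ I 1, (fun x => φ (x, y)) ∈ T) {u g : L2I l}
    (h : IBP (volume.restrict (I l)) T deriv u g) (c : C(ℝ, ℝ)) :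
    IBP (volume.restrict (S l)) T' pd1 (ten c u) (ten c g) := by
  intro φ hφ
  have hs := hT' φ hφ
  have hm1 : MemLp φ 2 (volume.restrict (S l)) := memLp_S l hs.continuous
  have hm2 : MemLp (pd1 φ) 2 (volume.restrict (S l)) :=
    memLp_S l ((hs.continuous_fderiv (by simp)).clm_apply continuous_const)
  have key : ∀ (v : L2I l) {Φ : ℝ × ℝ → ℝ} (_ : MemLp Φ 2 (volume.restrict (S l))),
      ∫ p in S l, ten c v p * Φ p = ∫ y in I 1, c y * ∫ x in I l, v x * Φ (x, y) := by
    intro v Φ hΦ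
    have hae : ∀ᵐ p ∂(volume.restrict (S l)), ten c v p * Φ p = c p.2 * (v p.1 * Φ p) := by
      filter_upwards [ten_coe c v] with p hp
      rw [hp]; ring
    have hint : Integrable (fun p : ℝ × ℝ => c p.2 * (v p.1 * Φ p)) (volume.restrict (S l)) :=
      (integrable_mul_Lp (ten c v) hΦ).congr hae
    rw [integral_congr_ae hae]
    rw [restrict_S] at hint ⊢
    rw [integral_prod_symm _ hint]
    simp only [integral_const_mul]
  rw [key u hm2, key g hm1, ← integral_neg]
  refine setIntegral_congr_fun measurableSet_Ioo fun y hy => ?_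
  have h1 := h _ (hT φ hφ y hy)
  have h2 : ∀ x, deriv (fun x => φ (x, y)) x = pd1 φ (x, y) := fun x =>
    (hasDerivAt_slice1 hs (x, y)).deriv
  simp only [h2] at h1
  simp only [h1, mul_neg]

theorem integral_mul_deriv_test {c ψ : ℝ → ℝ} (hc : ContDiff ℝ ∞ c) {Ω : Set ℝ}
    (hψ : ψ ∈ testFunctions Ω) : ∫ x in Ω, c x * deriv ψ x = -∫ x in Ω, deriv c x * ψ x := by
  have hψ' := deriv_mem_test hψ
  rw [setIntegral_mul_test hψ', setIntegral_mul_test hψ]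
  have hc' : Continuous (deriv c) := (contDiff_infty_iff_deriv.1 hc).2.continuous
  refine integral_mul_deriv_eq_deriv_mul_of_integrable
    (fun x _ => (hc.differentiable (by simp) x).hasDerivAt)
    (fun x _ => (hψ.1.differentiable (by simp) x).hasDerivAt) ?_ ?_ ?_
  · exact (hc.continuous.mul hψ'.1.continuous).integrable_of_hasCompactSupport
      (hψ'.2.1.mul_left)
  · exact (hc'.mul hψ.1.continuous).integrable_of_hasCompactSupport (hψ.2.1.mul_left)
  · exact (hc.continuous.mul hψ.1.continuous).integrable_of_hasCompactSupport (hψ.2.1.mul_left)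

/-- Integration by parts in the second variable, slice by slice. -/
theorem ten_IBP_snd (u : L2I l) (c c' : C(ℝ, ℝ)) (hc : ContDiff ℝ ∞ c) (hc' : deriv c = c') :
    IBP (volume.restrict (S l)) (testFunctions (S l)) pd2 (ten c u) (ten c' u) := by
  intro φ hφ
  have hs := hφ.1
  have key : ∀ (c : C(ℝ, ℝ)) {Φ : ℝ × ℝ → ℝ} (_ : MemLp Φ 2 (volume.restrict (S l))),
      ∫ p in S l, ten c u p * Φ p = ∫ x in I l, u x * ∫ y in I 1, c y * Φ (x, y) := by
    intro c Φ hΦ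
    have hae : ∀ᵐ p ∂(volume.restrict (S l)), ten c u p * Φ p = u p.1 * (c p.2 * Φ p) := by
      filter_upwards [ten_coe c u] with p hp
      rw [hp]; ring
    have hint : Integrable (fun p : ℝ × ℝ => u p.1 * (c p.2 * Φ p)) (volume.restrict (S l)) :=
      (integrable_mul_Lp (ten c u) hΦ).congr hae
    rw [integral_congr_ae hae]
    rw [restrict_S] at hint ⊢
    rw [integral_prod _ hint]
    simp only [integral_const_mul]
  rw [key c (memLp_test2 l φ hφ).2, key c' (memLp_test2 l φ hφ).1, ← integral_neg]
  refine setIntegral_congr_fun measurableSet_Ioo fun x hx => ?_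
  have hsl : (fun y => φ (x, y)) ∈ testFunctions (I 1) :=
    slice_mem_test hφ (contDiff_const.prodMk contDiff_id) continuous_snd (fun _ => rfl)
      fun y hy => hy.2
  have h1 := integral_mul_deriv_test hc hsl
  have h2 : ∀ y, deriv (fun y => φ (x, y)) y = pd2 φ (x, y) := fun y =>
    (hasDerivAt_slice2 hs (x, y)).deriv
  simp only [h2, hc'] at h1
  simp only [h1, mul_neg]

theorem ten_mem_W12Ssub {p : L2I l × L2I l} (hp : p ∈ W12sub l) (c c' : C(ℝ, ℝ))
    (hc : ContDiff ℝ ∞ c) (hc' : deriv c = c') : (ten c p.1, ten c p.2, ten c' p.1) ∈ W12Ssub l :=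
  ⟨ten_IBP (fun _ hφ => hφ.1) (fun _ hφ _ _ => slice_mem_test (r := Prod.fst) hφ
    (contDiff_id.prodMk contDiff_const) continuous_fst (fun _ => rfl) fun _ hx => hx.1) hp c,
    ten_IBP_snd p.1 c c' hc hc'⟩

theorem ten_mem_gammaSpace {p : L2I l × L2I l} (hp : p ∈ W12zero l) (c : C(ℝ, ℝ)) :
    (ten c p.1, ten c p.2) ∈ gammaSpace l :=
  ten_IBP (fun _ hφ => hφ.1) (fun _ hφ _ _ => hφ.1.comp (contDiff_id.prodMk contDiff_const)) hp c

end PlaneSobolev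

/-! ### Bernoulli–Navier displacements -/

section BernoulliNavier

variable {l : ℝ}

/-- The coordinate `x₂`. -/
abbrev X₂ : C(ℝ, ℝ) := ContinuousMap.id ℝ

theorem pair_one_one : pair 1 1 = 1 := by
  rw [pair]; simp

theorem pair_one_X₂ : pair 1 X₂ = 0 := by
  rw [pair, integral_I one_pos]
  simp

theorem pair_X₂_one : pair X₂ 1 = 0 := by
  rw [pair, integral_I one_pos]
  simp

theorem pair_X₂_X₂ : pair X₂ X₂ = 1 / 12 := by
  rw [pair, integral_I one_pos]
  have : ∀ x : ℝ, X₂ x * X₂ x = x ^ 2 := fun x => (sq x).symm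
  simp only [this, integral_pow]
  norm_num

theorem ten_eq_sub {c d e : C(ℝ, ℝ)} {a : ℝ} (h : ∀ x, c x = d x - a * e x) (f : L2I l) :
    ten c f = ten d f - a • ten e f := by
  refine Lp.ext ?_
  filter_upwards [ten_coe c f, ten_coe d f, ten_coe e f, Lp.coeFn_smul a (ten e f),
    Lp.coeFn_sub (ten d f) (a • ten e f)] with p h1 h2 h3 h4 h5
  rw [h5, Pi.sub_apply, h4, Pi.smul_apply, h1, h2, h3, h, smul_eq_mul]
  ring

theorem ten_zero (f : L2I l) : ten 0 f = 0 := by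
  have := ten_eq_sub (c := 0) (d := 0) (e := 0) (a := 1) (by simp) f
  rwa [one_smul, sub_self] at this

theorem mom_eq_sub {c d e : C(ℝ, ℝ)} {a : ℝ} (h : ∀ x, c x = d x - a * e x) (u : L2S l) :
    mom c u = mom d u - a • mom e u := by
  refine ext_inner_right ℝ fun f => ?_
  rw [inner_sub_left, real_inner_smul_left, inner_mom, inner_mom, inner_mom, ten_eq_sub h f,
    inner_sub_right, real_inner_smul_right]

theorem eq_of_mom {u v : L2S l}
    (h : ∀ ψ (hψ : ψ ∈ testFunctions (I 1)), mom (tst hψ) u = mom (tst hψ) v) : u = v := by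
  refine sub_eq_zero.1 (eq_zero_of_mom fun ψ hψ => ?_)
  rw [map_sub, h ψ hψ, sub_self]

theorem pair_one_tst {ψ : ℝ → ℝ} (hψ : ψ ∈ testFunctions (I 1)) :
    pair 1 (tst hψ) = ∫ x, ψ x :=
  setIntegral_mul_test hψ (fun _ => 1) |>.trans (by simp)

theorem exists_weight : ∃ (η : ℝ → ℝ) (hη : η ∈ testFunctions (I 1)), pair 1 (tst hη) = 1 := by
  obtain ⟨η, hη, h1⟩ := exists_test_integral_one (a := -(1 / 2 : ℝ)) (b := 1 / 2) (by norm_num)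
  exact ⟨η, hη, (pair_one_tst hη).trans h1⟩

theorem pair_one_deriv {ψ : ℝ → ℝ} (hψ : ψ ∈ testFunctions (I 1)) :
    pair 1 (tst (deriv_mem_test hψ)) = 0 := by
  have h := integral_mul_deriv_test (c := fun _ => 1) contDiff_const hψ
  simp only [deriv_const', zero_mul, integral_zero, neg_zero] at h
  exact h

theorem pair_X₂_deriv {ψ : ℝ → ℝ} (hψ : ψ ∈ testFunctions (I 1)) :
    pair X₂ (tst (deriv_mem_test hψ)) = -pair 1 (tst hψ) := by
  have h := integral_mul_deriv_test (c := fun x => x) contDiff_id hψ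
  simp only [deriv_id''] at h
  exact h

/-- A function whose `x₂`-derivative vanishes does not depend on `x₂`. -/
theorem eq_ten_of_mom_deriv {u : L2S l}
    (h : ∀ ψ (hψ : ψ ∈ testFunctions (I 1)), mom (tst (deriv_mem_test hψ)) u = 0)
    {η : ℝ → ℝ} (hη : η ∈ testFunctions (I 1)) (hη1 : pair 1 (tst hη) = 1) :
    u = ten 1 (mom (tst hη) u) := by
  refine eq_of_mom fun ψ hψ => ?_
  rw [pair_one_tst] at hη1
  obtain ⟨χ, hχ, hd⟩ := exists_test_primitive_sub (a := -(1 / 2 : ℝ)) (b := 1 / 2) (by norm_num)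
    hη hη1 hψ
  have h1 := h χ hχ
  rw [mom_eq_sub (d := tst hψ) (e := tst hη) (a := ∫ y, ψ y) fun x => by
    rw [tst_apply, hd]; rfl, sub_eq_zero] at h1
  rw [h1, mom_ten, pair_one_tst]

/-- A Bernoulli–Navier displacement has the form `y₁ = ξ₁ - x₂ ξ₂'`, `y₂ = ξ₂`. Here `ξ₂` is an
average of `y₂` over `x₂`. The shear condition makes the `x₂`-derivative of `y₁` equal to `-ξ₂'`,
and the moments of `∂₁y₁` provide the second derivative of `ξ₂`. -/
theorem exists_profile {y₁ y₂ : W12S l} (h12 : y₁.1.2.2 = -y₂.1.2.1) (h22 : y₂.1.2.2 = 0) :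
    ∃ (ξ₁ : W12 l) (ξ₂ : W22 l), y₁.1.1 = ten 1 ξ₁.1.1 - ten X₂ ξ₂.1.2.1 ∧
      y₂.1.1 = ten 1 ξ₂.1.1 := by
  obtain ⟨η, hη, hη1⟩ := exists_weight
  obtain ⟨m, hm⟩ : ∃ m, m = pair X₂ (tst hη) := ⟨_, rfl⟩
  have hy₁ := mem_W12Ssub.1 y₁.2
  have hy₂ := mem_W12Ssub.1 y₂.2
  obtain ⟨a, ha⟩ : ∃ a, a = mom (tst hη) y₂.1.1 := ⟨_, rfl⟩
  obtain ⟨b, hb⟩ : ∃ b, b = mom (tst hη) y₂.1.2.1 := ⟨_, rfl⟩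
  have e2 : y₂.1.1 = ten 1 a := by
    rw [ha]
    refine eq_ten_of_mom_deriv (fun ψ hψ => ?_) hη hη1
    rw [mom_deriv hψ hy₂.2, h22, map_zero, neg_zero]
  have hab : (a, b) ∈ W12sub l := by rw [ha, hb]; exact mom_mem_W12sub hη hy₂.1
  have e3 : ∀ ψ (hψ : ψ ∈ testFunctions (I 1)),
      mom (tst hψ) y₂.1.2.1 = pair 1 (tst hψ) • b := fun ψ hψ => by
    have h1 := mom_mem_W12sub hψ hy₂.1
    rw [e2, mom_ten] at h1
    exact weak_deriv_unique h1 ((W12sub l).smul_mem _ hab)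
  have e4 : ∀ ψ (hψ : ψ ∈ testFunctions (I 1)),
      mom (tst (deriv_mem_test hψ)) y₁.1.1 = pair 1 (tst hψ) • b := fun ψ hψ => by
    rw [mom_deriv hψ hy₁.2, h12, map_neg, neg_neg, e3]
  have e5 : y₁.1.1 + ten X₂ b = ten 1 (mom (tst hη) (y₁.1.1 + ten X₂ b)) := by
    refine eq_ten_of_mom_deriv (fun ψ hψ => ?_) hη hη1
    rw [map_add, e4 ψ hψ, mom_ten, pair_X₂_deriv hψ, neg_smul, add_neg_cancel]
  have hbd : (b, mom (tst (deriv_mem_test hη)) y₁.1.2.1) ∈ W12sub l := by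
    have h1 := mom_mem_W12sub (deriv_mem_test hη) hy₁.1
    rwa [e4 η hη, hη1, one_smul] at h1
  have hξ₁ : (mom (tst hη) (y₁.1.1 + ten X₂ b), mom (tst hη) y₁.1.2.1 +
      m • mom (tst (deriv_mem_test hη)) y₁.1.2.1) ∈ W12sub l := by
    have h1 := (W12sub l).add_mem (mom_mem_W12sub hη hy₁.1) ((W12sub l).smul_mem m hbd)
    rw [map_add, mom_ten, ← hm]
    exact h1
  exact ⟨⟨_, hξ₁⟩, ⟨(a, b, _), hab, hbd⟩, eq_sub_of_add_eq e5, e2⟩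

/-- The displacement `ξ₁ - x₂ ξ₂'`. -/
def bn1 (ξ₁ : W12 l) (ξ₂ : W22 l) : W12S l :=
  ⟨(ten 1 ξ₁.1.1, ten 1 ξ₁.1.2, ten 0 ξ₁.1.1) -
    (ten X₂ ξ₂.1.2.1, ten X₂ ξ₂.1.2.2, ten 1 ξ₂.1.2.1), (W12Ssub l).sub_mem
    (ten_mem_W12Ssub ξ₁.2 1 0 contDiff_const (deriv_const' 1))
    (ten_mem_W12Ssub ξ₂.2.2 X₂ 1 contDiff_id deriv_id'')⟩

/-- The displacement `ξ₂`, constant in `x₂`. -/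
def bn2 (ξ₂ : W22 l) : W12S l :=
  ⟨(ten 1 ξ₂.1.1, ten 1 ξ₂.1.2.1, ten 0 ξ₂.1.1),
    ten_mem_W12Ssub ξ₂.2.1 1 0 contDiff_const (deriv_const' 1)⟩

theorem bn1_fn (ξ₁ : W12 l) (ξ₂ : W22 l) :
    (bn1 ξ₁ ξ₂).1.1 = ten 1 ξ₁.1.1 - ten X₂ ξ₂.1.2.1 := rfl
theorem bn1_d2 (ξ₁ : W12 l) (ξ₂ : W22 l) : (bn1 ξ₁ ξ₂).1.2.2 = -(bn2 ξ₂).1.2.1 := by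
  change ten 0 ξ₁.1.1 - ten 1 ξ₂.1.2.1 = -ten 1 ξ₂.1.2.1
  rw [ten_zero, zero_sub]
theorem bn2_d2 (ξ₂ : W22 l) : (bn2 ξ₂).1.2.2 = 0 := ten_zero _

theorem ten_sub_coe (f g : L2I l) : ∀ᵐ p ∂(volume.restrict (S l)),
    (ten 1 f - ten X₂ g : L2S l) p = f p.1 - p.2 * g p.1 := by
  filter_upwards [ten_coe 1 f, ten_coe X₂ g, Lp.coeFn_sub (ten 1 f) (ten X₂ g)] with p h1 h2 h3
  rw [h3, Pi.sub_apply, h1, h2]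
  simp [mul_comm]

theorem ten_one_coe (f : L2I l) : ∀ᵐ p ∂(volume.restrict (S l)), ten 1 f p = f p.1 := by
  filter_upwards [ten_coe 1 f] with p h1
  rw [h1]; simp

theorem ten_one_injective {f g : L2I l} (h : ten 1 f = ten 1 g) : f = g := by
  obtain ⟨η, hη, hη1⟩ := exists_weight
  have h1 : mom (tst hη) (ten 1 f) = mom (tst hη) (ten 1 g) := by rw [h]
  rwa [mom_ten, mom_ten, hη1, one_smul, one_smul] at h1

/-- The boundary conditions for the displacements, in terms of `ξ₁` and `ξ₂`. -/
theorem bn1_mem_gammaSpace_iff (hl : 0 < l) {p q : L2I l × L2I l} :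
    (ten 1 p.1 - ten X₂ q.1, ten 1 p.2 - ten X₂ q.2) ∈ gammaSpace l ↔
      p ∈ W12zero l ∧ q ∈ W12zero l := by
  refine ⟨fun h => ?_, fun ⟨hp, hq⟩ =>
    (gammaSpace l).sub_mem (ten_mem_gammaSpace hp 1) (ten_mem_gammaSpace hq X₂)⟩
  obtain ⟨η, hη, hη1⟩ := exists_weight
  have h1 := mom_mem_W12zero hl (deriv_mem_test hη) h
  simp only [map_sub, mom_ten, pair_one_deriv hη, pair_X₂_deriv hη, hη1, zero_smul, neg_smul,
    one_smul, zero_sub, neg_neg] at h1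
  have h2 := mom_mem_W12zero hl hη h
  simp only [map_sub, mom_ten, hη1, one_smul] at h2
  refine ⟨?_, h1⟩
  have h3 := (W12zero l).add_mem h2 ((W12zero l).smul_mem (pair X₂ (tst hη)) h1)
  have e : (p.1 - pair X₂ (tst hη) • q.1, p.2 - pair X₂ (tst hη) • q.2) +
      pair X₂ (tst hη) • q = p := Prod.ext (sub_add_cancel _ _) (sub_add_cancel _ _)
  rwa [e] at h3

theorem bn2_mem_gammaSpace_iff (hl : 0 < l) {p : L2I l × L2I l} :
    (ten 1 p.1, ten 1 p.2) ∈ gammaSpace l ↔ p ∈ W12zero l := by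
  refine ⟨fun h => ?_, fun hp => ten_mem_gammaSpace hp 1⟩
  obtain ⟨η, hη, hη1⟩ := exists_weight
  have h2 := mom_mem_W12zero hl hη h
  simpa only [mom_ten, hη1, one_smul] using h2

theorem bn1_vanishes_iff (hl : 0 < l) (ξ₁ u₁hat : W12 l) (ξ₂ u₂hat : W22 l) :
    VanishesOnGamma l (fun p => (bn1 ξ₁ ξ₂).fn p - (u₁hat.fn p.1 - p.2 * u₂hat.d p.1))
      (fun p => (bn1 ξ₁ ξ₂).d1 p - (u₁hat.d p.1 - p.2 * u₂hat.dd p.1)) ↔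
    (ξ₁ - u₁hat : W12 l).1 ∈ W12zero l ∧ (ξ₂ - u₂hat : W22 l).1.2 ∈ W12zero l := by
  rw [← bn1_mem_gammaSpace_iff hl]
  refine vanishesOnGamma_iff ?_ ?_
  · filter_upwards [ten_sub_coe (ξ₁ - u₁hat : W12 l).1.1 (ξ₂ - u₂hat : W22 l).1.2.1,
      ten_sub_coe ξ₁.1.1 ξ₂.1.2.1, ae_lift (Lp.coeFn_sub ξ₁.1.1 u₁hat.1.1),
      ae_lift (Lp.coeFn_sub ξ₂.1.2.1 u₂hat.1.2.1)] with p h1 h2 h3 h4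
    rw [h1]
    change (ten 1 ξ₁.1.1 - ten X₂ ξ₂.1.2.1 : L2S l) p - _ =
      (ξ₁.1.1 - u₁hat.1.1 : L2I l) p.1 - p.2 * (ξ₂.1.2.1 - u₂hat.1.2.1 : L2I l) p.1
    rw [h2, h3, h4, Pi.sub_apply, Pi.sub_apply]
    change _ - (u₁hat.1.1 p.1 - p.2 * u₂hat.1.2.1 p.1) = _
    ring
  · filter_upwards [ten_sub_coe (ξ₁ - u₁hat : W12 l).1.2 (ξ₂ - u₂hat : W22 l).1.2.2,
      ten_sub_coe ξ₁.1.2 ξ₂.1.2.2, ae_lift (Lp.coeFn_sub ξ₁.1.2 u₁hat.1.2),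
      ae_lift (Lp.coeFn_sub ξ₂.1.2.2 u₂hat.1.2.2)] with p h1 h2 h3 h4
    rw [h1]
    change (ten 1 ξ₁.1.2 - ten X₂ ξ₂.1.2.2 : L2S l) p - _ =
      (ξ₁.1.2 - u₁hat.1.2 : L2I l) p.1 - p.2 * (ξ₂.1.2.2 - u₂hat.1.2.2 : L2I l) p.1
    rw [h2, h3, h4, Pi.sub_apply, Pi.sub_apply]
    change _ - (u₁hat.1.2 p.1 - p.2 * u₂hat.1.2.2 p.1) = _
    ring

theorem bn2_vanishes_iff (hl : 0 < l) (ξ₂ u₂hat : W22 l) :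
    VanishesOnGamma l (fun p => (bn2 ξ₂).fn p - u₂hat.fn p.1)
      (fun p => (bn2 ξ₂).d1 p - u₂hat.d p.1) ↔
    ((ξ₂ - u₂hat : W22 l).1.1, (ξ₂ - u₂hat : W22 l).1.2.1) ∈ W12zero l := by
  rw [← bn2_mem_gammaSpace_iff hl]
  refine vanishesOnGamma_iff ?_ ?_
  · filter_upwards [ten_one_coe (ξ₂ - u₂hat : W22 l).1.1, ten_one_coe ξ₂.1.1,
      ae_lift (Lp.coeFn_sub ξ₂.1.1 u₂hat.1.1)] with p h1 h2 h3
    rw [h1]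
    change ten 1 ξ₂.1.1 p - _ = (ξ₂.1.1 - u₂hat.1.1 : L2I l) p.1
    rw [h2, h3]; rfl
  · filter_upwards [ten_one_coe (ξ₂ - u₂hat : W22 l).1.2.1, ten_one_coe ξ₂.1.2.1,
      ae_lift (Lp.coeFn_sub ξ₂.1.2.1 u₂hat.1.2.1)] with p h1 h2 h3
    rw [h1]
    change ten 1 ξ₂.1.2.1 p - _ = (ξ₂.1.2.1 - u₂hat.1.2.1 : L2I l) p.1
    rw [h2, h3]; rfl

section Identification

variable {u₁hat : W12 l} {u₂hat vhat : W22 l}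

theorem identified_iff {k : V l} {z : S1D l u₁hat u₂hat vhat} : Identified k z ↔
    z.y₁ = bn1 (V.ξ₁ k) (V.ξ₂ k) ∧ z.y₂ = bn2 (V.ξ₂ k) ∧ z.w = V.w k ∧ z.θ = V.θ k := by
  have h1 : (∀ᵐ p ∂(volume.restrict (S l)),
      z.y₁.fn p = (V.ξ₁ k).fn p.1 - p.2 * (V.ξ₂ k).d p.1) ↔
      z.y₁ = bn1 (V.ξ₁ k) (V.ξ₂ k) := by
    refine ⟨fun h => W12S_ext (Lp.ext ?_), fun h => ?_⟩
    · filter_upwards [h, ten_sub_coe (V.ξ₁ k).1.1 (V.ξ₂ k).1.2.1] with p h1 h2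
      rw [bn1_fn, h2]
      exact h1
    · rw [h]
      exact ten_sub_coe (V.ξ₁ k).1.1 (V.ξ₂ k).1.2.1
  have h2 : (∀ᵐ p ∂(volume.restrict (S l)), z.y₂.fn p = (V.ξ₂ k).fn p.1) ↔
      z.y₂ = bn2 (V.ξ₂ k) := by
    refine ⟨fun h => W12S_ext (Lp.ext ?_), fun h => ?_⟩
    · filter_upwards [h, ten_one_coe (V.ξ₂ k).1.1] with p h1 h2
      refine Eq.trans h1 (Eq.symm ?_)
      exact h2
    · rw [h]
      exact ten_one_coe (V.ξ₂ k).1.1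
  rw [Identified, h1, h2]

theorem ae_sub_eq {α : Type*} [MeasurableSpace α] {μ : Measure α} {f g : Lp ℝ 2 μ}
    (h : f = -g) : ∀ᵐ p ∂μ, 1 / 2 * (f p + g p) = 0 := by
  subst h
  filter_upwards [Lp.coeFn_neg g] with p hp
  rw [hp]; simp

theorem exists_identified (hl : 0 < l) {k : V l} (hk : k ∈ K l u₁hat u₂hat vhat) :
    ∃ z : S1D l u₁hat u₂hat vhat, Identified k z := by
  obtain ⟨h1, h2, h3, h4⟩ := hk
  refine ⟨⟨bn1 (V.ξ₁ k) (V.ξ₂ k), bn2 (V.ξ₂ k), V.w k, V.θ k, ae_sub_eq (bn1_d2 _ _), ?_,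
    (bn1_vanishes_iff hl _ _ _ _).2 ⟨h1, h2.2⟩, (bn2_vanishes_iff hl _ _).2 h2.1, h3, h4⟩,
    identified_iff.2 ⟨rfl, rfl, rfl, rfl⟩⟩
  change ∀ᵐ p ∂(volume.restrict (S l)), (bn2 (V.ξ₂ k)).1.2.2 p = 0
  rw [bn2_d2]
  exact Lp.coeFn_zero ℝ 2 _

theorem Identified.mem_K (hl : 0 < l) {k : V l} {z : S1D l u₁hat u₂hat vhat}
    (h : Identified k z) : k ∈ K l u₁hat u₂hat vhat := by
  obtain ⟨h1, h2, h3, h4⟩ := identified_iff.1 h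
  have g1 := z.y₁_on_Γ
  have g2 := z.y₂_on_Γ
  have g3 := z.w_bdry
  have g4 := z.θ_bdry
  rw [h1, bn1_vanishes_iff hl] at g1
  rw [h2, bn2_vanishes_iff hl] at g2
  rw [h3] at g3
  rw [h4] at g4
  exact ⟨g1.1, ⟨g2, g1.2⟩, g3, g4⟩

theorem exists_state (z : S1D l u₁hat u₂hat vhat) : ∃ k : V l, Identified k z := by
  have h12 : z.y₁.1.2.2 = -z.y₂.1.2.1 := by
    refine Lp.ext ?_
    filter_upwards [z.e₁₂, Lp.coeFn_neg z.y₂.1.2.1] with p h1 h2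
    rw [h2, Pi.neg_apply]
    change z.y₁.d2 p = -z.y₂.d1 p
    linarith
  have h22 : z.y₂.1.2.2 = 0 := by
    refine Lp.ext ?_
    filter_upwards [z.e₂₂, Lp.coeFn_zero ℝ 2 (volume.restrict (S l))] with p h1 h2
    rw [h2]
    exact h1
  obtain ⟨ξ₁, ξ₂, h1, h2⟩ := exists_profile h12 h22
  exact ⟨(ξ₁, ξ₂, z.w, z.θ), identified_iff.2 ⟨W12S_ext h1, W12S_ext h2, rfl, rfl⟩⟩

theorem Identified.unique_right {k : V l} {z z' : S1D l u₁hat u₂hat vhat} (h : Identified k z)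
    (h' : Identified k z') : z = z' := by
  obtain ⟨h1, h2, h3, h4⟩ := identified_iff.1 h
  obtain ⟨h1', h2', h3', h4'⟩ := identified_iff.1 h'
  exact S1D.ext (h1.trans h1'.symm) (h2.trans h2'.symm) (h3.trans h3'.symm) (h4.trans h4'.symm)

theorem Identified.unique_left {k k' : V l} {z : S1D l u₁hat u₂hat vhat} (h : Identified k z)
    (h' : Identified k' z) : k = k' := by
  obtain ⟨h1, h2, h3, h4⟩ := identified_iff.1 h
  obtain ⟨h1', h2', h3', h4'⟩ := identified_iff.1 h'
  have e2 : V.ξ₂ k = V.ξ₂ k' := by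
    have : (bn2 (V.ξ₂ k)).1.1 = (bn2 (V.ξ₂ k')).1.1 := by rw [← h2, h2']
    exact W22_ext (ten_one_injective this)
  have e1 : V.ξ₁ k = V.ξ₁ k' := by
    have : (bn1 (V.ξ₁ k) (V.ξ₂ k)).1.1 = (bn1 (V.ξ₁ k') (V.ξ₂ k')).1.1 := by rw [← h1, h1']
    rw [bn1_fn, bn1_fn, e2] at this
    exact W12_ext (ten_one_injective (sub_left_injective this))
  exact Prod.ext e1 (Prod.ext e2 (Prod.ext (h3.symm.trans h3') (h4.symm.trans h4')))

end Identification

end BernoulliNavier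

/-! ### The planar functionals in terms of the strains -/

section Transfer

variable {l : ℝ}

/-- The coefficients describe the effective forms of `Q`. -/
def FormCoeffs.Describes (T : FormCoeffs) (Q : QuadraticForm ℝ (Matrix (Fin 2) (Fin 2) ℝ)) :
    Prop := ∀ a b, form1 Q a b = T.C * a ^ 2 + T.γ * (b + T.ρ * a) ^ 2

theorem exists_describes {Q : QuadraticForm ℝ (Matrix (Fin 2) (Fin 2) ℝ)}
    (hQ : IsAdmissibleForm Q) : ∃ T : FormCoeffs, T.Describes Q := by
  obtain ⟨C, γ, ρ, hC, hγ, h⟩ := exists_form1_eq hQ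
  exact ⟨⟨C, γ, ρ, hC, hγ⟩, h⟩

theorem integral_sq_eq_norm_sq {α : Type*} [MeasurableSpace α] {μ : Measure α} (u : Lp ℝ 2 μ) :
    ∫ x, (u x) ^ 2 ∂μ = ‖u‖ ^ 2 := by
  rw [← real_inner_self_eq_norm_sq, L2.inner_def]
  refine integral_congr_ae (Eventually.of_forall fun x => ?_)
  simp [sq]

theorem inner_eq_integral_mul {α : Type*} [MeasurableSpace α] {μ : Measure α} (u v : Lp ℝ 2 μ) :
    inner ℝ u v = ∫ x, u x * v x ∂μ := by
  rw [L2.inner_def]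
  refine integral_congr_ae (Eventually.of_forall fun x => ?_)
  simp [mul_comm]

section

variable {Q : QuadraticForm ℝ (Matrix (Fin 2) (Fin 2) ℝ)} {T : FormCoeffs}

/-- The term linear in `x₂` has mean zero, and `x₂²` has mean `1 / 12`. -/
theorem integral_form0 (hT : T.Describes Q) (a b : L2I l) {F : ℝ × ℝ → ℝ}
    (hF : ∀ᵐ p ∂(volume.restrict (S l)), F p = a p.1 - p.2 * b p.1) :
    ∫ p in S l, form0 Q (F p) = T.C * ‖a‖ ^ 2 + 1 / 12 * (T.C * ‖b‖ ^ 2) := by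
  have e : ∫ p in S l, form0 Q (F p) =
      ∫ p in S l, T.C * ((ten 1 a - ten X₂ b : L2S l) p) ^ 2 := by
    refine integral_congr_ae ?_
    filter_upwards [hF, ten_sub_coe a b] with p h1 h2
    rw [form0_eq T.γ_pos hT, h1, h2]
  rw [e, integral_const_mul, integral_sq_eq_norm_sq, ← real_inner_self_eq_norm_sq, inner_sub_left,
    inner_sub_right, inner_sub_right, inner_ten, inner_ten, inner_ten, inner_ten, pair_one_one,
    pair_one_X₂, pair_X₂_one, pair_X₂_X₂, real_inner_self_eq_norm_sq, real_inner_self_eq_norm_sq]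
  ring

theorem integral_form1 (hT : T.Describes Q) (a b : L2I l) {A B : ℝ → ℝ}
    (hA : ∀ᵐ x ∂(volume.restrict (I l)), A x = a x)
    (hB : ∀ᵐ x ∂(volume.restrict (I l)), B x = b x) :
    ∫ x in I l, form1 Q (A x) (B x) = T.C * ‖a‖ ^ 2 + T.γ * ‖b + T.ρ • a‖ ^ 2 := by
  rw [← integral_sq_eq_norm_sq, ← integral_sq_eq_norm_sq, ← integral_const_mul,
    ← integral_const_mul, ← integral_add]
  · refine integral_congr_ae ?_
    filter_upwards [hA, hB, Lp.coeFn_add b (T.ρ • a), Lp.coeFn_smul T.ρ a] with x h1 h2 h3 h4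
    rw [hT, h1, h2, h3, Pi.add_apply, h4]; rfl
  · exact (Lp.memLp a).integrable_sq.const_mul _
  · exact (Lp.memLp (b + T.ρ • a)).integrable_sq.const_mul _

theorem norm_sq_op (T : FormCoeffs) (y : Y l) : ‖T.op l y‖ ^ 2 =
    (T.C * ‖y 0‖ ^ 2 + 1 / 12 * (T.C * ‖y 1‖ ^ 2)) +
      1 / 12 * (T.C * ‖y 2‖ ^ 2 + T.γ * ‖y 3 + T.ρ • y 2‖ ^ 2) := by
  rw [← real_inner_self_eq_norm_sq, T.inner_op]
  simp only [real_inner_self_eq_norm_sq]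
  ring

variable {u₁hat : W12 l} {u₂hat vhat : W22 l}

theorem Identified.d1_ae {k : V l} {z : S1D l u₁hat u₂hat vhat} (h : Identified k z) :
    ∀ᵐ p ∂(volume.restrict (S l)), z.y₁.d1 p = (V.ξ₁ k).d p.1 - p.2 * (V.ξ₂ k).dd p.1 := by
  obtain ⟨h1, -, -, -⟩ := identified_iff.1 h
  rw [h1]
  exact ten_sub_coe (V.ξ₁ k).1.2 (V.ξ₂ k).1.2.2

theorem D0_eq (hl : 0 < l) (hT : T.Describes Q) {k k' : V l} {z z' : S1D l u₁hat u₂hat vhat}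
    (h : Identified k z) (h' : Identified k' z') :
    D0 Q z z' = ‖T.op l (strain hl k) - T.op l (strain hl k')‖ := by
  have hd := h.d1_ae
  have hd' := h'.d1_ae
  obtain ⟨-, -, hw, hθ⟩ := h
  obtain ⟨-, -, hw', hθ'⟩ := h'
  rw [← map_sub, D0, ← Real.sqrt_sq (norm_nonneg (T.op l _)), norm_sq_op]
  congr 2
  · refine integral_form0 hT _ _ ?_
    rw [PiLp.sub_apply, PiLp.sub_apply, strain_1, strain_1]
    filter_upwards [hd, hd', ae_lift (Lp.coeFn_sub (strain hl k 0) (strain hl k' 0)),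
      ae_lift (Lp.coeFn_sub (D2 l k) (D2 l k')), ae_lift (strain_0_coe hl k),
      ae_lift (strain_0_coe hl k')] with p h1 h2 h3 h4 h5 h6
    rw [h1, h2, h3, h4, Pi.sub_apply, Pi.sub_apply, h5, h6, hw, hw', D2_apply, D2_apply]
    ring
  · congr 1
    refine integral_form1 hT _ _ ?_ ?_
    · rw [PiLp.sub_apply, strain_2, strain_2, hw, hw']
      filter_upwards [Lp.coeFn_sub (D3 l k) (D3 l k')] with x hx
      rw [hx]; rfl
    · rw [PiLp.sub_apply, strain_3, strain_3, hθ, hθ']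
      filter_upwards [Lp.coeFn_sub (D4 l k) (D4 l k')] with x hx
      rw [hx]; rfl

theorem integral_work (f g₁ g₂ : L2I l) {k : V l} {z : S1D l u₁hat u₂hat vhat}
    (h : Identified k z) :
    ∫ p in S l, (f p.1 * z.w.fn p.1 + (g₁ p.1 * z.y₁.fn p + g₂ p.1 * z.y₂.fn p)) =
      work f g₁ g₂ k := by
  obtain ⟨h1, h2, hw, hθ⟩ := identified_iff.1 h
  have i : ∀ u v : L2S l, Integrable (fun p => u p * v p) (volume.restrict (S l)) :=
    fun u v => integrable_mul_Lp u (Lp.memLp v)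
  have e : ∀ᵐ p ∂(volume.restrict (S l)),
      f p.1 * z.w.fn p.1 + (g₁ p.1 * z.y₁.fn p + g₂ p.1 * z.y₂.fn p) =
      ten 1 f p * ten 1 (V.w k).1.1 p + (ten 1 g₁ p * (bn1 (V.ξ₁ k) (V.ξ₂ k)).1.1 p +
        ten 1 g₂ p * (bn2 (V.ξ₂ k)).1.1 p) := by
    rw [h1, h2, hw]
    filter_upwards [ten_one_coe f, ten_one_coe g₁, ten_one_coe g₂, ten_one_coe (V.w k).1.1]
      with p e1 e2 e3 e4
    rw [e1, e2, e3, e4]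
  have j : ∀ u v u' v' : L2S l,
      Integrable (fun p => u p * v p + u' p * v' p) (volume.restrict (S l)) :=
    fun u v u' v' => (i u v).add (i u' v')
  rw [integral_congr_ae e, integral_add (i _ _) (j _ _ _ _),
    integral_add (i _ _) (i _ _), ← inner_eq_integral_mul, ← inner_eq_integral_mul,
    ← inner_eq_integral_mul, bn1_fn, inner_sub_right, inner_ten, inner_ten, inner_ten]
  change _ + (_ + inner ℝ (ten 1 g₂) (ten 1 (V.ξ₂ k).1.1)) = _
  rw [inner_ten, pair_one_one, pair_one_X₂, work_apply]
  ring

theorem phi0_eq (hl : 0 < l) (hT : T.Describes Q) (f g₁ g₂ : L2I l) {k : V l}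
    {z : S1D l u₁hat u₂hat vhat} (h : Identified k z) :
    phi0 Q f g₁ g₂ z = 1 / 2 * ‖T.op l (strain hl k)‖ ^ 2 - work f g₁ g₂ k := by
  have hw := h.2.2.1
  have hθ := h.2.2.2
  rw [phi0, integral_work f g₁ g₂ h, norm_sq_op,
    integral_form0 hT (strain hl k 0) (strain hl k 1),
    integral_form1 hT (strain hl k 2) (strain hl k 3)]
  · ring
  · rw [strain_2, hw]
    exact Eventually.of_forall fun x => rfl
  · rw [strain_3, hθ]
    exact Eventually.of_forall fun x => rfl
  · rw [strain_1]
    filter_upwards [h.d1_ae, ae_lift (strain_0_coe hl k)] with p h1 h2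
    rw [h1, h2, hw, D2_apply]
    ring

end

/-! ### Transfer to the gradient system of directions -/

section Equivalence

variable (hl : 0 < l) {u₁hat : W12 l} {u₂hat vhat : W22 l}

/-- The state identified with a point of `𝒮`. -/
def state (z : S1D l u₁hat u₂hat vhat) : V l := (exists_state z).choose

theorem identified_state (z : S1D l u₁hat u₂hat vhat) : Identified (state z) z :=
  (exists_state z).choose_spec

/-- The state that carries the boundary values. -/
def base (u₁hat : W12 l) (u₂hat vhat : W22 l) : V l := (u₁hat, u₂hat, vhat, 0)

/-- The difference of the state identified with `z` and the state of the boundary values. -/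
def dir (z : S1D l u₁hat u₂hat vhat) : V0 l :=
  ⟨state z - base u₁hat u₂hat vhat, mem_K_iff.1 ((identified_state z).mem_K hl)⟩

theorem base_add_dir (z : S1D l u₁hat u₂hat vhat) :
    base u₁hat u₂hat vhat + (dir hl z : V l) = state z := add_sub_cancel _ _

theorem dir_bijective : Function.Bijective (dir hl (u₁hat := u₁hat) (u₂hat := u₂hat)
    (vhat := vhat)) := by
  constructor
  · intro z z' h
    have e : state z = state z' := by rw [← base_add_dir hl, ← base_add_dir hl, h]
    have h' := identified_state z'
    rw [← e] at h'
    exact (identified_state z).unique_right h'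
  · intro x
    have hk : base u₁hat u₂hat vhat + (x : V l) ∈ K l u₁hat u₂hat vhat := by
      refine mem_K_iff.2 ?_
      change base u₁hat u₂hat vhat + (x : V l) - base u₁hat u₂hat vhat ∈ V0 l
      rw [add_sub_cancel_left]
      exact x.2
    obtain ⟨z, hz⟩ := exists_identified hl hk
    refine ⟨z, Subtype.ext ?_⟩
    have e := (identified_state z).unique_left hz
    change state z - base u₁hat u₂hat vhat = x
    rw [e, add_sub_cancel_left]

/-- The points of `𝒮` correspond to the directions. -/
def dirEquiv (u₁hat : W12 l) (u₂hat vhat : W22 l) : S1D l u₁hat u₂hat vhat ≃ V0 l :=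
  Equiv.ofBijective (dir hl) (dir_bijective hl)

theorem dirEquiv_apply (z : S1D l u₁hat u₂hat vhat) :
    dirEquiv hl u₁hat u₂hat vhat z = dir hl z := rfl

variable {QW QR : QuadraticForm ℝ (Matrix (Fin 2) (Fin 2) ℝ)} {W R : FormCoeffs}

theorem D0_eq_D (hR : R.Describes QR) (f g₁ g₂ : L2I l) :
    (D0 QR : S1D l u₁hat u₂hat vhat → _ → ℝ) = fun z z' =>
      (ribbonSystem hl R W f g₁ g₂ (base u₁hat u₂hat vhat)).toGradSystem.D
        (dirEquiv hl u₁hat u₂hat vhat z) (dirEquiv hl u₁hat u₂hat vhat z') := by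
  funext z z'
  rw [D0_eq hl hR (identified_state z) (identified_state z'), ← base_add_dir hl z,
    ← base_add_dir hl z', ← ribbonSystem_P hl R W f g₁ g₂, ← ribbonSystem_P hl R W f g₁ g₂]
  rfl

theorem phi0_eq_φ (hW : W.Describes QW) (f g₁ g₂ : L2I l) :
    (phi0 QW f g₁ g₂ : S1D l u₁hat u₂hat vhat → ℝ) = fun z =>
      (ribbonSystem hl R W f g₁ g₂ (base u₁hat u₂hat vhat)).toGradSystem.φ
        (dirEquiv hl u₁hat u₂hat vhat z) := by
  funext z
  rw [phi0_eq hl hW f g₁ g₂ (identified_state z), ← base_add_dir hl z,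
    ← ribbonSystem_P hl R W f g₁ g₂, map_add]
  change _ = 1 / 2 * ‖W.op l _‖ ^ 2 - work f g₁ g₂ (dir hl z : V l) +
    -work f g₁ g₂ (base u₁hat u₂hat vhat)
  rw [dirEquiv_apply]
  ring

theorem localSlope_comp {X X' : Type*} {e : X' → X} (he : Function.Surjective e)
    (d : X → X → ℝ) (φ : X → ℝ) (u : X') :
    localSlope (fun a b => d (e a) (e b)) (fun a => φ (e a)) u = localSlope d φ (e u) := by
  have h : comap (fun v => d (e u) (e v)) (𝓝[>] 0) = comap e (comap (fun v => d (e u) v) (𝓝[>] 0)) :=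
    comap_comap.symm
  rw [localSlope, localSlope, h]
  conv_rhs => rw [← map_comap_of_surjective he (comap (fun v => d (e u) v) (𝓝[>] 0))]
  rfl

theorem slope0_eq_slope (hW : W.Describes QW) (hR : R.Describes QR) (f g₁ g₂ : L2I l) :
    (slope0 QW QR f g₁ g₂ : S1D l u₁hat u₂hat vhat → ENNReal) = fun z =>
      ENNReal.ofReal ((ribbonSystem hl R W f g₁ g₂ (base u₁hat u₂hat vhat)).toGradSystem.slope
        (dirEquiv hl u₁hat u₂hat vhat z)) := by
  funext z
  rw [slope0, D0_eq_D hl (W := W) hR f g₁ g₂, phi0_eq_φ hl (R := R) hW f g₁ g₂,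
    localSlope_comp (dirEquiv hl u₁hat u₂hat vhat).surjective, GradSystem.localSlope_eq]

end Equivalence

end Transfer

/-! ### The weak form of the gradient flow -/

section Weak

variable {l : ℝ}

/-- The derivative of the strains at `k` in the direction `h`. -/
def dstrain (hl : 0 < l) (k h : V l) : Y l := strainL l h + (2 : ℝ) • strainB hl k h

theorem dstrain_0 (hl : 0 < l) (k h : V l) :
    dstrain hl k h 0 = D1 l h + mulW hl (Dw l k) (Dw l h) := by
  change D1 l h + (2 : ℝ) • ((1 / 2 : ℝ) • mulW hl (Dw l k) (Dw l h)) = _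
  rw [smul_smul]
  norm_num

theorem dstrain_1 (hl : 0 < l) (k h : V l) : dstrain hl k h 1 = D2 l h := by
  change D2 l h + (2 : ℝ) • (0 : L2I l) = _
  rw [smul_zero, add_zero]

theorem dstrain_2 (hl : 0 < l) (k h : V l) : dstrain hl k h 2 = D3 l h := by
  change D3 l h + (2 : ℝ) • (0 : L2I l) = _
  rw [smul_zero, add_zero]

theorem dstrain_3 (hl : 0 < l) (k h : V l) : dstrain hl k h 3 = D4 l h := by
  change D4 l h + (2 : ℝ) • (0 : L2I l) = _
  rw [smul_zero, add_zero]

theorem dstrain_0_coe (hl : 0 < l) (k h : V l) : ∀ᵐ x ∂(volume.restrict (I l)),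
    dstrain hl k h 0 x = (V.ξ₁ h).d x + (V.w k).d x * (V.w h).d x := by
  rw [dstrain_0]
  filter_upwards [Lp.coeFn_add (D1 l h) (mulW hl (Dw l k) (Dw l h)),
    mulW_coe hl (Dw l k) (Dw l h)] with x h1 h2
  rw [h1, Pi.add_apply, h2]; rfl

/-- The axial, in-plane bending, out-of-plane bending and twisting stresses of a form with the
coefficients `T`, for a strain `y`. -/
def FormCoeffs.stress (T : FormCoeffs) (y : Y l) : Fin 4 → L2I l :=
  ![T.C • y 0, T.C • y 1, T.C • y 2 + (T.γ * T.ρ) • (y 3 + T.ρ • y 2), T.γ • (y 3 + T.ρ • y 2)]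

theorem FormCoeffs.inner_op_eq_stress (T : FormCoeffs) (y h : Y l) :
    inner ℝ (T.op l y) (T.op l h) = inner ℝ (T.stress y 0) (h 0) + 1 / 12 *
      (inner ℝ (T.stress y 1) (h 1) + inner ℝ (T.stress y 2) (h 2) +
        inner ℝ (T.stress y 3) (h 3)) := by
  change _ = inner ℝ (T.C • y 0) (h 0) + 1 / 12 * (inner ℝ (T.C • y 1) (h 1) +
    inner ℝ (T.C • y 2 + (T.γ * T.ρ) • (y 3 + T.ρ • y 2)) (h 2) +
    inner ℝ (T.γ • (y 3 + T.ρ • y 2)) (h 3))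
  rw [T.inner_op]
  simp only [inner_add_left, inner_add_right, real_inner_smul_left, real_inner_smul_right]
  ring

section

variable {Q : QuadraticForm ℝ (Matrix (Fin 2) (Fin 2) ℝ)} {T : FormCoeffs}

theorem stress_0_coe (hT : T.Describes Q) (y : Y l) :
    ∀ᵐ x ∂(volume.restrict (I l)), T.stress y 0 x = const0 Q * y 0 x := by
  filter_upwards [Lp.coeFn_smul T.C (y 0)] with x hx
  rw [const0_eq T.γ_pos hT]
  exact hx

theorem stress_1_coe (hT : T.Describes Q) (y : Y l) :
    ∀ᵐ x ∂(volume.restrict (I l)), T.stress y 1 x = const0 Q * y 1 x := by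
  filter_upwards [Lp.coeFn_smul T.C (y 1)] with x hx
  rw [const0_eq T.γ_pos hT]
  exact hx

theorem stress_2_coe (hT : T.Describes Q) (y : Y l) : ∀ᵐ x ∂(volume.restrict (I l)),
    T.stress y 2 x = 1 / 2 * form1_d1 Q (y 2 x) (y 3 x) := by
  filter_upwards [Lp.coeFn_add (T.C • y 2) ((T.γ * T.ρ) • (y 3 + T.ρ • y 2)),
    Lp.coeFn_smul T.C (y 2), Lp.coeFn_smul (T.γ * T.ρ) (y 3 + T.ρ • y 2),
    Lp.coeFn_add (y 3) (T.ρ • y 2), Lp.coeFn_smul T.ρ (y 2)] with x h1 h2 h3 h4 h5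
  rw [form1_d1_eq hT]
  refine h1.trans ?_
  rw [Pi.add_apply, h2, h3, Pi.smul_apply, Pi.smul_apply, h4, Pi.add_apply, h5, Pi.smul_apply,
    smul_eq_mul, smul_eq_mul, smul_eq_mul]
  ring

theorem stress_3_coe (hT : T.Describes Q) (y : Y l) : ∀ᵐ x ∂(volume.restrict (I l)),
    T.stress y 3 x = 1 / 2 * form1_d2 Q (y 2 x) (y 3 x) := by
  filter_upwards [Lp.coeFn_smul T.γ (y 3 + T.ρ • y 2),
    Lp.coeFn_add (y 3) (T.ρ • y 2), Lp.coeFn_smul T.ρ (y 2)] with x h3 h4 h5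
  rw [form1_d2_eq hT]
  refine h3.trans ?_
  rw [Pi.smul_apply, h4, Pi.add_apply, h5, Pi.smul_apply, smul_eq_mul, smul_eq_mul]
  ring

end

/-- The weak equations are the balance of forces, tested with one component at a time. -/
theorem weakEquations_of_inner (hl : 0 < l) {QW QR : QuadraticForm ℝ (Matrix (Fin 2) (Fin 2) ℝ)}
    {W R : FormCoeffs} (hW : W.Describes QW) (hR : R.Describes QR) {f g₁ g₂ : L2I l}
    {k k' : V l} (H : ∀ h ∈ V0 l, inner ℝ (W.op l (strain hl k)) (W.op l (dstrain hl k h)) +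
      inner ℝ (R.op l (dstrain hl k k')) (R.op l (dstrain hl k h)) = work f g₁ g₂ h) :
    WeakEquations QW QR f g₁ g₂ k k' := by
  obtain ⟨n, hn⟩ : ∃ n : Fin 4 → L2I l,
      n = fun i => W.stress (strain hl k) i + R.stress (dstrain hl k k') i := ⟨_, rfl⟩
  have H' : ∀ h ∈ V0 l, inner ℝ (n 0) (D1 l h + mulW hl (Dw l k) (Dw l h)) + 1 / 12 *
      (inner ℝ (n 1) (D2 l h) + inner ℝ (n 2) (D3 l h) + inner ℝ (n 3) (D4 l h)) =
      inner ℝ f (V.w h).1.1 + (inner ℝ g₁ (V.ξ₁ h).1.1 + inner ℝ g₂ (V.ξ₂ h).1.1) := by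
    intro h hh
    rw [← work_apply, ← H h hh, W.inner_op_eq_stress, R.inner_op_eq_stress, dstrain_0, dstrain_1,
      dstrain_2, dstrain_3, hn]
    simp only [inner_add_left]
    ring
  have hadd : ∀ i, ∀ᵐ x ∂(volume.restrict (I l)),
      n i x = W.stress (strain hl k) i x + R.stress (dstrain hl k k') i x := fun i => by
    rw [hn]
    exact Lp.coeFn_add _ _
  have n0 : ∀ᵐ x ∂(volume.restrict (I l)), n 0 x =
      const0 QW * ((V.ξ₁ k).d x + ((V.w k).d x) ^ 2 / 2)
        + const0 QR * ((V.ξ₁ k').d x + (V.w k).d x * (V.w k').d x) := by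
    filter_upwards [hadd 0, stress_0_coe hW (strain hl k), stress_0_coe hR (dstrain hl k k'),
      strain_0_coe hl k, dstrain_0_coe hl k k'] with x h1 h2 h3 h4 h5
    rw [h1, h2, h3, h4, h5]
  have n1 : ∀ᵐ x ∂(volume.restrict (I l)), n 1 x =
      const0 QW * (V.ξ₂ k).dd x + const0 QR * (V.ξ₂ k').dd x := by
    filter_upwards [hadd 1, stress_1_coe hW (strain hl k), stress_1_coe hR (dstrain hl k k')]
      with x h1 h2 h3
    rw [h1, h2, h3, strain_1, dstrain_1, D2_apply, D2_apply]
  have n2 : ∀ᵐ x ∂(volume.restrict (I l)), n 2 x =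
      1 / 2 * (form1_d1 QW ((V.w k).dd x) ((V.θ k).d x)
        + form1_d1 QR ((V.w k').dd x) ((V.θ k').d x)) := by
    filter_upwards [hadd 2, stress_2_coe hW (strain hl k), stress_2_coe hR (dstrain hl k k')]
      with x h1 h2 h3
    rw [h1, h2, h3, strain_2, strain_3, dstrain_2, dstrain_3, mul_add]
    rfl
  have n3 : ∀ᵐ x ∂(volume.restrict (I l)), n 3 x =
      1 / 2 * (form1_d2 QW ((V.w k).dd x) ((V.θ k).d x)
        + form1_d2 QR ((V.w k').dd x) ((V.θ k').d x)) := by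
    filter_upwards [hadd 3, stress_3_coe hW (strain hl k), stress_3_coe hR (dstrain hl k k')]
      with x h1 h2 h3
    rw [h1, h2, h3, strain_2, strain_3, dstrain_2, dstrain_3, mul_add]
    rfl
  have z12 : (0 : L2I l × L2I l) ∈ W12zero l := zero_mem _
  have z22 : (0 : L2I l × L2I l × L2I l) ∈ W22zero l := zero_mem _
  refine ⟨fun φ hφ => ?_, fun φ hφ => ?_, fun φ hφ => ?_, fun φ hφ => ?_⟩
  · have h0 := H' (⟨φ, W12zero_le hφ⟩, 0, 0, 0) (mem_V0.2 ⟨hφ, z22, z22, z12⟩)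
    change inner ℝ (n 0) (φ.2 + mulW hl (Dw l k) 0) + 1 / 12 * (inner ℝ (n 1) (0 : L2I l) +
      inner ℝ (n 2) (0 : L2I l) + inner ℝ (n 3) (0 : L2I l)) = inner ℝ f (0 : L2I l) +
      (inner ℝ g₁ φ.1 + inner ℝ g₂ (0 : L2I l)) at h0
    simp only [map_zero, inner_zero_right, add_zero, mul_zero, zero_add] at h0
    have e : ∫ x in I l, (const0 QW * ((V.ξ₁ k).d x + ((V.w k).d x) ^ 2 / 2)
        + const0 QR * ((V.ξ₁ k').d x + (V.w k).d x * (V.w k').d x)) * φ.2 x =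
        ∫ x in I l, n 0 x * φ.2 x :=
      integral_congr_ae (by filter_upwards [n0] with x hx; rw [hx])
    rw [e, ← inner_eq_integral_mul, ← inner_eq_integral_mul, h0, sub_self]
  · have h0 := H' (0, ⟨φ, W22zero_le hφ⟩, 0, 0) (mem_V0.2 ⟨z12, hφ, z22, z12⟩)
    change inner ℝ (n 0) ((0 : L2I l) + mulW hl (Dw l k) 0) + 1 / 12 * (inner ℝ (n 1) φ.2.2 +
      inner ℝ (n 2) (0 : L2I l) + inner ℝ (n 3) (0 : L2I l)) = inner ℝ f (0 : L2I l) +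
      (inner ℝ g₁ (0 : L2I l) + inner ℝ g₂ φ.1) at h0
    simp only [map_zero, inner_zero_right, add_zero, zero_add] at h0
    have e : ∫ x in I l,
        1 / 12 * (const0 QW * (V.ξ₂ k).dd x + const0 QR * (V.ξ₂ k').dd x) * φ.2.2 x =
        ∫ x in I l, 1 / 12 * (n 1 x * φ.2.2 x) :=
      integral_congr_ae (by filter_upwards [n1] with x hx; rw [hx]; ring)
    rw [e, integral_const_mul, ← inner_eq_integral_mul, ← inner_eq_integral_mul, h0, sub_self]
  · have h0 := H' (0, 0, ⟨φ, W22zero_le hφ⟩, 0) (mem_V0.2 ⟨z12, z22, hφ, z12⟩)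
    obtain ⟨q, hq⟩ : ∃ q : W12 l, q = ⟨φ.2, W12zero_le hφ.2⟩ := ⟨_, rfl⟩
    have hq' : Dw l (0, 0, ⟨φ, W22zero_le hφ⟩, 0) = q := hq.symm
    have hqf : q.1.1 = φ.2.1 := by rw [hq]
    rw [hq'] at h0
    change inner ℝ (n 0) ((0 : L2I l) + mulW hl (Dw l k) q) + 1 / 12 * (inner ℝ (n 1) (0 : L2I l) +
      inner ℝ (n 2) φ.2.2 + inner ℝ (n 3) (0 : L2I l)) = inner ℝ f φ.1 +
      (inner ℝ g₁ (0 : L2I l) + inner ℝ g₂ (0 : L2I l)) at h0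
    simp only [inner_zero_right, add_zero, zero_add] at h0
    have e1 : ∫ x in I l, (const0 QW * ((V.ξ₁ k).d x + ((V.w k).d x) ^ 2 / 2)
        + const0 QR * ((V.ξ₁ k').d x + (V.w k).d x * (V.w k').d x)) * (V.w k).d x * φ.2.1 x =
        ∫ x in I l, n 0 x * mulW hl (Dw l k) q x := by
      refine integral_congr_ae ?_
      filter_upwards [n0, mulW_coe hl (Dw l k) q] with x hx hx'
      rw [hx, hx']
      change _ = _ * ((V.w k).d x * q.1.1 x)
      rw [hqf, mul_assoc]
    have e2 : ∫ x in I l, (form1_d1 QW ((V.w k).dd x) ((V.θ k).d x)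
        + form1_d1 QR ((V.w k').dd x) ((V.θ k').d x)) * φ.2.2 x =
        ∫ x in I l, 2 * (n 2 x * φ.2.2 x) :=
      integral_congr_ae (by filter_upwards [n2] with x hx; rw [hx]; ring)
    rw [e1, e2, integral_const_mul, ← inner_eq_integral_mul, ← inner_eq_integral_mul,
      ← inner_eq_integral_mul]
    linarith
  · have h0 := H' (0, 0, 0, ⟨φ, W12zero_le hφ⟩) (mem_V0.2 ⟨z12, z22, z22, hφ⟩)
    change inner ℝ (n 0) ((0 : L2I l) + mulW hl (Dw l k) 0) + 1 / 12 * (inner ℝ (n 1) (0 : L2I l) +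
      inner ℝ (n 2) (0 : L2I l) + inner ℝ (n 3) φ.2) = inner ℝ f (0 : L2I l) +
      (inner ℝ g₁ (0 : L2I l) + inner ℝ g₂ (0 : L2I l)) at h0
    simp only [map_zero, inner_zero_right, add_zero, zero_add] at h0
    have e2 : ∫ x in I l, (form1_d2 QW ((V.w k).dd x) ((V.θ k).d x)
        + form1_d2 QR ((V.w k').dd x) ((V.θ k').d x)) * φ.2 x =
        ∫ x in I l, 2 * (n 3 x * φ.2 x) :=
      integral_congr_ae (by filter_upwards [n3] with x hx; rw [hx]; ring)
    rw [e2, integral_const_mul, ← inner_eq_integral_mul]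
    linarith

theorem weakEquations_gradient (hl : 0 < l)
    {QW QR : QuadraticForm ℝ (Matrix (Fin 2) (Fin 2) ℝ)} {W R : FormCoeffs}
    (hW : W.Describes QW) (hR : R.Describes QR) (f g₁ g₂ : L2I l) (k₀ : V l) (x : V0 l) :
    WeakEquations QW QR f g₁ g₂ (k₀ + x)
      (-(ribbonSystem hl R W f g₁ g₂ k₀).toGradSystem.F x : V0 l) := by
  obtain ⟨v, hv⟩ : ∃ v, v = (ribbonSystem hl R W f g₁ g₂ k₀).toGradSystem.F x := ⟨_, rfl⟩
  refine weakEquations_of_inner hl hW hR fun h hh => ?_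
  have h1 := (ribbonSystem hl R W f g₁ g₂ k₀).toGradSystem.inner_F x ⟨h, hh⟩
  rw [← hv] at h1 ⊢
  have h2 := (ribbonSystem hl R W f g₁ g₂ k₀).dφ_apply x ⟨h, hh⟩
  rw [ribbonSystem_P, ribbonSystem_dP] at h2
  have h3 : ∀ u : V0 l, (ribbonSystem hl R W f g₁ g₂ k₀).toGradSystem.A x u =
      R.op l (dstrain hl (k₀ + x) u) := fun u =>
    congrArg (R.op l) (ribbonSystem_dP hl R W f g₁ g₂ k₀ x u)
  rw [h3, h3] at h1
  have h4 : dstrain hl (k₀ + x) (-v : V0 l) = -dstrain hl (k₀ + x) v := by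
    change strainL l (-(v : V l)) + (2 : ℝ) • strainB hl (k₀ + x) (-(v : V l)) = -(_ + _)
    rw [map_neg, map_neg, smul_neg, neg_add]
  rw [h4, map_neg, inner_neg_left]
  change _ = (ribbonSystem hl R W f g₁ g₂ k₀).dφ x ⟨h, hh⟩ at h1
  rw [h2] at h1
  change _ = inner ℝ (W.op l (strain hl (k₀ + x))) (W.op l (dstrain hl (k₀ + x) h)) -
    work f g₁ g₂ h at h1
  change _ + -inner ℝ (R.op l (dstrain hl (k₀ + x) v)) (R.op l (dstrain hl (k₀ + x) h)) = _
  linarith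

end Weak

/-! ### Transfer along a bijection -/

section Bijection

variable {X Y Z : Type*} [NormedAddCommGroup X] [NormedSpace ℝ X] [CompleteSpace X]
  [NormedAddCommGroup Y] [InnerProductSpace ℝ Y] (Q : QuadSystem X Y) (e : Z ≃ X)

theorem isStrongUpperGradient_comp :
    IsStrongUpperGradient (fun a b => Q.toGradSystem.D (e a) (e b))
      (fun a => Q.toGradSystem.φ (e a)) (fun a => ENNReal.ofReal (Q.toGradSystem.slope (e a))) :=
  fun a b z hz => Q.toGradSystem.isStrongUpperGradient a b (fun t => e (z t)) hz

theorem exists_isDiscreteSolution_comp {τ : ℝ} (hτ : 0 < τ) (z₀ : Z) : ∃ U : ℕ → Z,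
    IsDiscreteSolution (fun a b => Q.toGradSystem.D (e a) (e b))
      (fun a => Q.toGradSystem.φ (e a)) τ z₀ U := by
  obtain ⟨U, hU0, hU⟩ := Q.exists_isDiscreteSolution hτ (e z₀)
  refine ⟨fun n => e.symm (U n), ?_, fun n v => ?_⟩
  · exact (congrArg e.symm hU0).trans (e.symm_apply_apply z₀)
  · simp only [e.apply_symm_apply]
    exact hU n (e v)

theorem exists_limit_comp (z₀ : Z) {τ : ℕ → ℝ} {U : ℕ → ℕ → Z} (hτ : ∀ j, 0 < τ j)
    (hτ0 : Tendsto τ atTop (𝓝 0))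
    (hU : ∀ j, IsDiscreteSolution (fun a b => Q.toGradSystem.D (e a) (e b))
      (fun a => Q.toGradSystem.φ (e a)) (τ j) z₀ (U j)) :
    ∃ (z : ℝ → Z) (σ : ℕ → ℕ), StrictMono σ ∧ z 0 = z₀ ∧
      (∀ t : ℝ, 0 ≤ t → Tendsto (fun j => Q.toGradSystem.D
        (e (interpolation (τ (σ j)) (U (σ j)) t)) (e (z t))) atTop (𝓝 0)) ∧
      IsCurveOfMaximalSlope (fun a b => Q.toGradSystem.D (e a) (e b))
        (fun a => Q.toGradSystem.φ (e a))
        (fun a => ENNReal.ofReal (Q.toGradSystem.slope (e a))) z := by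
  obtain ⟨x, hx0, hle, hx⟩ := Q.toGradSystem.exists_flow (e z₀)
  have hU' : ∀ j, IsDiscreteSolution Q.toGradSystem.D Q.toGradSystem.φ (τ j) (e z₀)
      (fun n => e (U j n)) := fun j => by
    refine ⟨congrArg e (hU j).1, fun n v => ?_⟩
    have := (hU j).2 n (e.symm v)
    simp only [e.apply_symm_apply] at this
    exact this
  refine ⟨fun t => e.symm (x t), id, strictMono_id, ?_, fun t ht => ?_, ?_⟩
  · exact (congrArg e.symm hx0).trans (e.symm_apply_apply z₀)
  · simp only [e.apply_symm_apply]
    exact Q.toGradSystem.tendsto_discrete hx0 hle hx hτ hτ0 hU' ht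
  · have h := Q.toGradSystem.isCurveOfMaximalSlope_of_flow hle hx
    have h' : x = fun t => e (e.symm (x t)) := funext fun t => (e.apply_symm_apply _).symm
    rw [h'] at h
    exact h

theorem flow_of_maximal_slope_comp {z : ℝ → Z}
    (hz : IsCurveOfMaximalSlope (fun a b => Q.toGradSystem.D (e a) (e b))
      (fun a => Q.toGradSystem.φ (e a))
      (fun a => ENNReal.ofReal (Q.toGradSystem.slope (e a))) z) :
    (∃ B, ∀ t, 0 ≤ t → ‖e (z t)‖ ≤ B) ∧
    MemLp (fun t => -Q.toGradSystem.F (e (z t))) 2 (volume.restrict (Ioi (0 : ℝ))) ∧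
    ∀ t, 0 ≤ t → IntervalIntegrable (fun r => -Q.toGradSystem.F (e (z r))) volume 0 t ∧
      e (z t) = e (z 0) + ∫ r in (0 : ℝ)..t, -Q.toGradSystem.F (e (z r)) := by
  obtain ⟨hc, hint⟩ := Q.toGradSystem.eq_integral_of_maximal_slope (z := fun t => e (z t)) hz
  obtain ⟨hB, hL2⟩ := Q.toGradSystem.bounded_and_memLp_of_integral_equation hc hint
  refine ⟨hB, hL2.neg, fun t ht => ⟨ContinuousOn.intervalIntegrable ?_, hint t ht⟩⟩
  refine (Q.toGradSystem.continuous_F.comp_continuousOn (hc.mono ?_)).neg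
  rw [uIcc_of_le ht]
  exact Icc_subset_Ici_self

end Bijection

section Weak

variable {l : ℝ}

set_option maxSynthPendingDepth 3 in
theorem isW12Curve_add {u₁hat : W12 l} {u₂hat vhat : W22 l} (k₀ : V l) {x v : ℝ → V0 l}
    (hK : ∀ t, k₀ + (x t : V l) ∈ K l u₁hat u₂hat vhat) {B : ℝ} (hB : ∀ t, 0 ≤ t → ‖x t‖ ≤ B)
    (hv : MemLp v 2 (volume.restrict (Ioi (0 : ℝ))))
    (hx : ∀ t, 0 ≤ t → IntervalIntegrable v volume 0 t ∧ x t = x 0 + ∫ r in (0 : ℝ)..t, v r) :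
    IsW12Curve u₁hat u₂hat vhat (fun t => k₀ + (x t : V l)) (fun t => (v t : V l)) := by
  refine ⟨fun t _ => hK t, ⟨‖k₀‖ + B, fun t ht => (norm_add_le _ _).trans
    (add_le_add_right (hB t ht) _)⟩, (V0 l).subtypeL.comp_memLp' hv, fun t ht => ?_⟩
  have h1 : ∫ r in (0 : ℝ)..t, (v r : V l) = ((∫ r in (0 : ℝ)..t, v r : V0 l) : V l) :=
    (V0 l).subtypeL.intervalIntegral_comp_comm (hx t ht).1
  have h2 := congrArg (fun x : V0 l => k₀ + (x : V l)) (hx t ht).2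
  refine h2.trans ?_
  simp only [Submodule.coe_add]
  rw [h1, add_assoc]

theorem exists_weak_solution (hl : 0 < l)
    {QW QR : QuadraticForm ℝ (Matrix (Fin 2) (Fin 2) ℝ)} {W R : FormCoeffs}
    (hW : W.Describes QW) (hR : R.Describes QR) {u₁hat : W12 l} {u₂hat vhat : W22 l}
    {f g₁ g₂ : L2I l} {z : ℝ → S1D l u₁hat u₂hat vhat}
    (hz : IsCurveOfMaximalSlope (D0 QR) (phi0 QW f g₁ g₂) (slope0 QW QR f g₁ g₂) z) :
    ∃ k : ℝ → V l, (∀ t : ℝ, 0 ≤ t → Identified (k t) (z t)) ∧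
      IsWeakSolution QW QR u₁hat u₂hat vhat f g₁ g₂ (k 0) k ∧
      (∀ k₀ : V l, Identified k₀ (z 0) → k 0 = k₀) := by
  rw [D0_eq_D hl (W := W) hR f g₁ g₂, phi0_eq_φ hl (R := R) hW f g₁ g₂,
    slope0_eq_slope hl hW hR f g₁ g₂] at hz
  obtain ⟨⟨B, hB⟩, hL2, hint⟩ := flow_of_maximal_slope_comp _ _ hz
  have hid : ∀ t, Identified (base u₁hat u₂hat vhat +
      (dirEquiv hl u₁hat u₂hat vhat (z t) : V l)) (z t) := fun t => by
    rw [dirEquiv_apply, base_add_dir]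
    exact identified_state _
  exact ⟨_, fun t _ => hid t, ⟨rfl, _, isW12Curve_add _ (fun t => (hid t).mem_K hl) hB hL2 hint,
    Eventually.of_forall fun t => weakEquations_gradient hl hW hR f g₁ g₂ _ _⟩,
    fun k hk => (hid 0).unique_left hk⟩

end Weak

end

end Ribbon

theorem theorem2p2 (l : ℝ) (hl : 0 < l)
    (QW QR : QuadraticForm ℝ (Matrix (Fin 2) (Fin 2) ℝ))
    (hQW : Ribbon.IsAdmissibleForm QW) (hQR : Ribbon.IsAdmissibleForm QR)
    (u₁hat : Ribbon.W12 l) (u₂hat vhat : Ribbon.W22 l) (f g₁ g₂ : Ribbon.L2I l) :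
    -- the local slope is a strong upper gradient, as the notion of a curve of maximal slope requires
    Ribbon.IsStrongUpperGradient (X := Ribbon.S1D l u₁hat u₂hat vhat) (Ribbon.D0 QR)
      (Ribbon.phi0 QW f g₁ g₂) (Ribbon.slope0 QW QR f g₁ g₂) ∧
    (∀ k₀ ∈ Ribbon.K l u₁hat u₂hat vhat,
      -- the initial datum `(ξ₁⁰, ξ₂⁰, w⁰, θ⁰)` determines a point `z₀ = (y⁰, w⁰, θ⁰)`
      ∃ z₀ : Ribbon.S1D l u₁hat u₂hat vhat, (∀ z, Ribbon.Identified k₀ z ↔ z = z₀) ∧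
        -- (i) existence of time-discrete solutions
        (∀ τ : ℝ, 0 < τ → ∃ U : ℕ → Ribbon.S1D l u₁hat u₂hat vhat,
          Ribbon.IsDiscreteSolution (Ribbon.D0 QR) (Ribbon.phi0 QW f g₁ g₂) τ z₀ U) ∧
        -- (i) convergence of a subsequence to a curve of maximal slope
        (∀ (τ : ℕ → ℝ) (U : ℕ → ℕ → Ribbon.S1D l u₁hat u₂hat vhat),
          (∀ j, 0 < τ j) → Tendsto τ atTop (𝓝 0) →
          (∀ j, Ribbon.IsDiscreteSolution (Ribbon.D0 QR) (Ribbon.phi0 QW f g₁ g₂)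
            (τ j) z₀ (U j)) →
          ∃ (z : ℝ → Ribbon.S1D l u₁hat u₂hat vhat) (σ : ℕ → ℕ), StrictMono σ ∧ z 0 = z₀ ∧
            (∀ t : ℝ, 0 ≤ t → Tendsto
              (fun j => Ribbon.D0 QR (Ribbon.interpolation (τ (σ j)) (U (σ j)) t) (z t))
              atTop (𝓝 0)) ∧
            Ribbon.IsCurveOfMaximalSlope (Ribbon.D0 QR) (Ribbon.phi0 QW f g₁ g₂)
              (Ribbon.slope0 QW QR f g₁ g₂) z)) ∧
    -- (ii) identification of every curve of maximal slope with a weak solution; its initial datum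
    -- is the one that is identified with the initial point of the curve
    (∀ z : ℝ → Ribbon.S1D l u₁hat u₂hat vhat,
      Ribbon.IsCurveOfMaximalSlope (Ribbon.D0 QR) (Ribbon.phi0 QW f g₁ g₂)
        (Ribbon.slope0 QW QR f g₁ g₂) z →
      ∃ k : ℝ → Ribbon.V l,
        (∀ t : ℝ, 0 ≤ t → Ribbon.Identified (k t) (z t)) ∧
        Ribbon.IsWeakSolution QW QR u₁hat u₂hat vhat f g₁ g₂ (k 0) k ∧
        (∀ k₀ : Ribbon.V l, Ribbon.Identified k₀ (z 0) → k 0 = k₀)) := by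
  obtain ⟨W, hW⟩ := Ribbon.exists_describes hQW
  obtain ⟨R, hR⟩ := Ribbon.exists_describes hQR
  refine ⟨?_, fun k hk => ?_, fun z hz => Ribbon.exists_weak_solution hl hW hR hz⟩
  · rw [Ribbon.D0_eq_D hl (W := W) hR f g₁ g₂, Ribbon.phi0_eq_φ hl (R := R) hW f g₁ g₂,
      Ribbon.slope0_eq_slope hl hW hR f g₁ g₂]
    exact Ribbon.isStrongUpperGradient_comp _ _
  · obtain ⟨z₀, hz₀⟩ := Ribbon.exists_identified hl hk
    refine ⟨z₀, fun z => ⟨fun h => h.unique_right hz₀, fun h => h ▸ hz₀⟩, ?_⟩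
    rw [Ribbon.D0_eq_D hl (W := W) hR f g₁ g₂, Ribbon.phi0_eq_φ hl (R := R) hW f g₁ g₂,
      Ribbon.slope0_eq_slope hl hW hR f g₁ g₂]
    exact ⟨fun τ hτ => Ribbon.exists_isDiscreteSolution_comp _ _ hτ z₀,
      fun τ U hτ hτ0 hU => Ribbon.exists_limit_comp _ _ z₀ hτ hτ0 hU⟩
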